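/- Let $S_n$ denote either the ring $\mathbb{C}\{x_1,\dots,x_n\}$ of convergent power series (local analytic case) or the polynomial ring $\mathbb{C}[x_1,\dots,x_n]$ (algebraic case). Accordingly, let a subspace of $\mathbb{C}^n$ be a nonempty germ at $0$ of an analytic subset of $\mathbb{C}^n$, respectively a nonempty algebraic subset of $\mathbb{C}^n$, with its reduced structure: $I_X\subseteq S_n$ is the (radical) ideal of all functions vanishing on $X$. It is equidimensional of codimension $k$ if every minimal prime of $I_X$ has height $k$. Let $\mathrm{Der}_{\mathbb{C}^n}=\bigoplus_i S_n\,\partial_{x_i}$, and for $X$ reduced equidimensional of codimension $k$ set $$\mathrm{Der}^k(-\log X)=\Big\{\delta\in\bigwedge^k\mathrm{Der}_{\mathbb{C}^n}\ \Big|\ \langle\delta,\mathrm{d}f_1\wedge\dots\wedge\mathrm{d}f_k\rangle\in I_X\ \text{ for all } f_1,\dots,f_k\in I_X\Big\}.$$ Call $X$ free if the $S_n$-module $\mathrm{Der}^k(-\log X)$ has projective dimension $k-1$ (the zero module has projective dimension $-\infty$). **Proposition.** In either case, let $X_1\subseteq\mathbb{C}^{n_1}$ (coordinates $x_i$) and $X_2\subseteq\mathbb{C}^{n_2}$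 (coordinates $y_j$) be reduced equidimensional subspaces of the same codimension $k$, let $S=S_{n_1+n_2}$ and $$X_1*X_2=(X_1\times\mathbb{C}^{n_2})\cup(\mathbb{C}^{n_1}\times X_2)\subseteq\mathbb{C}^{n_1+n_2}.$$ Then, as an internal direct sum of $S$-submodules of $\bigwedge^k\mathrm{Der}_{\mathbb{C}^{n_1+n_2}}$, $$\mathrm{Der}^k(-\log X_1*X_2)=\mathrm{Der}^k(-\log X_1)\oplus\mathrm{Der}^k(-\log X_2)\oplus D_{1,2}.$$ Here $\mathrm{Der}^k(-\log X_i)$ is identified with the $S$-submodule generated by its image under the canonical map $\bigwedge^k\mathrm{Der}_{\mathbb{C}^{n_i}}\to\bigwedge^k\mathrm{Der}_{\mathbb{C}^{n_1+n_2}}$, and $D_{1,2}$ is the submodule, which is free, generated by the mixed $k$-vectors $\partial_{x_{i_1}}\wedge\dots\wedge\partial_{x_{i_p}}\wedge\partial_{y_{j_1}}\wedge\dots\wedge\partial_{y_{j_{k-p}}}$ with $1\le p\le k-1$. Moreover $X_1*X_2$ is free (that is, it is reduced equidimensional of codimension $k$ and the projective dimension of $\mathrm{Der}^k(-\log X_1*X_2)$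 is $k-1$) if and only if both $X_1$ and $X_2$ are free. -/

import Mathlib

open Filter Topology
open scoped BigOperators

noncomputable section

namespace LogProd

/-! ### Multivector fields and logarithmic multivector fields

Let `S` be a coordinate ring with coordinates indexed by `σ`.  The free module of vector fields
is written `σ → S`: the vector `v` stands for the vector field `∑ i, v i ∂ᵢ`. -/

section General

variable {S : Type} [CommRing S] [Algebra ℂ S] {σ : Type} [Fintype σ]

/-- The differential `df` of `f`, as a linear form on vector fields: `∑ i, vᵢ ∂ᵢ ↦ ∑ i, vᵢ ∂ᵢ(f)`.
The family `d` gives the partial derivatives `∂ᵢ`. -/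
def differential (d : σ → Derivation ℂ S S) (f : S) : Module.Dual S (σ → S) :=
  ∑ i, d i f • LinearMap.proj i

/-- The value `⟨δ, df₁ ∧ ⋯ ∧ df_k⟩` of the usual pairing of `k`-vector fields and `k`-forms. -/
def pairing (d : σ → Derivation ℂ S S) {k : ℕ} (δ : ⋀[S]^k (σ → S)) (f : Fin k → S) : S :=
  exteriorPower.pairingDual S (σ → S) k
    (exteriorPower.ιMulti S k fun j => differential d (f j)) δ

/-- The module of multi-logarithmic `k`-vector fields of the ideal `I`: all `δ` such that
`⟨δ, df₁ ∧ ⋯ ∧ df_k⟩ ∈ I` for all `f₁, …, f_k ∈ I`. -/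
def logModule (d : σ → Derivation ℂ S S) (I : Ideal S) (k : ℕ) :
    Submodule S (⋀[S]^k (σ → S)) where
  carrier := {δ | ∀ f : Fin k → S, (∀ j, f j ∈ I) → pairing d δ f ∈ I}
  add_mem' {a b} ha hb f hf := by
    have := I.add_mem (ha f hf) (hb f hf)
    simpa [pairing] using this
  zero_mem' f _ := by simp [pairing]
  smul_mem' c a ha f hf := by
    have := I.mul_mem_left c (ha f hf)
    simpa [pairing] using this

end General

section Extension

variable {R S : Type} [CommRing R] [CommRing S]

/-- The map induced on exterior powers by a semilinear map, given on decomposable elements by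
`v₁ ∧ ⋯ ∧ v_k ↦ g v₁ ∧ ⋯ ∧ g v_k` (see `wedgeMap_ιMulti`). -/
def wedgeMap {M N : Type} [AddCommGroup M] [Module R M] [AddCommGroup N] [Module S N]
    (φ : R →+* S) (g : M →ₛₗ[φ] N) (k : ℕ) : ⋀[R]^k M →ₛₗ[φ] ⋀[S]^k N :=
  letI : Module R (⋀[S]^k N) := Module.compHom _ φ
  let A : M [⋀^Fin k]→ₗ[R] (⋀[S]^k N) :=
    { toFun := fun v => exteriorPower.ιMulti S k (g ∘ v)
      map_update_add' := by
        intro _ v i x y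
        classical
        have h (z : M) : g ∘ Function.update v i z = Function.update (g ∘ v) i (g z) :=
          Function.comp_update g v i z
        have e := (exteriorPower.ιMulti S k).map_update_add (g ∘ v) i (g x) (g y)
        rw [← map_add g, ← h, ← h, ← h] at e
        convert e
      map_update_smul' := by
        intro _ v i c x
        classical
        have h (z : M) : g ∘ Function.update v i z = Function.update (g ∘ v) i (g z) :=
          Function.comp_update g v i z
        have e := (exteriorPower.ιMulti S k).map_update_smul (g ∘ v) i (φ c) (g x)
        rw [← map_smulₛₗ g, ← h, ← h] at e
        refine Eq.trans ?_ (e.trans ?_)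
        · congr!
        · exact congrArg (fun w => φ c • exteriorPower.ιMulti S k w) (by congr!)
      map_eq_zero_of_eq' := by
        intro v i j hij hne
        exact (exteriorPower.ιMulti S k).map_eq_zero_of_eq (g ∘ v) (congrArg g hij) hne }
  { toFun := exteriorPower.alternatingMapLinearEquiv A
    map_add' := map_add _
    map_smul' := fun c x => map_smul (exteriorPower.alternatingMapLinearEquiv A) c x }

theorem wedgeMap_ιMulti {M N : Type} [AddCommGroup M] [Module R M] [AddCommGroup N] [Module S N]
    (φ : R →+* S) (g : M →ₛₗ[φ] N) (k : ℕ) (v : Fin k → M) :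
    wedgeMap φ g k (exteriorPower.ιMulti R k v) = exteriorPower.ιMulti S k (g ∘ v) := by
  let _ : Module R (⋀[S]^k N) := Module.compHom _ φ
  exact exteriorPower.alternatingMapLinearEquiv_apply_ιMulti _ v

variable {σ ρ : Type} [Fintype σ] [DecidableEq ρ]

/-- The canonical map on vector fields attached to an inclusion `φ` of coordinate rings which
sends the `i`-th coordinate to the `e i`-th one: `∑ i, vᵢ ∂ᵢ ↦ ∑ i, φ(vᵢ) ∂_{e i}`. -/
def extendField (φ : R →+* S) (e : σ → ρ) : (σ → R) →ₛₗ[φ] (ρ → S) where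
  toFun v := ∑ i, φ (v i) • Pi.single (e i) (1 : S)
  map_add' v w := by simp [add_smul, Finset.sum_add_distrib]
  map_smul' c v := by simp [mul_smul, Finset.smul_sum]

/-- The `S`-submodule of `⋀ᵏ Der` generated by the image of a submodule `N` under the canonical
map `ι` on `k`-vector fields. -/
def extendSubmodule (φ : R →+* S) (e : σ → ρ) (k : ℕ) (N : Submodule R (⋀[R]^k (σ → R))) :
    Submodule S (⋀[S]^k (ρ → S)) :=
  Submodule.span S (wedgeMap φ (extendField φ e) k '' (N : Set (⋀[R]^k (σ → R))))

end Extension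

/-- The module `D_{1,2}` of mixed `k`-vector fields: it is generated by the wedge products of `k`
coordinate fields of which at least one is a `∂_{xᵢ}` and at least one is a `∂_{yⱼ}`. -/
def mixed (S : Type) [CommRing S] (σ τ : Type) [DecidableEq σ] [DecidableEq τ] (k : ℕ) :
    Submodule S (⋀[S]^k (σ ⊕ τ → S)) :=
  Submodule.span S
    {w | ∃ g : Fin k → σ ⊕ τ, (∃ a, (g a).isLeft = true) ∧ (∃ b, (g b).isRight = true) ∧
      w = exteriorPower.ιMulti S k fun a => Pi.single (g a) (1 : S)}

/-- `X₁ * X₂ = X₁ × ℂ^τ ∪ ℂ^σ × X₂`. -/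
def starProd {σ τ : Type} (X₁ : Set (σ → ℂ)) (X₂ : Set (τ → ℂ)) : Set (σ ⊕ τ → ℂ) :=
  {z | (fun i => z (Sum.inl i)) ∈ X₁} ∪ {z | (fun j => z (Sum.inr j)) ∈ X₂}

/-! ### The algebraic case: `S = ℂ[x]` -/

section Algebraic

variable {σ : Type} [Fintype σ]

/-- `X` is a (nonempty) algebraic subset of affine space, all of whose irreducible components have
codimension `k`. -/
structure IsEquidimAlg (X : Set (σ → ℂ)) (k : ℕ) : Prop where
  algebraic : ∃ J : Ideal (MvPolynomial σ ℂ), X = MvPolynomial.zeroLocus ℂ J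
  nonempty : X.Nonempty
  height : ∀ p ∈ (MvPolynomial.vanishingIdeal ℂ X).minimalPrimes, p.height = k

/-- `Derᵏ(-log X)` over the polynomial ring. -/
def derLogAlg (X : Set (σ → ℂ)) (k : ℕ) :
    Submodule (MvPolynomial σ ℂ) (⋀[MvPolynomial σ ℂ]^k (σ → MvPolynomial σ ℂ)) :=
  logModule (fun i => MvPolynomial.pderiv i) (MvPolynomial.vanishingIdeal ℂ X) k

/-- The submodule of `⋀ᵏ Der_{ℂ^ρ}` generated by the image of `Derᵏ(-log X)`, where `e` includes the
coordinates of `ℂ^σ` into those of `ℂ^ρ`. -/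
def extDerLogAlg {ρ : Type} [DecidableEq ρ] (e : σ ↪ ρ) (X : Set (σ → ℂ)) (k : ℕ) :
    Submodule (MvPolynomial ρ ℂ) (⋀[MvPolynomial ρ ℂ]^k (ρ → MvPolynomial ρ ℂ)) :=
  extendSubmodule (MvPolynomial.rename (R := ℂ) e).toRingHom e k (derLogAlg X k)

/-- `X` is equidimensional of codimension `k` and free, i.e. `Derᵏ(-log X)` has projective
dimension `k - 1`. -/
def IsFreeAlg (X : Set (σ → ℂ)) (k : ℕ) : Prop :=
  IsEquidimAlg X k ∧
    CategoryTheory.projectiveDimension (ModuleCat.of (MvPolynomial σ ℂ) (derLogAlg X k)) + 1 = k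

end Algebraic

/-! ### Convergent power series -/

section Convergent

variable {σ τ : Type}

/-- The power series `f` converges absolutely on some polydisc of positive radius. -/
def IsConvergent (f : MvPowerSeries σ ℂ) : Prop :=
  ∃ r : ℝ, 0 < r ∧ Summable fun m : σ →₀ ℕ => ‖MvPowerSeries.coeff m f‖ * r ^ m.degree

theorem summable_mono {f : MvPowerSeries σ ℂ} {r s : ℝ} (hr : 0 ≤ r) (hrs : r ≤ s)
    (h : Summable fun m : σ →₀ ℕ => ‖MvPowerSeries.coeff m f‖ * s ^ m.degree) :
    Summable fun m : σ →₀ ℕ => ‖MvPowerSeries.coeff m f‖ * r ^ m.degree :=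
  h.of_nonneg_of_le (fun m => by positivity) (fun m => by gcongr)

theorem IsConvergent.add {f g : MvPowerSeries σ ℂ} (hf : IsConvergent f) (hg : IsConvergent g) :
    IsConvergent (f + g) := by
  obtain ⟨r, hr, hf⟩ := hf
  obtain ⟨s, hs, hg⟩ := hg
  have ht : 0 < min r s := lt_min hr hs
  refine ⟨min r s, ht, ((summable_mono ht.le (min_le_left r s) hf).add
    (summable_mono ht.le (min_le_right r s) hg)).of_nonneg_of_le (fun m => by positivity) ?_⟩
  intro m
  rw [map_add, ← add_mul]
  gcongr
  exact norm_add_le _ _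

theorem summable_antidiagonal [DecidableEq σ] {F G : (σ →₀ ℕ) → ℝ} (hF : Summable F)
    (hG : Summable G) (h1 : 0 ≤ F) (h2 : 0 ≤ G) :
    Summable fun n => ∑ p ∈ Finset.HasAntidiagonal.antidiagonal n, F p.1 * G p.2 :=
  summable_sum_mul_antidiagonal_of_summable_mul (hF.mul_of_nonneg hG h1 h2)

theorem tsum_mul_antidiagonal [DecidableEq σ] {F G : (σ →₀ ℕ) → ℂ} (hF : Summable fun m => ‖F m‖)
    (hG : Summable fun m => ‖G m‖) :
    (∑' m, F m) * ∑' m, G m =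
      ∑' n, ∑ p ∈ Finset.HasAntidiagonal.antidiagonal n, F p.1 * G p.2 :=
  hF.of_norm.tsum_mul_tsum_eq_tsum_sum_antidiagonal hG.of_norm (summable_mul_of_summable_norm hF hG)

theorem IsConvergent.mul [DecidableEq σ] {f g : MvPowerSeries σ ℂ} (hf : IsConvergent f)
    (hg : IsConvergent g) : IsConvergent (f * g) := by
  obtain ⟨r, hr, hf⟩ := hf
  obtain ⟨s, hs, hg⟩ := hg
  obtain ⟨t, ht, htr, hts⟩ : ∃ t : ℝ, 0 < t ∧ t ≤ r ∧ t ≤ s :=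
    ⟨min r s, lt_min hr hs, min_le_left r s, min_le_right r s⟩
  have hf' := summable_mono ht.le htr hf
  have hg' := summable_mono ht.le hts hg
  have hf0 (f : MvPowerSeries σ ℂ) :
      0 ≤ fun m : σ →₀ ℕ => ‖MvPowerSeries.coeff m f‖ * t ^ m.degree := by
    intro m
    exact mul_nonneg (norm_nonneg _) (pow_nonneg ht.le _)
  have h := summable_antidiagonal hf' hg' (hf0 f) (hf0 g)
  refine ⟨t, ht, h.of_nonneg_of_le (hf0 _) ?_⟩
  intro m
  rw [MvPowerSeries.coeff_mul]
  refine (mul_le_mul_of_nonneg_right (norm_sum_le _ _) (pow_nonneg ht.le _)).trans ?_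
  rw [Finset.sum_mul]
  refine Finset.sum_le_sum fun p hp => le_of_eq ?_
  have hp' : p.1 + p.2 = m := Finset.HasAntidiagonal.mem_antidiagonal.1 hp
  have hd : m.degree = p.1.degree + p.2.degree := by rw [← hp', map_add]
  rw [hd, pow_add, norm_mul]
  exact mul_mul_mul_comm _ _ _ _

theorem isConvergent_C (c : ℂ) : IsConvergent (MvPowerSeries.C c : MvPowerSeries σ ℂ) := by
  classical
  refine ⟨1, one_pos, summable_of_ne_finset_zero (s := {0}) ?_⟩
  intro m hm
  rw [MvPowerSeries.coeff_C, if_neg (by simpa using hm)]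
  simp

/-- The ring `ℂ{x}` of convergent power series. -/
def Conv (σ : Type) : Subalgebra ℂ (MvPowerSeries σ ℂ) where
  carrier := {f | IsConvergent f}
  add_mem' := IsConvergent.add
  mul_mem' := by classical exact IsConvergent.mul
  algebraMap_mem' := isConvergent_C

theorem IsConvergent.pderiv {f : MvPowerSeries σ ℂ} (hf : IsConvergent f) (i : σ) :
    IsConvergent (MvPowerSeries.pderiv ℂ i f) := by
  obtain ⟨r, hr, hf⟩ := hf
  have hinj : Function.Injective fun m : σ →₀ ℕ => m + Finsupp.single i 1 :=
    add_left_injective _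
  refine ⟨r / 2, by positivity, ((hf.comp_injective hinj).mul_right r⁻¹).of_nonneg_of_le
    (fun m => by positivity) ?_⟩
  intro m
  have h1 : ((m i : ℝ) + 1) ≤ 2 ^ m.degree := by
    have h2 : m i + 1 ≤ 2 ^ m i := Nat.lt_two_pow_self
    have h3 : m i ≤ m.degree := Finsupp.le_degree i m
    have h4 : m i + 1 ≤ 2 ^ m.degree := h2.trans (Nat.pow_le_pow_right (by norm_num) h3)
    exact_mod_cast h4
  have h5 : ‖((m i : ℂ) + 1)‖ = (m i : ℝ) + 1 := by
    have := Complex.norm_natCast (m i + 1)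
    push_cast at this
    exact this
  simp only [Function.comp_apply, MvPowerSeries.coeff_pderiv, norm_mul, h5, map_add,
    Finsupp.degree_single, pow_succ, div_pow]
  calc ‖MvPowerSeries.coeff (m + Finsupp.single i 1) f‖ * ((m i : ℝ) + 1)
        * (r ^ m.degree / 2 ^ m.degree)
      ≤ ‖MvPowerSeries.coeff (m + Finsupp.single i 1) f‖ * 2 ^ m.degree
        * (r ^ m.degree / 2 ^ m.degree) := by gcongr
    _ = _ := by field_simp

/-- The partial derivative `∂ᵢ` on `ℂ{x}`. -/
def convPDeriv (i : σ) : Derivation ℂ (Conv σ) (Conv σ) :=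
  Derivation.mk'
    { toFun := fun f => ⟨MvPowerSeries.pderiv ℂ i f.1, IsConvergent.pderiv f.2 i⟩
      map_add' := fun f g => Subtype.ext (map_add _ f.1 g.1)
      map_smul' := fun c f => Subtype.ext ((MvPowerSeries.pderiv ℂ i).map_smul c f.1) }
    (fun f g => Subtype.ext ((MvPowerSeries.pderiv ℂ i).leibniz f.1 g.1))

theorem degree_embDomain (e : σ ↪ τ) (m : σ →₀ ℕ) : (m.embDomain e).degree = m.degree := by
  simp [Finsupp.degree_apply, Finsupp.support_embDomain]

theorem IsConvergent.rename {f : MvPowerSeries σ ℂ} (hf : IsConvergent f) (e : σ ↪ τ) :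
    IsConvergent (MvPowerSeries.rename e f) := by
  obtain ⟨r, hr, hf⟩ := hf
  refine ⟨r, hr, ((Finsupp.embDomain_injective e).summable_iff ?_).1 ?_⟩
  · intro m hm
    rw [MvPowerSeries.coeff_rename_eq_zero, norm_zero, zero_mul]
    rintro ⟨x, rfl⟩
    exact hm ⟨x, Finsupp.embDomain_eq_mapDomain e x⟩
  · convert hf using 2 with m
    rw [Function.comp_apply, MvPowerSeries.coeff_embDomain_rename, degree_embDomain]

/-- The inclusion of rings of convergent power series `ℂ{x_σ} → ℂ{x_τ}` induced by an inclusion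
of the variables. -/
def convRename (e : σ ↪ τ) : Conv σ →+* Conv τ where
  toFun f := ⟨MvPowerSeries.rename e f.1, IsConvergent.rename f.2 e⟩
  map_one' := Subtype.ext (map_one _)
  map_mul' f g := Subtype.ext (map_mul _ f.1 g.1)
  map_zero' := Subtype.ext (map_zero _)
  map_add' f g := Subtype.ext (map_add _ f.1 g.1)

/-- The value at `x` of a power series, i.e. the sum of the series (meaningful for `x` close to `0`
when the series is convergent). -/
def evalSeries (f : MvPowerSeries σ ℂ) (x : σ → ℂ) : ℂ :=
  ∑' m : σ →₀ ℕ, MvPowerSeries.coeff m f * m.prod fun i a => x i ^ a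

theorem norm_monomial_le {x : σ → ℂ} {r : ℝ} (hx : ∀ i, ‖x i‖ ≤ r) (m : σ →₀ ℕ) :
    ‖m.prod fun i a => x i ^ a‖ ≤ r ^ m.degree := by
  rw [Finsupp.prod, norm_prod, Finsupp.degree_apply, ← Finset.prod_pow_eq_pow_sum]
  refine Finset.prod_le_prod (fun i _ => norm_nonneg _) fun i _ => ?_
  rw [norm_pow]
  exact pow_le_pow_left₀ (norm_nonneg _) (hx i) _

/-- A convergent power series converges absolutely at all points close to `0`. -/
theorem IsConvergent.eventually_summable [Fintype σ] {f : MvPowerSeries σ ℂ}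
    (hf : IsConvergent f) : ∀ᶠ x : σ → ℂ in 𝓝 0,
      Summable fun m : σ →₀ ℕ => ‖MvPowerSeries.coeff m f * m.prod fun i a => x i ^ a‖ := by
  obtain ⟨r, hr, hf⟩ := hf
  filter_upwards [Metric.closedBall_mem_nhds (0 : σ → ℂ) hr] with x hx
  have hx' : ∀ i, ‖x i‖ ≤ r := fun i =>
    (norm_le_pi_norm x i).trans (by simpa using hx)
  refine hf.of_nonneg_of_le (fun m => norm_nonneg _) fun m => ?_
  rw [norm_mul]
  gcongr
  exact norm_monomial_le hx' m

theorem eventually_evalSeries_add [Fintype σ] {f g : MvPowerSeries σ ℂ} (hf : IsConvergent f)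
    (hg : IsConvergent g) : ∀ᶠ x : σ → ℂ in 𝓝 0,
      evalSeries (f + g) x = evalSeries f x + evalSeries g x := by
  filter_upwards [hf.eventually_summable, hg.eventually_summable] with x h1 h2
  simp only [evalSeries, map_add, add_mul]
  exact h1.of_norm.tsum_add h2.of_norm

theorem eventually_evalSeries_mul [Fintype σ] {f g : MvPowerSeries σ ℂ} (hf : IsConvergent f)
    (hg : IsConvergent g) : ∀ᶠ x : σ → ℂ in 𝓝 0,
      evalSeries (f * g) x = evalSeries f x * evalSeries g x := by
  classical
  filter_upwards [hf.eventually_summable, hg.eventually_summable] with x h1 h2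
  rw [evalSeries, evalSeries, evalSeries, tsum_mul_antidiagonal h1 h2]
  refine tsum_congr fun m => ?_
  rw [MvPowerSeries.coeff_mul, Finset.sum_mul]
  refine Finset.sum_congr rfl fun p hp => ?_
  have hp' : p.1 + p.2 = m := Finset.HasAntidiagonal.mem_antidiagonal.1 hp
  have hd : (m.prod fun i a => x i ^ a) =
      (p.1.prod fun i a => x i ^ a) * p.2.prod fun i a => x i ^ a := by
    rw [← hp', Finsupp.prod_add_index' (by simp) (by intro i a b; exact pow_add _ _ _)]
  rw [hd]
  exact mul_mul_mul_comm _ _ _ _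

end Convergent

/-! ### The local analytic case: `S = ℂ{x}`

A germ at `0` of a subset of `ℂ^σ` is given by a subset `X` representing it; all notions below
depend only on `X` in a neighbourhood of `0`. -/

section Germ

variable {σ : Type} [Fintype σ]

/-- The ideal of the convergent power series that vanish on the germ of `X` at `0`. -/
def germIdeal (X : Set (σ → ℂ)) : Ideal (Conv σ) where
  carrier := {f | ∀ᶠ x in 𝓝 (0 : σ → ℂ), x ∈ X → evalSeries f.1 x = 0}
  zero_mem' := Eventually.of_forall fun x _ => by simp [evalSeries]
  add_mem' {f g} hf hg := by
    filter_upwards [hf, hg, eventually_evalSeries_add f.2 g.2] with x h1 h2 h3 hx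
    have : evalSeries (f + g).1 x = evalSeries f.1 x + evalSeries g.1 x := h3
    rw [this, h1 hx, h2 hx, add_zero]
  smul_mem' c f hf := by
    filter_upwards [hf, eventually_evalSeries_mul c.2 f.2] with x h1 h2 hx
    have : evalSeries (c • f).1 x = evalSeries c.1 x * evalSeries f.1 x := h2
    rw [this, h1 hx, mul_zero]

/-- The germ of `X` at `0` is a (nonempty) germ of an analytic set, all of whose irreducible
components have codimension `k`. -/
structure IsEquidimGerm (X : Set (σ → ℂ)) (k : ℕ) : Prop where
  analytic : ∃ F : Finset (Conv σ),
    ∀ᶠ x in 𝓝 (0 : σ → ℂ), x ∈ X ↔ ∀ f ∈ F, evalSeries f.1 x = 0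
  zero_mem : (0 : σ → ℂ) ∈ X
  height : ∀ p ∈ (germIdeal X).minimalPrimes, p.height = k

/-- `Derᵏ(-log X)` over the ring of convergent power series. -/
def derLogGerm (X : Set (σ → ℂ)) (k : ℕ) :
    Submodule (Conv σ) (⋀[Conv σ]^k (σ → Conv σ)) :=
  logModule convPDeriv (germIdeal X) k

/-- The submodule of `⋀ᵏ Der_{ℂ^ρ}` generated by the image of `Derᵏ(-log X)`, where `e` includes the
coordinates of `ℂ^σ` into those of `ℂ^ρ`. -/
def extDerLogGerm {ρ : Type} [DecidableEq ρ] (e : σ ↪ ρ) (X : Set (σ → ℂ)) (k : ℕ) :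
    Submodule (Conv ρ) (⋀[Conv ρ]^k (ρ → Conv ρ)) :=
  extendSubmodule (convRename e) e k (derLogGerm X k)

/-- The germ of `X` at `0` is equidimensional of codimension `k` and free, i.e. `Derᵏ(-log X)` has
projective dimension `k - 1`. -/
def IsFreeGerm (X : Set (σ → ℂ)) (k : ℕ) : Prop :=
  IsEquidimGerm X k ∧
    CategoryTheory.projectiveDimension (ModuleCat.of (Conv σ) (derLogGerm X k)) + 1 = k

end Germ

end LogProd

end

/-!
Write `R`, `T` for the coordinate rings of the two factors and `S` for that of the product; both
the polynomial and the convergent case are instances of the structures `IsExpansion`, `IsProduct`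
and `IsCoordinateRing`, through which the argument is carried out once.

**Expansion.** An element of `S` is a series `∑ f_α y^α` with coefficients `f_α` in `R`. The key
property (`IsExpansion.mem_span`) is that membership of a vector over `S` in a submodule extended
from `R` can be tested coefficient by coefficient. For polynomials this is clear; for convergent
power series it follows from Krull's intersection theorem. Consequences are the flatness of `S`
over `R`, the fact that extensions of primes are primes of the same height, and, together with the
identity theorem, the fact that the ideal of a cylinder is the extension of the ideal of its base.
The ideal of `X₁ * X₂` is therefore the intersection of the extensions of `I₁` and `I₂`, so
`X₁ * X₂` is again equidimensional of codimension `k`.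

**Decomposition.** The coordinate projections split a `k`-vector field into its components in the
`x`-directions, in the `y`-directions and a mixed part. Mixed fields are logarithmic, since a
derivation in the `y`-directions preserves the extension of `I₁` and vice versa. If `δ` is
logarithmic along `X₁ * X₂`, testing it on `u h₁, …, u h_k` with `h_b` in `I₁` and a fixed nonzero
`u` in `I₂` gives `u ^ k` times the test of the `x`-component on `h₁, …, h_k`, modulo the extension
of `I₁`; there `u` is a nonzerodivisor, so the coefficients of the expansion of the `x`-component
are logarithmic along `X₁` (`IsProduct.map_coordProj_mem`). This gives the direct sum.

**Freeness.** The projective dimension of a module does not change under the flat extension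
`R → S`, because `y ↦ 0` is a retraction of it (`hasProjectiveDimensionLT_baseChange_iff`). So the
projective dimension over `S` of the module of `X₁ * X₂` is less than `k` if and only if those of
the modules of `X₁` and `X₂` are. What remains is the lower bound `k - 1`, valid for every reduced
equidimensional subspace (`not_hasProjectiveDimensionLT_logModule`): at a component with prime `p`
there are derivations `D₁, …, D_k` and functions of `p` whose Jacobian matrix is triangular modulo
`p` with nonzero diagonal, and `p` contains a regular sequence of length `k` (`NormalAt`). The field
`u D₁ ∧ ⋯ ∧ D_k`, where `u` cuts out the other components, is not logarithmic, but each element of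
`p` moves it into the logarithmic module; for a module of projective dimension less than `k - 1`
this is ruled out by the vanishing of `Ext` groups along the regular sequence. The data `NormalAt`
come from Noether normalization, one variable at a time.

**Convergent power series.** For this ring, Weierstrass division is proved by a geometric series in
weighted `ℓ¹`-norms. After a linear change of coordinates it makes the quotient by a nonzero series
finite over the ring in one variable less, which yields both the Noetherian property and the
normalization.

In codimension `k = 0` the vanishing ideals are zero, all the modules vanish, and no subspace is
free.
-/

noncomputable section

namespace LogProd

/-! ### Weighted norms of power series -/

section WeightedNorm

open scoped NNReal ENNReal
open MvPowerSeries

variable {σ : Type}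

/-- The value `∏ i, w i ^ m i` of the monomial with exponent `m` at the polyradius `w`. -/
def weight (w : σ → ℝ≥0) (m : σ →₀ ℕ) : ℝ≥0 := m.prod fun i a => w i ^ a

theorem weight_add (w : σ → ℝ≥0) (m n : σ →₀ ℕ) : weight w (m + n) = weight w m * weight w n := by
  classical
  exact Finsupp.prod_add_index' (by simp) (by intro i a b; exact pow_add _ _ _)

theorem weight_ne_zero {w : σ → ℝ≥0} (hw : ∀ i, w i ≠ 0) (m : σ →₀ ℕ) : weight w m ≠ 0 :=
  Finset.prod_ne_zero_iff.2 fun i _ => pow_ne_zero _ (hw i)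

theorem weight_const (r : ℝ≥0) (m : σ →₀ ℕ) : weight (fun _ => r) m = r ^ m.degree := by
  rw [weight, Finsupp.prod, Finset.prod_pow_eq_pow_sum, Finsupp.degree_apply]

theorem weight_mono {v w : σ → ℝ≥0} (h : ∀ i, v i ≤ w i) (m : σ →₀ ℕ) : weight v m ≤ weight w m :=
  Finset.prod_le_prod' fun i _ => pow_le_pow_left₀ zero_le (h i) _

/-- The weighted `ℓ¹`-norm `∑ ‖f_m‖ w^m`, with value `∞` for a divergent sum. -/
def wnorm (w : σ → ℝ≥0) (f : MvPowerSeries σ ℂ) : ℝ≥0∞ := ∑' m, ‖coeff m f‖ₑ * weight w m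

theorem coeff_le_wnorm (w : σ → ℝ≥0) (f : MvPowerSeries σ ℂ) (m : σ →₀ ℕ) :
    ‖coeff m f‖ₑ * weight w m ≤ wnorm w f :=
  ENNReal.le_tsum m

theorem tsum_mul_tsum_antidiagonal [DecidableEq σ] (F G : (σ →₀ ℕ) → ℝ≥0∞) :
    (∑' m, F m) * ∑' m, G m =
      ∑' n, ∑ p ∈ Finset.HasAntidiagonal.antidiagonal n, F p.1 * G p.2 := by
  simp_rw [← ENNReal.tsum_mul_right, ← ENNReal.tsum_mul_left]
  rw [← ENNReal.tsum_prod (f := fun a b => F a * G b),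
    ← Finset.HasAntidiagonal.sigmaAntidiagonalEquivProd.tsum_eq, ENNReal.tsum_sigma']
  refine tsum_congr fun n => ?_
  rw [← Finset.tsum_subtype (Finset.HasAntidiagonal.antidiagonal n)
    fun p : (σ →₀ ℕ) × (σ →₀ ℕ) => F p.1 * G p.2]
  rfl

theorem wnorm_mul_le (w : σ → ℝ≥0) (f g : MvPowerSeries σ ℂ) :
    wnorm w (f * g) ≤ wnorm w f * wnorm w g := by
  classical
  rw [wnorm, wnorm, wnorm, tsum_mul_tsum_antidiagonal]
  refine ENNReal.tsum_le_tsum fun m => ?_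
  rw [coeff_mul]
  refine (mul_le_mul_left (enorm_sum_le _ _) _).trans ?_
  rw [Finset.sum_mul]
  refine Finset.sum_le_sum fun p hp => le_of_eq ?_
  have hp' : p.1 + p.2 = m := Finset.HasAntidiagonal.mem_antidiagonal.1 hp
  rw [← hp', weight_add, enorm_mul, ENNReal.coe_mul]
  exact mul_mul_mul_comm _ _ _ _

theorem wnorm_mono {v w : σ → ℝ≥0} (h : ∀ i, v i ≤ w i) (f : MvPowerSeries σ ℂ) :
    wnorm v f ≤ wnorm w f :=
  ENNReal.tsum_le_tsum fun m => by gcongr; exact weight_mono h m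

theorem isConvergent_iff_wnorm {f : MvPowerSeries σ ℂ} :
    IsConvergent f ↔ ∃ r : ℝ≥0, r ≠ 0 ∧ wnorm (fun _ => r) f ≠ ∞ := by
  have key (r : ℝ≥0) : wnorm (fun _ => r) f ≠ ∞ ↔
      Summable fun m : σ →₀ ℕ => ‖coeff m f‖ * (r : ℝ) ^ m.degree := by
    have e : wnorm (fun _ => r) f =
        ∑' m : σ →₀ ℕ, ((‖coeff m f‖₊ * r ^ m.degree : ℝ≥0) : ℝ≥0∞) := by
      simp [wnorm, weight_const, enorm]
    rw [e, ENNReal.tsum_coe_ne_top_iff_summable, ← NNReal.summable_coe]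
    simp
  constructor
  · rintro ⟨r, hr, h⟩
    lift r to ℝ≥0 using hr.le
    exact ⟨r, by exact_mod_cast hr.ne', (key r).2 h⟩
  · rintro ⟨r, hr, h⟩
    exact ⟨r, by exact_mod_cast pos_iff_ne_zero.2 hr, (key r).1 h⟩

theorem isConvergent_of_wnorm [Finite σ] {w : σ → ℝ≥0} (hw : ∀ i, w i ≠ 0)
    {f : MvPowerSeries σ ℂ} (h : wnorm w f ≠ ∞) : IsConvergent f := by
  cases nonempty_fintype σ
  obtain ⟨r, hr, hrw⟩ : ∃ r : ℝ≥0, r ≠ 0 ∧ ∀ i, r ≤ w i := by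
    rcases isEmpty_or_nonempty σ with _ | _
    · exact ⟨1, one_ne_zero, fun i => isEmptyElim i⟩
    · obtain ⟨i, hi⟩ := Finite.exists_min w
      exact ⟨w i, hw i, hi⟩
  exact isConvergent_iff_wnorm.2 ⟨r, hr, ne_top_of_le_ne_top h (wnorm_mono hrw f)⟩

/-- The series `∑ f_{m+d} x^m`, i.e. the part of `f` divisible by `x^d`, divided by `x^d`. -/
def shift (d : σ →₀ ℕ) (f : MvPowerSeries σ ℂ) : MvPowerSeries σ ℂ := fun m => coeff (m + d) f

theorem coeff_shift (d : σ →₀ ℕ) (f : MvPowerSeries σ ℂ) (m : σ →₀ ℕ) :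
    coeff m (shift d f) = coeff (m + d) f := rfl

theorem weight_mul_wnorm_shift_le (w : σ → ℝ≥0) (d : σ →₀ ℕ) (f : MvPowerSeries σ ℂ) :
    weight w d * wnorm w (shift d f) ≤ wnorm w f := by
  rw [wnorm, wnorm, ← ENNReal.tsum_mul_left]
  refine le_trans (le_of_eq (tsum_congr fun m => ?_))
    (ENNReal.tsum_comp_le_tsum_of_injective (add_left_injective d) _)
  rw [coeff_shift, weight_add, ENNReal.coe_mul]
  ring

/-- Division with remainder by `x^d + h` in the weighted `ℓ¹`-norm, where `h` is small: the
quotient `q` of `g` is the sum of the geometric series of `q ↦ -shift d (h * q)`. -/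
theorem exists_add_shift_mul_eq {w : σ → ℝ≥0} (hw : ∀ i, w i ≠ 0) (d : σ →₀ ℕ)
    {h g : MvPowerSeries σ ℂ} (hh : 2 * wnorm w h ≤ weight w d) (hg : wnorm w g ≠ ∞) :
    ∃ q, wnorm w q ≠ ∞ ∧ ∀ m, coeff m q + coeff (m + d) (h * q) = coeff (m + d) g := by
  classical
  have hd : (weight w d : ℝ≥0∞) ≠ 0 := by exact_mod_cast weight_ne_zero hw d
  have hdt : (weight w d : ℝ≥0∞) ≠ ∞ := ENNReal.coe_ne_top
  obtain ⟨Q, hQ0, hQs⟩ : ∃ Q : ℕ → MvPowerSeries σ ℂ, Q 0 = shift d g ∧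
      ∀ k, Q (k + 1) = -shift d (h * Q k) :=
    ⟨fun k => Nat.rec (shift d g) (fun _ q => -shift d (h * q)) k, rfl, fun _ => rfl⟩
  have hneg (f : MvPowerSeries σ ℂ) : wnorm w (-f) = wnorm w f := by simp [wnorm]
  have step (k : ℕ) : 2 * wnorm w (Q (k + 1)) ≤ wnorm w (Q k) := by
    rw [hQs, hneg]
    have h1 : weight w d * (2 * wnorm w (shift d (h * Q k))) ≤ weight w d * wnorm w (Q k) :=
      calc _ = 2 * (weight w d * wnorm w (shift d (h * Q k))) := by ring
        _ ≤ 2 * (wnorm w h * wnorm w (Q k)) := by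
          refine mul_le_mul_right ?_ 2
          exact (weight_mul_wnorm_shift_le w d _).trans (wnorm_mul_le w _ _)
        _ = (2 * wnorm w h) * wnorm w (Q k) := by ring
        _ ≤ _ := by gcongr
    exact (ENNReal.mul_le_mul_iff_right hd hdt).1 h1
  have hN0 : wnorm w (Q 0) ≠ ∞ := by
    intro ht
    have := weight_mul_wnorm_shift_le w d g
    rw [← hQ0, ht, ENNReal.mul_top hd] at this
    exact hg (top_le_iff.1 this)
  have bound (k : ℕ) : wnorm w (Q k) ≤ 2⁻¹ ^ k * wnorm w (Q 0) := by
    induction k with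
    | zero => simp
    | succ k ih =>
      have h2 : wnorm w (Q (k + 1)) ≤ 2⁻¹ * wnorm w (Q k) := by
        rw [← ENNReal.div_eq_inv_mul, ENNReal.le_div_iff_mul_le (by simp) (by simp), mul_comm]
        exact step k
      refine h2.trans ?_
      rw [pow_succ', mul_assoc]
      gcongr
  have htot : ∑' k, wnorm w (Q k) ≠ ∞ := by
    refine ne_top_of_le_ne_top ?_ (ENNReal.tsum_le_tsum bound)
    rw [ENNReal.tsum_mul_right, ENNReal.tsum_geometric]
    refine ENNReal.mul_ne_top ?_ hN0
    rw [ENNReal.one_sub_inv_two, inv_inv]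
    exact ENNReal.ofNat_ne_top
  have hsum (m : σ →₀ ℕ) : Summable fun k => coeff m (Q k) := by
    have hm : (weight w m : ℝ≥0∞) ≠ 0 := by exact_mod_cast weight_ne_zero hw m
    have h1 : ∑' k, ‖coeff m (Q k)‖ₑ ≠ ∞ := by
      intro ht
      apply htot
      have h2 : (∑' k, ‖coeff m (Q k)‖ₑ) * weight w m ≤ ∑' k, wnorm w (Q k) := by
        rw [← ENNReal.tsum_mul_right]
        exact ENNReal.tsum_le_tsum fun k => coeff_le_wnorm w _ m
      rw [ht, ENNReal.top_mul hm] at h2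
      exact top_le_iff.1 h2
    have h3 : Summable fun k => ‖coeff m (Q k)‖₊ := by
      rw [← ENNReal.tsum_coe_ne_top_iff_summable]
      exact h1
    exact Summable.of_norm (NNReal.summable_coe.2 h3)
  obtain ⟨q, hq⟩ : ∃ q : MvPowerSeries σ ℂ, ∀ m, coeff m q = ∑' k, coeff m (Q k) :=
    ⟨fun m => ∑' k, coeff m (Q k), fun m => rfl⟩
  refine ⟨q, ?_, fun m => ?_⟩
  · refine ne_top_of_le_ne_top htot ?_
    simp only [wnorm]
    rw [ENNReal.tsum_comm]
    refine ENNReal.tsum_le_tsum fun m => ?_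
    rw [ENNReal.tsum_mul_right]
    gcongr
    rw [hq]
    exact enorm_tsum_le_tsum_enorm
  · have hsum' (p : (σ →₀ ℕ) × (σ →₀ ℕ)) : Summable fun k => coeff p.1 h * coeff p.2 (Q k) :=
      Summable.mul_left (coeff p.1 h) (hsum p.2)
    have hmul : coeff (m + d) (h * q) = ∑' k, coeff (m + d) (h * Q k) :=
      calc coeff (m + d) (h * q)
          = ∑ p ∈ Finset.HasAntidiagonal.antidiagonal (m + d),
              coeff p.1 h * ∑' k, coeff p.2 (Q k) := by
            rw [coeff_mul]
            exact Finset.sum_congr rfl fun p _ => by rw [hq]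
        _ = ∑ p ∈ Finset.HasAntidiagonal.antidiagonal (m + d),
              ∑' k, coeff p.1 h * coeff p.2 (Q k) :=
            Finset.sum_congr rfl fun p _ => tsum_mul_left.symm
        _ = ∑' k, ∑ p ∈ Finset.HasAntidiagonal.antidiagonal (m + d),
              coeff p.1 h * coeff p.2 (Q k) :=
            (Summable.tsum_finsetSum fun p _ => hsum' p).symm
        _ = ∑' k, coeff (m + d) (h * Q k) := tsum_congr fun k => by rw [coeff_mul]
    have hs : ∀ k, coeff (m + d) (h * Q k) = -coeff m (Q (k + 1)) := fun k => by
      rw [hQs, map_neg, coeff_shift, neg_neg]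
    rw [hmul, hq, (hsum m).tsum_eq_zero_add]
    simp_rw [hs, tsum_neg]
    rw [hQ0, coeff_shift, add_neg_cancel_right]

end WeightedNorm

/-! ### The local ring of convergent power series -/

section ConvLocal

open scoped NNReal ENNReal
open MvPowerSeries

variable {σ : Type}

theorem weight_le_mul_of_le {v w : σ → ℝ≥0} (hwv : ∀ i, w i ≤ v i) {c : ℝ≥0} {d m : σ →₀ ℕ}
    (hdm : d ≤ m) (h : weight w d ≤ c * weight v d) : weight w m ≤ c * weight v m := by
  obtain ⟨e, rfl⟩ := exists_add_of_le hdm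
  rw [weight_add, weight_add, ← mul_assoc]
  exact mul_le_mul' h (weight_mono hwv e)

theorem wnorm_le_mul {v w : σ → ℝ≥0} {c : ℝ≥0} {f : MvPowerSeries σ ℂ}
    (h : ∀ m, coeff m f ≠ 0 → weight w m ≤ c * weight v m) : wnorm w f ≤ c * wnorm v f := by
  rw [wnorm, wnorm, ← ENNReal.tsum_mul_left]
  refine ENNReal.tsum_le_tsum fun m => ?_
  by_cases hm : coeff m f = 0
  · simp [hm]
  · rw [mul_left_comm]
    gcongr
    exact_mod_cast h m hm

theorem IsConvergent.of_norm_le {f g : MvPowerSeries σ ℂ} (hg : IsConvergent g)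
    (h : ∀ m, ‖coeff m f‖ ≤ ‖coeff m g‖) : IsConvergent f := by
  obtain ⟨r, hr, hg⟩ := hg
  exact ⟨r, hr, hg.of_nonneg_of_le (fun m => by positivity) fun m => by gcongr; exact h m⟩

theorem IsConvergent.shift {f : MvPowerSeries σ ℂ} (hf : IsConvergent f) (d : σ →₀ ℕ) :
    IsConvergent (shift d f) := by
  obtain ⟨r, hr, hf⟩ := isConvergent_iff_wnorm.1 hf
  refine isConvergent_iff_wnorm.2 ⟨r, hr, fun ht => hf ?_⟩
  have := weight_mul_wnorm_shift_le (fun _ => r) d f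
  rw [ht, ENNReal.mul_top (by exact_mod_cast weight_ne_zero (fun _ => hr) d)] at this
  exact top_le_iff.1 this

theorem IsConvergent.X (i : σ) : IsConvergent (X i : MvPowerSeries σ ℂ) := by
  classical
  refine ⟨1, one_pos, summable_of_ne_finset_zero (s := {Finsupp.single i 1}) fun m hm => ?_⟩
  rw [coeff_X, if_neg (by simpa using hm)]
  simp

/-- The coordinate function `xᵢ`. -/
def convX (i : σ) : Conv σ := ⟨X i, IsConvergent.X i⟩

/-- The value of a convergent power series at the origin. -/
def convConst (σ : Type) : Conv σ →+* ℂ := constantCoeff.comp (Conv σ).val.toRingHom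

theorem convConst_apply (f : Conv σ) : convConst σ f = coeff 0 f.1 := rfl

theorem isUnit_conv_iff {f : Conv σ} : IsUnit f ↔ convConst σ f ≠ 0 := by
  classical
  refine ⟨fun h => (h.map (convConst σ)).ne_zero, fun hf => ?_⟩
  set a := convConst σ f with ha
  obtain ⟨h, hh⟩ : ∃ h : Conv σ, h = algebraMap ℂ (Conv σ) a⁻¹ * f - 1 := ⟨_, rfl⟩
  have h0 : coeff 0 h.1 = 0 := by
    rw [← convConst_apply, hh, map_sub, map_mul, ← ha]
    have : convConst σ (algebraMap ℂ (Conv σ) a⁻¹) = a⁻¹ :=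
      constantCoeff_C (σ := σ) (R := ℂ) a⁻¹
    rw [this, inv_mul_cancel₀ hf, map_one, sub_self]
  obtain ⟨r, hr, hN⟩ := isConvergent_iff_wnorm.1 h.2
  set N := (wnorm (fun _ => r) h.1).toNNReal with hNdef
  have hN' : wnorm (fun _ => r) h.1 = N := (ENNReal.coe_toNNReal hN).symm
  set u : ℝ≥0 := (2 * N + 1)⁻¹ with hu
  have hu0 : u ≠ 0 := by positivity
  have hu1 : u ≤ 1 := inv_le_one_of_one_le₀ (by simp)
  have hw : wnorm (fun _ => r * u) h.1 ≤ u * wnorm (fun _ => r) h.1 := by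
    refine wnorm_le_mul fun m hm => ?_
    have hm0 : m ≠ 0 := by rintro rfl; exact hm h0
    obtain ⟨i, hi⟩ : ∃ i, m i ≠ 0 := by
      by_contra! hc
      exact hm0 (Finsupp.ext hc)
    refine weight_le_mul_of_le (d := Finsupp.single i 1)
      (fun _ => mul_le_of_le_one_right zero_le hu1) ?_ ?_
    · simpa using Nat.one_le_iff_ne_zero.2 hi
    · simp [weight_const, mul_comm]
  obtain ⟨q, hq, hqm⟩ := exists_add_shift_mul_eq (w := fun _ : σ => r * u) (h := h.1) (g := 1)
    (fun _ => mul_ne_zero hr hu0) 0 (by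
      have h1 : 2 * (u * N) ≤ 1 := by
        rw [hu, mul_left_comm, inv_mul_le_iff₀ (by positivity), mul_one]
        simp
      calc _ ≤ 2 * (u * wnorm (fun _ => r) h.1) := by gcongr
        _ = ((2 * (u * N) : ℝ≥0) : ℝ≥0∞) := by rw [hN']; push_cast; rfl
        _ ≤ 1 := by exact_mod_cast h1
        _ = _ := by simp [weight])
    (by
      rw [wnorm, tsum_eq_single 0 fun m hm => by simp [coeff_one, hm]]
      simp [weight])
  have hqc : IsConvergent q := isConvergent_iff_wnorm.2 ⟨_, mul_ne_zero hr hu0, hq⟩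
  have hprod : (1 + h) * (⟨q, hqc⟩ : Conv σ) = 1 := by
    refine Subtype.ext (MvPowerSeries.ext fun m => ?_)
    have h1 := hqm m
    rw [add_zero] at h1
    have h3 : (1 + h.1) * q = q + h.1 * q := by ring
    refine Eq.trans ?_ h1
    rw [← map_add, ← h3]
    rfl
  have h2 : f * (algebraMap ℂ (Conv σ) a⁻¹ * ⟨q, hqc⟩) = 1 := by
    rw [← hprod, hh]
    ring
  exact IsUnit.of_mul_eq_one _ h2

instance : IsLocalHom (convConst σ) := ⟨fun _ h => isUnit_conv_iff.2 h.ne_zero⟩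

instance : IsLocalRing (Conv σ) := RingHom.domain_isLocalRing (convConst σ)

instance : IsDomain (Conv σ) :=
  have : IsDomain (MvPowerSeries σ ℂ) := NoZeroDivisors.to_isDomain _
  Function.Injective.isDomain (Conv σ).val.toRingHom Subtype.val_injective

theorem mem_maximalIdeal_conv {f : Conv σ} :
    f ∈ IsLocalRing.maximalIdeal (Conv σ) ↔ convConst σ f = 0 := by
  rw [IsLocalRing.mem_maximalIdeal, mem_nonunits_iff, isUnit_conv_iff, not_not]

/-- A power series is divided by the variables: each monomial is divided by one variable that
occurs in it. -/
theorem exists_eq_sum_convX_mul [Fintype σ] {N : ℕ} {f : Conv σ}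
    (hf : ∀ m, m.degree < N + 1 → coeff m f.1 = 0) :
    ∃ g : σ → Conv σ, f = ∑ i, convX i * g i ∧ ∀ i m, m.degree < N → coeff m (g i).1 = 0 := by
  classical
  have hex : ∃ p : (σ →₀ ℕ) → Option σ, ∀ m, m ≠ 0 → ∃ i, p m = some i ∧ m i ≠ 0 := by
    refine ⟨fun m => if h : m ≠ 0 then some (Finsupp.ne_iff.1 h).choose else none, fun m hm => ?_⟩
    exact ⟨_, dif_pos hm, (Finsupp.ne_iff.1 hm).choose_spec⟩
  obtain ⟨p, hp⟩ := hex
  let G (i : σ) : MvPowerSeries σ ℂ := fun m =>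
    if p (m + Finsupp.single i 1) = some i then coeff (m + Finsupp.single i 1) f.1 else 0
  have hG (i : σ) (m : σ →₀ ℕ) : coeff m (G i) = if p (m + Finsupp.single i 1) = some i then
      coeff (m + Finsupp.single i 1) f.1 else 0 := rfl
  have hGc (i : σ) : IsConvergent (G i) :=
    (f.2.shift (Finsupp.single i 1)).of_norm_le fun m => by
      rw [hG, coeff_shift]
      split_ifs <;> simp
  refine ⟨fun i => ⟨G i, hGc i⟩, Subtype.ext (MvPowerSeries.ext fun m => ?_), fun i m hm => ?_⟩
  · have e : (∑ i, convX i * (⟨G i, hGc i⟩ : Conv σ) : Conv σ).1 = ∑ i, X i * G i := by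
      rw [AddSubmonoidClass.coe_finsetSum]
      rfl
    rw [e, map_sum]
    have hc (i : σ) : coeff m (X i * G i) = if p m = some i ∧ m i ≠ 0 then coeff m f.1 else 0 := by
      by_cases hi : m i = 0
      · rw [if_neg (by simp [hi]), X, coeff_monomial_mul, if_neg]
        simp [hi]
      · have hle : Finsupp.single i 1 ≤ m := by simpa using Nat.one_le_iff_ne_zero.2 hi
        rw [X, coeff_monomial_mul, if_pos hle, one_mul, hG, tsub_add_cancel_of_le hle]
        simp [hi]
    simp_rw [hc]
    by_cases hm : m = 0
    · subst hm
      simpa using hf 0 (by simp)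
    · obtain ⟨i, hi, hmi⟩ := hp m hm
      rw [Finset.sum_eq_single i]
      · simp [hi, hmi]
      · intro j _ hj
        rw [if_neg]
        rintro ⟨h, -⟩
        rw [hi] at h
        exact hj (Option.some.inj h).symm
      · simp
  · change coeff m (G i) = 0
    rw [hG]
    split_ifs
    · exact hf _ (by rw [map_add, Finsupp.degree_single]; omega)
    · rfl

theorem convX_mem_maximalIdeal (i : σ) : convX i ∈ IsLocalRing.maximalIdeal (Conv σ) :=
  mem_maximalIdeal_conv.2 (coeff_zero_X i)

theorem mem_maximalIdeal_pow_of_coeff_eq_zero [Fintype σ] (N : ℕ) {f : Conv σ}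
    (hf : ∀ m, m.degree < N → coeff m f.1 = 0) : f ∈ IsLocalRing.maximalIdeal (Conv σ) ^ N := by
  induction N generalizing f with
  | zero => simp
  | succ N ih =>
    obtain ⟨g, rfl, hg⟩ := exists_eq_sum_convX_mul hf
    refine Ideal.sum_mem _ fun i _ => ?_
    rw [pow_succ']
    exact Ideal.mul_mem_mul (convX_mem_maximalIdeal i) (ih (hg i))

theorem maximalIdeal_conv [Fintype σ] :
    IsLocalRing.maximalIdeal (Conv σ) = Ideal.span (Set.range convX) := by
  refine le_antisymm (fun f hf => ?_) (Ideal.span_le.2 ?_)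
  · obtain ⟨g, rfl, -⟩ := exists_eq_sum_convX_mul (N := 0) (f := f) fun m hm => by
      have : m = 0 := (Finsupp.degree_eq_zero_iff m).1 (by omega)
      rw [this]
      exact mem_maximalIdeal_conv.1 hf
    exact Ideal.sum_mem _ fun i _ => Ideal.mul_mem_right _ _ (Ideal.subset_span ⟨i, rfl⟩)
  · rintro _ ⟨i, rfl⟩
    exact convX_mem_maximalIdeal i

/-- **Weierstrass division**: if `f(0, z)` has order `b` in the variable `z`, then every convergent
power series is a multiple of `f` up to a polynomial in `z` of degree less than `b`. -/
theorem exists_weierstrass_div [Finite σ] (z : σ) (b : ℕ) {f : Conv σ}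
    (hlt : ∀ j < b, coeff (Finsupp.single z j) f.1 = 0)
    (hb : coeff (Finsupp.single z b) f.1 = 1) (g : Conv σ) :
    ∃ q : Conv σ, ∀ m : σ →₀ ℕ, b ≤ m z → coeff m (g - q * f).1 = 0 := by
  classical
  set d : σ →₀ ℕ := Finsupp.single z b with hd
  have hmon : IsConvergent (monomial d (1 : ℂ)) := by
    have := (convX z ^ b).2
    have e : ((convX z ^ b : Conv σ) : MvPowerSeries σ ℂ) = X z ^ b := rfl
    rw [e, X_pow_eq] at this
    exact this
  set h : Conv σ := f - ⟨monomial d 1, hmon⟩ with hh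
  have hcoeff (m : σ →₀ ℕ) : coeff m h.1 = coeff m f.1 - coeff m (monomial d (1 : ℂ)) := rfl
  have hsupp (j : ℕ) (hj : j ≤ b) : coeff (Finsupp.single z j) h.1 = 0 := by
    rw [hcoeff, coeff_monomial]
    rcases hj.lt_or_eq with hj | rfl
    · rw [hlt j hj, if_neg, sub_zero]
      rw [hd]
      intro e
      exact hj.ne (Finsupp.single_injective z e)
    · rw [hb, if_pos rfl, sub_self]
  -- A polyradius `r` on which everything converges; it is then shrunk by the factor `u` in the
  -- direction of `z` and by `u ^ (b + 1)` in the other directions, so that each monomial of `h`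
  -- shrinks by `u ^ (b + 1)` but `z ^ b` only by `u ^ b`.
  obtain ⟨r₁, hr₁, hN₁⟩ := isConvergent_iff_wnorm.1 h.2
  obtain ⟨r₂, hr₂, hN₂⟩ := isConvergent_iff_wnorm.1 g.2
  obtain ⟨r, hr, hN, hNg⟩ : ∃ r : ℝ≥0, r ≠ 0 ∧ wnorm (fun _ => r) h.1 ≠ ∞ ∧
      wnorm (fun _ => r) g.1 ≠ ∞ :=
    ⟨min r₁ r₂, (lt_min (pos_iff_ne_zero.2 hr₁) (pos_iff_ne_zero.2 hr₂)).ne',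
      ne_top_of_le_ne_top hN₁ (wnorm_mono (fun _ => min_le_left _ _) _),
      ne_top_of_le_ne_top hN₂ (wnorm_mono (fun _ => min_le_right _ _) _)⟩
  set N := (wnorm (fun _ => r) h.1).toNNReal with hNdef
  have hN' : wnorm (fun _ => r) h.1 = N := (ENNReal.coe_toNNReal hN).symm
  obtain ⟨u, hu0, hu1, hu⟩ : ∃ u : ℝ≥0, u ≠ 0 ∧ u ≤ 1 ∧ 2 * (u * N) ≤ r ^ b := by
    refine ⟨min 1 (r ^ b * (2 * N + 1)⁻¹), ?_, min_le_left _ _, ?_⟩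
    · have : 0 < r ^ b * (2 * N + 1)⁻¹ := by positivity
      exact (lt_min one_pos this).ne'
    · calc 2 * (min 1 (r ^ b * (2 * N + 1)⁻¹) * N) ≤ 2 * ((r ^ b * (2 * N + 1)⁻¹) * N) := by
            gcongr
            exact min_le_right _ _
        _ = r ^ b * ((2 * N + 1)⁻¹ * (2 * N)) := by ring
        _ ≤ r ^ b * 1 := by
            gcongr
            rw [inv_mul_le_iff₀ (by positivity), mul_one]
            simp
        _ = r ^ b := mul_one _
  set w : σ → ℝ≥0 := fun i => if i = z then r * u else r * u ^ (b + 1) with hw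
  have hw0 (i : σ) : w i ≠ 0 := by
    simp only [hw]
    split_ifs <;> positivity
  have hwr (i : σ) : w i ≤ r := by
    simp only [hw]
    split_ifs
    · exact mul_le_of_le_one_right zero_le hu1
    · exact mul_le_of_le_one_right zero_le (pow_le_one₀ zero_le hu1)
  have hwz : w z = r * u := if_pos rfl
  have hwd : weight w d = (r * u) ^ b := by simp [weight, hd, hwz]
  have hwh : wnorm w h.1 ≤ (u ^ (b + 1) : ℝ≥0) * wnorm (fun _ => r) h.1 := by
    refine wnorm_le_mul fun m hm => ?_
    by_cases hmz : ∃ i, i ≠ z ∧ m i ≠ 0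
    · obtain ⟨i, hiz, hi⟩ := hmz
      refine weight_le_mul_of_le (d := Finsupp.single i 1) hwr ?_ ?_
      · simpa using Nat.one_le_iff_ne_zero.2 hi
      · simp [weight, hw, hiz, mul_comm]
    · push Not at hmz
      have hms : m = Finsupp.single z (m z) := by
        ext i
        by_cases hi : i = z
        · rw [hi, Finsupp.single_eq_same]
        · rw [hmz i hi, Finsupp.single_eq_of_ne hi]
      have hbz : b + 1 ≤ m z := by
        by_contra hlt'
        rw [hms] at hm
        exact hm (hsupp _ (by omega))
      refine weight_le_mul_of_le (d := Finsupp.single z (b + 1)) hwr ?_ ?_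
      · rwa [Finsupp.single_le_iff]
      · rw [weight_const, weight,
          Finsupp.prod_single_index (h := fun i a => w i ^ a) (pow_zero _), hwz,
          Finsupp.degree_single, mul_pow, mul_comm]
  obtain ⟨q, hq, hqm⟩ := exists_add_shift_mul_eq hw0 d (h := h.1) (g := g.1) (by
      have h1 : 2 * (u ^ (b + 1) * N) ≤ (r * u) ^ b :=
        calc 2 * (u ^ (b + 1) * N) = 2 * (u * N) * u ^ b := by ring
          _ ≤ r ^ b * u ^ b := by gcongr
          _ = _ := (mul_pow _ _ _).symm
      calc _ ≤ 2 * ((u ^ (b + 1) : ℝ≥0) * wnorm (fun _ => r) h.1) := by gcongr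
        _ = ((2 * (u ^ (b + 1) * N) : ℝ≥0) : ℝ≥0∞) := by rw [hN']; push_cast; rfl
        _ ≤ _ := by rw [hwd]; exact_mod_cast h1)
    (ne_top_of_le_ne_top hNg (wnorm_mono hwr _))
  refine ⟨⟨q, isConvergent_of_wnorm hw0 hq⟩, fun m hm => ?_⟩
  have hdm : d ≤ m := by simpa [hd] using hm
  obtain ⟨e, rfl⟩ := exists_add_of_le hdm
  have h1 := hqm e
  have h2 : (g - (⟨q, isConvergent_of_wnorm hw0 hq⟩ : Conv σ) * f).1 =
      g.1 - (monomial d 1 * q + h.1 * q) := by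
    have : f.1 = monomial d 1 + h.1 := by
      rw [hh]
      exact (add_sub_cancel _ _).symm
    change g.1 - q * f.1 = _
    rw [this]
    ring
  rw [h2, map_sub, map_add, coeff_add_monomial_mul, one_mul, add_comm d e, ← h1, sub_self]

end ConvLocal

/-! ### Expansion with respect to some of the variables -/

section Expansion

open MvPowerSeries

variable {σ τ ρ : Type}

/-- Exponents in the variables `ρ = σ ⊕ τ` as pairs of exponents. -/
def expEquiv (E : σ ⊕ τ ≃ ρ) : (σ →₀ ℕ) × (τ →₀ ℕ) ≃+ (ρ →₀ ℕ) :=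
  Finsupp.sumFinsuppAddEquivProdFinsupp.symm.trans (Finsupp.domCongr E)

@[simp]
theorem expEquiv_inl (E : σ ⊕ τ ≃ ρ) (m : σ →₀ ℕ) (α : τ →₀ ℕ) (i : σ) :
    expEquiv E (m, α) (E (Sum.inl i)) = m i := by
  simp [expEquiv, Finsupp.sumFinsuppAddEquivProdFinsupp]

@[simp]
theorem expEquiv_inr (E : σ ⊕ τ ≃ ρ) (m : σ →₀ ℕ) (α : τ →₀ ℕ) (j : τ) :
    expEquiv E (m, α) (E (Sum.inr j)) = α j := by
  simp [expEquiv, Finsupp.sumFinsuppAddEquivProdFinsupp]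

theorem finsupp_ext_sum (E : σ ⊕ τ ≃ ρ) {m n : ρ →₀ ℕ}
    (hl : ∀ i, m (E (Sum.inl i)) = n (E (Sum.inl i)))
    (hr : ∀ j, m (E (Sum.inr j)) = n (E (Sum.inr j))) : m = n := by
  ext x
  obtain ⟨y, rfl⟩ := E.surjective x
  cases y with
  | inl i => exact hl i
  | inr j => exact hr j

theorem expEquiv_zero_right (E : σ ⊕ τ ≃ ρ) (m : σ →₀ ℕ) :
    expEquiv E (m, 0) = m.embDomain (Function.Embedding.inl.trans E.toEmbedding) := by
  refine finsupp_ext_sum E (fun i => ?_) fun j => ?_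
  · rw [expEquiv_inl]
    exact (Finsupp.embDomain_apply_self (Function.Embedding.inl.trans E.toEmbedding) m i).symm
  · rw [expEquiv_inr, Finsupp.embDomain_of_notMem_range]
    · rfl
    · rintro ⟨i, hi⟩
      exact Sum.inl_ne_inr (E.injective hi)

theorem expEquiv_single_right (E : σ ⊕ τ ≃ ρ) (j : τ) (a : ℕ) :
    expEquiv E (0, Finsupp.single j a) = Finsupp.single (E (Sum.inr j)) a := by
  classical
  refine finsupp_ext_sum E (fun i' => ?_) fun j => ?_
  · simp
  · simp [Finsupp.single_apply]

theorem expEquiv_eq_add (E : σ ⊕ τ ≃ ρ) (m : σ →₀ ℕ) (α : τ →₀ ℕ) :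
    expEquiv E (m, α) = m.embDomain (Function.Embedding.inl.trans E.toEmbedding) +
      α.embDomain (Function.Embedding.inr.trans E.toEmbedding) := by
  have h1 : expEquiv E (m, α) = expEquiv E (m, 0) + expEquiv E (0, α) := by
    rw [← map_add, Prod.mk_add_mk, add_zero, zero_add]
  have h2 : expEquiv E (0, α) = α.embDomain (Function.Embedding.inr.trans E.toEmbedding) := by
    refine finsupp_ext_sum E (fun i => ?_) fun j => ?_
    · rw [expEquiv_inl, Finsupp.embDomain_of_notMem_range]
      · rfl
      · rintro ⟨i, hi⟩
        exact Sum.inr_ne_inl (E.injective hi)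
    · rw [expEquiv_inr]
      exact (Finsupp.embDomain_apply_self (Function.Embedding.inr.trans E.toEmbedding) α j).symm
  rw [h1, h2, expEquiv_zero_right]

theorem degree_expEquiv (E : σ ⊕ τ ≃ ρ) (m : σ →₀ ℕ) (α : τ →₀ ℕ) :
    (expEquiv E (m, α)).degree = m.degree + α.degree := by
  rw [expEquiv_eq_add, map_add, degree_embDomain, degree_embDomain]

theorem sum_antidiagonal_expEquiv [DecidableEq σ] [DecidableEq τ] [DecidableEq ρ] {M : Type}
    [AddCommMonoid M] (E : σ ⊕ τ ≃ ρ) (m : σ →₀ ℕ) (α : τ →₀ ℕ) (F : (ρ →₀ ℕ) → (ρ →₀ ℕ) → M) :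
    ∑ p ∈ Finset.HasAntidiagonal.antidiagonal (expEquiv E (m, α)), F p.1 p.2 =
      ∑ b ∈ Finset.HasAntidiagonal.antidiagonal α, ∑ a ∈ Finset.HasAntidiagonal.antidiagonal m,
        F (expEquiv E (a.1, b.1)) (expEquiv E (a.2, b.2)) := by
  rw [← Finset.sum_product']
  symm
  refine Finset.sum_nbij' (fun x => (expEquiv E (x.2.1, x.1.1), expEquiv E (x.2.2, x.1.2)))
    (fun y => ((((expEquiv E).symm y.1).2, ((expEquiv E).symm y.2).2),
      (((expEquiv E).symm y.1).1, ((expEquiv E).symm y.2).1))) ?_ ?_ ?_ ?_ ?_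
  · rintro ⟨b, a⟩ h
    simp only [Finset.mem_product, Finset.HasAntidiagonal.mem_antidiagonal] at h ⊢
    rw [← map_add, Prod.mk_add_mk, h.1, h.2]
  · rintro ⟨y₁, y₂⟩ h
    simp only [Finset.mem_product, Finset.HasAntidiagonal.mem_antidiagonal] at h ⊢
    rw [← Prod.fst_add, ← Prod.snd_add, ← map_add, h, AddEquiv.symm_apply_apply]
    exact ⟨rfl, rfl⟩
  · rintro ⟨b, a⟩ -
    simp
  · rintro ⟨y₁, y₂⟩ -
    simp
  · rintro ⟨b, a⟩ -
    rfl

theorem isConvergent_coeff (E : σ ⊕ τ ≃ ρ) (f : Conv ρ) (α : τ →₀ ℕ) :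
    IsConvergent (fun m => coeff (expEquiv E (m, α)) f.1 : MvPowerSeries σ ℂ) := by
  obtain ⟨r, hr, hf⟩ := f.2.shift (expEquiv E (0, α))
  have hinj : Function.Injective fun m : σ →₀ ℕ => expEquiv E (m, (0 : τ →₀ ℕ)) := fun a b h => by
    simpa using (expEquiv E).injective h
  refine ⟨r, hr, ?_⟩
  refine (hf.comp_injective hinj).congr fun m => ?_
  rw [Function.comp_apply, coeff_shift, ← map_add, degree_expEquiv, Prod.mk_add_mk, add_zero,
    zero_add, map_zero, add_zero]
  rfl

/-- The coefficient `f_α` of the expansion `f = ∑ f_α y^α` of a power series in the variables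
`x`, `y`. -/
def convPart (E : σ ⊕ τ ≃ ρ) (f : Conv ρ) (α : τ →₀ ℕ) : Conv σ :=
  ⟨fun m => coeff (expEquiv E (m, α)) f.1, isConvergent_coeff E f α⟩

theorem coeff_convPart (E : σ ⊕ τ ≃ ρ) (f : Conv ρ) (m : σ →₀ ℕ) (α : τ →₀ ℕ) :
    coeff m (convPart E f α).1 = coeff (expEquiv E (m, α)) f.1 := rfl

theorem convPart_mul [DecidableEq τ] (E : σ ⊕ τ ≃ ρ) (f g : Conv ρ) (α : τ →₀ ℕ) :
    convPart E (f * g) α =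
      ∑ b ∈ Finset.HasAntidiagonal.antidiagonal α, convPart E f b.1 * convPart E g b.2 := by
  classical
  refine Subtype.ext (MvPowerSeries.ext fun m => ?_)
  have h1 : coeff (expEquiv E (m, α)) (f.1 * g.1) = ∑ b ∈ Finset.HasAntidiagonal.antidiagonal α,
      coeff m ((convPart E f b.1).1 * (convPart E g b.2).1) := by
    rw [coeff_mul, sum_antidiagonal_expEquiv E m α fun a b => coeff a f.1 * coeff b g.1]
    refine Finset.sum_congr rfl fun b _ => ?_
    rw [coeff_mul]
    rfl
  rw [AddSubmonoidClass.coe_finsetSum, map_sum]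
  exact h1

/-- The expansion `∑ f_α y^α` of `f`, as a formal power series in the variables `y`. -/
def convSeries (E : σ ⊕ τ ≃ ρ) (f : Conv ρ) : MvPowerSeries τ (Conv σ) := fun α => convPart E f α

theorem coeff_convSeries (E : σ ⊕ τ ≃ ρ) (f : Conv ρ) (α : τ →₀ ℕ) :
    coeff α (convSeries E f) = convPart E f α := rfl

theorem convSeries_mul (E : σ ⊕ τ ≃ ρ) (f g : Conv ρ) :
    convSeries E (f * g) = convSeries E f * convSeries E g := by
  classical
  refine MvPowerSeries.ext fun α => ?_
  rw [coeff_mul, coeff_convSeries, convPart_mul]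
  rfl

theorem convSeries_one (E : σ ⊕ τ ≃ ρ) : convSeries E 1 = 1 := by
  classical
  refine MvPowerSeries.ext fun α => Subtype.ext (MvPowerSeries.ext fun m => ?_)
  change coeff (expEquiv E (m, α)) (1 : MvPowerSeries ρ ℂ) = _
  rw [coeff_one, coeff_one]
  by_cases hα : α = 0
  · rw [if_pos hα]
    change _ = coeff m (1 : MvPowerSeries σ ℂ)
    rw [coeff_one]
    simp [hα]
  · rw [if_neg hα, if_neg]
    · rfl
    · simp [hα]

/-- The expansion `f = ∑ f_α y^α` of a convergent power series in the variables `x`, `y` with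
coefficients in the ring of convergent power series in the variables `x`. -/
def convExpand (E : σ ⊕ τ ≃ ρ) : Conv ρ →+* MvPowerSeries τ (Conv σ) where
  toFun f := convSeries E f
  map_zero' := rfl
  map_add' _ _ := rfl
  map_one' := convSeries_one E
  map_mul' := convSeries_mul E

theorem coeff_convExpand (E : σ ⊕ τ ≃ ρ) (f : Conv ρ) (m : σ →₀ ℕ) (α : τ →₀ ℕ) :
    coeff m (coeff α (convExpand E f)).1 = coeff (expEquiv E (m, α)) f.1 := rfl

theorem convExpand_injective (E : σ ⊕ τ ≃ ρ) : Function.Injective (convExpand E) := by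
  intro f g h
  refine Subtype.ext (MvPowerSeries.ext fun n => ?_)
  obtain ⟨⟨m, α⟩, rfl⟩ := (expEquiv E).surjective n
  rw [← coeff_convExpand, ← coeff_convExpand, h]

theorem convExpand_convRename (E : σ ⊕ τ ≃ ρ) (f : Conv σ) :
    convExpand E (convRename (Function.Embedding.inl.trans E.toEmbedding) f) = C f := by
  classical
  refine MvPowerSeries.ext fun α => Subtype.ext (MvPowerSeries.ext fun m => ?_)
  rw [coeff_convExpand, coeff_C]
  change coeff _ (MvPowerSeries.rename _ f.1) = _
  split_ifs with h
  · rw [h, expEquiv_zero_right, coeff_embDomain_rename]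
  · rw [coeff_rename_eq_zero]
    · rfl
    · rintro ⟨n, hn⟩
      rw [← Finsupp.embDomain_eq_mapDomain, ← expEquiv_zero_right] at hn
      have := (expEquiv E).injective hn
      simp only [Prod.mk.injEq] at this
      exact h this.2.symm

theorem coeff_convExpand_convRename_inr (E : σ ⊕ τ ≃ ρ) (f : Conv τ) (α : τ →₀ ℕ) :
    coeff α (convExpand E (convRename (Function.Embedding.inr.trans E.toEmbedding) f)) =
      algebraMap ℂ (Conv σ) (coeff α f.1) := by
  classical
  have key (m : σ →₀ ℕ) : expEquiv E (m, α) =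
      expEquiv ((Equiv.sumComm τ σ).trans E) (α, m) :=
    finsupp_ext_sum E (fun i => by
        rw [expEquiv_inl]
        exact (expEquiv_inr ((Equiv.sumComm τ σ).trans E) α m i).symm)
      fun j => by
        rw [expEquiv_inr]
        exact (expEquiv_inl ((Equiv.sumComm τ σ).trans E) α m j).symm
  refine Subtype.ext (MvPowerSeries.ext fun m => ?_)
  rw [coeff_convExpand, key, ← coeff_convExpand]
  have h := convExpand_convRename ((Equiv.sumComm τ σ).trans E) f
  have he : Function.Embedding.inl.trans ((Equiv.sumComm τ σ).trans E).toEmbedding =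
      Function.Embedding.inr.trans E.toEmbedding := rfl
  rw [he] at h
  rw [h, coeff_C]
  refine Eq.trans ?_ (coeff_C (R := ℂ) m (coeff α f.1)).symm
  split_ifs <;> rfl

theorem convExpand_convX_inr (E : σ ⊕ τ ≃ ρ) (j : τ) :
    convExpand E (convX (E (Sum.inr j))) = X j := by
  classical
  refine MvPowerSeries.ext fun α => Subtype.ext (MvPowerSeries.ext fun m => ?_)
  rw [coeff_convExpand, coeff_X]
  change coeff _ (X _ : MvPowerSeries ρ ℂ) = _
  simp only [coeff_X, ← expEquiv_single_right, (expEquiv E).apply_eq_iff_eq, Prod.mk.injEq]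
  split_ifs with h1 h2 h2
  · rw [h1.1]
    simp
  · exact absurd h1.2 h2
  · have hm : m ≠ 0 := fun hm => h1 ⟨hm, h2⟩
    exact (by rw [coeff_one, if_neg hm] : (0 : ℂ) = coeff m (1 : MvPowerSeries σ ℂ))
  · rfl

/-- Renaming the variables along a bijection is an isomorphism. -/
def convRenameEquiv (e : σ ≃ τ) : Conv σ ≃ₐ[ℂ] Conv τ :=
  AlgEquiv.ofRingEquiv (f := RingEquiv.ofRingHom (convRename e.toEmbedding)
    (convRename e.symm.toEmbedding)
    (RingHom.ext fun f => Subtype.ext (by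
      change MvPowerSeries.rename e (MvPowerSeries.rename e.symm f.1) = f.1
      simp))
    (RingHom.ext fun f => Subtype.ext (by
      change MvPowerSeries.rename e.symm (MvPowerSeries.rename e f.1) = f.1
      simp)))
    (fun r => Subtype.ext (by
      change MvPowerSeries.rename e (C r) = C r
      simp))

end Expansion

/-! ### Linear changes of coordinates -/

section Shear

open scoped NNReal ENNReal
open MvPowerSeries

variable {σ : Type}

/-- The substitution `xᵢ ↦ xᵢ + cᵢ z`. -/
def shearFamily (z : σ) (c : σ → ℂ) (i : σ) : MvPowerSeries σ ℂ := X i + C (c i) * X z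

theorem hasSubst_shearFamily [Finite σ] (z : σ) (c : σ → ℂ) : HasSubst (shearFamily z c) :=
  hasSubst_of_constantCoeff_zero fun i => by simp [shearFamily]

theorem subst_shearFamily_neg [Finite σ] (z : σ) {c : σ → ℂ} (hz : c z = 0)
    (f : MvPowerSeries σ ℂ) :
    subst (shearFamily z (-c)) (subst (shearFamily z c) f) = f := by
  rw [subst_comp_subst_apply (hasSubst_shearFamily z c) (hasSubst_shearFamily z _)]
  have h : (fun s => subst (shearFamily z (-c)) (shearFamily z c s)) = X := by
    funext s
    have hs := hasSubst_shearFamily z (-c)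
    rw [shearFamily, subst_add hs, subst_mul hs, subst_X hs, subst_X hs, subst_C]
    simp [shearFamily, hz]
  rw [h, subst_self, id]

theorem wnorm_add_le (w : σ → ℝ≥0) (f g : MvPowerSeries σ ℂ) :
    wnorm w (f + g) ≤ wnorm w f + wnorm w g := by
  rw [wnorm, wnorm, wnorm, ← ENNReal.tsum_add]
  refine ENNReal.tsum_le_tsum fun m => ?_
  rw [map_add, ← add_mul]
  gcongr
  exact enorm_add_le _ _

theorem wnorm_monomial (w : σ → ℝ≥0) (m : σ →₀ ℕ) (a : ℂ) :
    wnorm w (monomial m a) = ‖a‖ₑ * weight w m := by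
  classical
  rw [wnorm, tsum_eq_single m fun n hn => by rw [coeff_monomial, if_neg hn]; simp,
    coeff_monomial_same]

theorem wnorm_prod_pow_le (w : σ → ℝ≥0) (a : σ → MvPowerSeries σ ℂ) (v : σ → ℝ≥0)
    (h : ∀ i, wnorm w (a i) ≤ v i) (d : σ →₀ ℕ) :
    wnorm w (d.prod fun i e => a i ^ e) ≤ weight v d := by
  classical
  have h1 : wnorm w (1 : MvPowerSeries σ ℂ) ≤ 1 := by
    rw [← monomial_zero_one, wnorm_monomial]
    simp [weight]
  have hpow (i : σ) (e : ℕ) : wnorm w (a i ^ e) ≤ (v i : ℝ≥0∞) ^ e := by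
    induction e with
    | zero => simpa using h1
    | succ e ih =>
      rw [pow_succ, pow_succ]
      exact (wnorm_mul_le w _ _).trans (mul_le_mul' ih (h i))
  rw [Finsupp.prod, weight, Finsupp.prod, ENNReal.ofNNReal_finsetProd]
  induction d.support using Finset.induction_on with
  | empty => simpa using h1
  | insert i s his ih =>
    rw [Finset.prod_insert his, Finset.prod_insert his]
    refine (wnorm_mul_le w _ _).trans (mul_le_mul' ?_ ih)
    simpa using hpow i (d i)

/-- A substitution which maps the polyradius `w` into the polyradius `v` does not increase norms. -/
theorem wnorm_subst_le (w v : σ → ℝ≥0) {a : σ → MvPowerSeries σ ℂ} (ha : HasSubst a)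
    (h : ∀ i, wnorm w (a i) ≤ v i) (f : MvPowerSeries σ ℂ) : wnorm w (subst a f) ≤ wnorm v f := by
  have hc (e : σ →₀ ℕ) : ‖coeff e (subst a f)‖ₑ ≤
      ∑' d, ‖coeff d f‖ₑ * ‖coeff e (d.prod fun s e => a s ^ e)‖ₑ := by
    rw [coeff_subst ha, finsum_eq_sum _ (coeff_subst_finite ha f e)]
    refine (enorm_sum_le _ _).trans (le_trans (Finset.sum_le_sum fun d _ => ?_)
      (ENNReal.sum_le_tsum _))
    rw [smul_eq_mul, enorm_mul]
  calc wnorm w (subst a f)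
      ≤ ∑' e, ∑' d, ‖coeff d f‖ₑ * ‖coeff e (d.prod fun s e => a s ^ e)‖ₑ * weight w e := by
        refine ENNReal.tsum_le_tsum fun e => ?_
        rw [ENNReal.tsum_mul_right]
        gcongr
        exact hc e
    _ = ∑' d, ‖coeff d f‖ₑ * wnorm w (d.prod fun s e => a s ^ e) := by
        rw [ENNReal.tsum_comm]
        refine tsum_congr fun d => ?_
        rw [wnorm, ← ENNReal.tsum_mul_left]
        exact tsum_congr fun e => mul_assoc _ _ _
    _ ≤ wnorm v f := by
        refine ENNReal.tsum_le_tsum fun d => ?_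
        gcongr
        exact wnorm_prod_pow_le w a v h d

theorem IsConvergent.subst_shearFamily [Finite σ] {f : MvPowerSeries σ ℂ} (hf : IsConvergent f)
    (z : σ) (c : σ → ℂ) : IsConvergent (subst (shearFamily z c) f) := by
  cases nonempty_fintype σ
  obtain ⟨r, hr, hN⟩ := isConvergent_iff_wnorm.1 hf
  set K : ℝ≥0 := 1 + ∑ i, ‖c i‖₊ with hK
  have hK0 : K ≠ 0 := by positivity
  refine isConvergent_iff_wnorm.2 ⟨r / K, div_ne_zero hr hK0, ne_top_of_le_ne_top hN
    (wnorm_subst_le _ _ (hasSubst_shearFamily z c) (fun i => ?_) f)⟩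
  have h1 : wnorm (fun _ => r / K) (shearFamily z c i) ≤
      ((r / K + ‖c i‖₊ * (r / K) : ℝ≥0) : ℝ≥0∞) := by
    rw [shearFamily]
    refine (wnorm_add_le _ _ _).trans ?_
    have h2 : (C (c i) * MvPowerSeries.X z : MvPowerSeries σ ℂ) =
        monomial (Finsupp.single z 1) (c i) := by
      rw [MvPowerSeries.X, ← monomial_zero_eq_C_apply, monomial_mul_monomial, zero_add, mul_one]
    rw [h2, MvPowerSeries.X, wnorm_monomial, wnorm_monomial]
    simp [weight, enorm]
  refine h1.trans ?_
  norm_cast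
  calc r / K + ‖c i‖₊ * (r / K) = (1 + ‖c i‖₊) * (r / K) := by ring
    _ ≤ K * (r / K) := by
      gcongr
      rw [hK]
      gcongr
      exact Finset.single_le_sum (f := fun i => ‖c i‖₊) (fun _ _ => zero_le) (Finset.mem_univ i)
    _ = r := mul_div_cancel₀ _ hK0

/-- The linear change of coordinates `xᵢ ↦ xᵢ + cᵢ z` of the ring of convergent power series. -/
def shearHom [Finite σ] (z : σ) (c : σ → ℂ) : Conv σ →ₐ[ℂ] Conv σ :=
  ((substAlgHom (R := ℂ) (hasSubst_shearFamily z c)).comp (Conv σ).val).codRestrict (Conv σ)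
    fun f => by
      change IsConvergent (substAlgHom (R := ℂ) (hasSubst_shearFamily z c) f.1)
      rw [substAlgHom_apply]
      exact f.2.subst_shearFamily z c

theorem shearHom_val [Finite σ] (z : σ) (c : σ → ℂ) (f : Conv σ) :
    (shearHom z c f).1 = subst (shearFamily z c) f.1 :=
  substAlgHom_apply (hasSubst_shearFamily z c) f.1

/-- The coordinate change `xᵢ ↦ xᵢ + cᵢ z` as an automorphism; it fixes `z`. -/
def shearEquiv [Finite σ] (z : σ) (c : σ → ℂ) (hz : c z = 0) : Conv σ ≃ₐ[ℂ] Conv σ :=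
  AlgEquiv.ofAlgHom (shearHom z c) (shearHom z (-c))
    (AlgHom.ext fun f => Subtype.ext (by
      have := subst_shearFamily_neg z (c := -c) (by simpa using hz) f.1
      rw [neg_neg] at this
      rw [AlgHom.comp_apply, shearHom_val, shearHom_val, this]
      rfl))
    (AlgHom.ext fun f => Subtype.ext (by
      rw [AlgHom.comp_apply, shearHom_val, shearHom_val, subst_shearFamily_neg z hz]
      rfl))

/-- The restriction of `f(x + c z)` to the `z`-axis is `∑ f_m c^m z^|m|`, with the entry
`c_z = 0` replaced by `1`. -/
theorem coeff_single_subst_shearFamily [Finite σ] [DecidableEq σ] (z : σ) {c : σ → ℂ}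
    (hz : c z = 0) (f : MvPowerSeries σ ℂ) (j : ℕ) :
    coeff (Finsupp.single z j) (subst (shearFamily z c) f) =
      ∑ᶠ d : σ →₀ ℕ, if d.degree = j then
        coeff d f * d.prod fun i a => (c i + if i = z then 1 else 0) ^ a else 0 := by
  rw [coeff_subst (hasSubst_shearFamily z c)]
  refine finsum_congr fun d => ?_
  let e : Unit ↪ σ := ⟨fun _ => z, fun _ _ _ => rfl⟩
  have h1 : Finsupp.single z j = Finsupp.embDomain e (Finsupp.single () j) := by
    rw [Finsupp.embDomain_single]
    rfl
  have h2 (i : σ) : killCompl e (shearFamily z c i) =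
      C (c i + if i = z then 1 else 0) * X () := by
    have hzX : killCompl (R := ℂ) e (X z) = X () := killCompl_X (e := e) ()
    rw [shearFamily, map_add, map_mul, killCompl_C, hzX]
    by_cases hi : i = z
    · rw [hi, hzX, hz]
      simp
    · rw [killCompl_X_eq_zero, if_neg hi]
      · simp
      · rintro ⟨u, hu⟩
        exact hi hu.symm
  have h3 : killCompl e (d.prod fun s e => shearFamily z c s ^ e) =
      C (d.prod fun i a => (c i + if i = z then 1 else 0) ^ a) * X () ^ d.degree := by
    simp only [Finsupp.prod, map_prod, map_pow, h2, mul_pow, Finset.prod_mul_distrib,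
      Finset.prod_pow_eq_pow_sum, Finsupp.degree_apply]
  rw [h1, ← coeff_killCompl, h3, coeff_C_mul, X_pow_eq, coeff_monomial]
  by_cases hd : d.degree = j
  · simp [hd]
  · rw [if_neg hd, if_neg]
    · simp
    · intro h
      exact hd (Finsupp.single_injective _ h).symm

/-- After a linear change of coordinates, a nonzero convergent power series is regular in the
direction of the variable `z`. -/
theorem exists_shear_regular [Finite σ] (z : σ) {f : Conv σ} (hf : f ≠ 0) :
    ∃ (c : σ → ℂ) (hz : c z = 0) (b : ℕ),
      (∀ j < b, coeff (Finsupp.single z j) (shearEquiv z c hz f).1 = 0) ∧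
      coeff (Finsupp.single z b) (shearEquiv z c hz f).1 ≠ 0 := by
  classical
  cases nonempty_fintype σ
  have hex : ∃ b, ∃ m : σ →₀ ℕ, m.degree = b ∧ coeff m f.1 ≠ 0 := by
    by_contra! h
    exact hf (Subtype.ext (MvPowerSeries.ext fun m => h _ m rfl))
  obtain ⟨m₀, hm₀, hm₀f⟩ := Nat.find_spec hex
  set b := Nat.find hex with hb
  have hlow (m : σ →₀ ℕ) (hm : m.degree < b) : coeff m f.1 = 0 := by
    by_contra h
    exact Nat.find_min hex hm ⟨m, rfl, h⟩
  -- The leading form of `f` and a point with nonzero `z`-coordinate where it does not vanish.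
  set s : Finset (σ →₀ ℕ) := Finset.finsuppAntidiag Finset.univ b with hs
  have hmem (m : σ →₀ ℕ) : m ∈ s ↔ m.degree = b := by
    rw [hs, Finset.mem_finsuppAntidiag, Finsupp.degree_eq_sum]
    simp
  set F : MvPolynomial σ ℂ := ∑ m ∈ s, MvPolynomial.monomial m (coeff m f.1) with hF
  have hF0 : F ≠ 0 := by
    intro h
    apply hm₀f
    have := congrArg (MvPolynomial.coeff m₀) h
    rw [hF, MvPolynomial.coeff_sum] at this
    simp_rw [MvPolynomial.coeff_monomial] at this
    rw [Finset.sum_ite_eq_of_mem' _ _ _ ((hmem m₀).2 hm₀)] at this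
    simpa using this
  obtain ⟨x, hx⟩ : ∃ x : σ → ℂ, MvPolynomial.eval x (F * MvPolynomial.X z) ≠ 0 := by
    by_contra! h
    have := MvPolynomial.funext (p := F * MvPolynomial.X z) (q := 0) fun x => by simpa using h x
    exact mul_ne_zero hF0 (MvPolynomial.X_ne_zero z) this
  rw [map_mul, MvPolynomial.eval_X] at hx
  have hxz : x z ≠ 0 := right_ne_zero_of_mul hx
  set c : σ → ℂ := fun i => if i = z then 0 else x i / x z with hc
  have hcz : c z = 0 := if_pos rfl
  have hcx (i : σ) : (c i + if i = z then 1 else 0) = x i / x z := by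
    by_cases hi : i = z
    · rw [hi, hcz, if_pos rfl, div_self hxz, zero_add]
    · simp [hc, hi]
  refine ⟨c, hcz, b, fun j hj => ?_, ?_⟩
  · change coeff _ (shearHom z c f).1 = 0
    rw [shearHom_val, coeff_single_subst_shearFamily z hcz]
    refine finsum_eq_zero_of_forall_eq_zero fun d => ?_
    split_ifs with hd
    · rw [hlow d (hd.trans_lt hj), zero_mul]
    · rfl
  · change coeff _ (shearHom z c f).1 ≠ 0
    rw [shearHom_val, coeff_single_subst_shearFamily z hcz]
    have e : (∑ᶠ d : σ →₀ ℕ, if d.degree = b then coeff d f.1 *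
        d.prod fun i a => (c i + if i = z then 1 else 0) ^ a else 0) =
        MvPolynomial.eval x F / x z ^ b := by
      rw [finsum_eq_sum_of_support_subset (s := s)]
      · rw [hF, map_sum, Finset.sum_div]
        refine Finset.sum_congr rfl fun d hd => ?_
        rw [if_pos ((hmem d).1 hd), MvPolynomial.eval_monomial, mul_div_assoc]
        congr 1
        simp_rw [hcx]
        rw [Finsupp.prod, Finsupp.prod]
        simp_rw [div_pow]
        rw [Finset.prod_div_distrib, Finset.prod_pow_eq_pow_sum, ← Finsupp.degree_apply,
          (hmem d).1 hd]
      · intro d hd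
        rw [Finset.mem_coe, hmem]
        by_contra h
        exact hd (if_neg h)
    rw [e]
    exact div_ne_zero (left_ne_zero_of_mul hx) (pow_ne_zero _ hxz)

end Shear

/-! ### Weierstrass preparation and the Noetherian property -/

section Weierstrass

open MvPowerSeries

variable {σ : Type}

/-- A ring `S` over a Noetherian ring `A` is Noetherian when every nonzero element can be moved by
an automorphism to an element whose quotient is a finite `A`-module. -/
theorem isNoetherianRing_of_finite_quotient {A S : Type} [CommRing A] [CommRing S] [Algebra A S]
    [IsNoetherianRing A]
    (h : ∀ f : S, f ≠ 0 → ∃ θ : S ≃+* S, Module.Finite A (S ⧸ Ideal.span {θ f})) :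
    IsNoetherianRing S := by
  refine isNoetherianRing_iff_ideal_fg S |>.2 fun I => ?_
  by_cases hI : I = ⊥
  · rw [hI]
    exact Submodule.fg_bot
  obtain ⟨f, hf, hf0⟩ := Submodule.exists_mem_ne_zero_of_ne_bot hI
  obtain ⟨θ, hθ⟩ := h f hf0
  have h1 : IsNoetherian A (S ⧸ Ideal.span {θ f}) :=
    isNoetherian_of_isNoetherianRing_of_finite A _
  have h2 : IsNoetherian S (S ⧸ Ideal.span {θ f}) := isNoetherian_of_tower A h1
  have hJ : (I.map θ).FG := by
    refine Submodule.fg_of_fg_map_of_fg_inf_ker (Ideal.span {θ f}).mkQ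
      (IsNoetherian.noetherian _) ?_
    rw [Submodule.ker_mkQ, inf_eq_right.2 ((Ideal.span_singleton_le_iff_mem _).2
      (Ideal.mem_map_of_mem θ hf))]
    exact ⟨{θ f}, by simp⟩
  have := hJ.map (θ.symm : S →+* S)
  rwa [show (I.map θ).map (θ.symm : S →+* S) = I from Ideal.map_of_equiv θ] at this

/-- A convergent power series whose expansion has degree less than `b` in the variable `z` is a
combination of `1, z, …, z ^ (b - 1)`. -/
theorem eq_sum_of_coeff_eq_zero (b : ℕ) (r : Conv (σ ⊕ Unit))
    (hr : ∀ m : σ ⊕ Unit →₀ ℕ, b ≤ m (Sum.inr ()) → coeff m r.1 = 0) :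
    r = ∑ j ∈ Finset.range b, convRename Function.Embedding.inl
      (coeff (Finsupp.single () j) (convExpand (Equiv.refl _) r)) * convX (Sum.inr ()) ^ j := by
  apply convExpand_injective (Equiv.refl _)
  refine MvPowerSeries.ext fun α => ?_
  obtain ⟨a, rfl⟩ : ∃ a, α = Finsupp.single () a := ⟨α (), Finsupp.unique_single α⟩
  have h1 : ∀ x : Conv σ, ∀ j : ℕ, coeff (Finsupp.single () a) (convExpand (Equiv.refl (σ ⊕ Unit))
      (convRename Function.Embedding.inl x * convX (Sum.inr ()) ^ j)) = if a = j then x else 0 := by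
    intro x j
    classical
    rw [map_mul, map_pow]
    have e1 := convExpand_convRename (Equiv.refl (σ ⊕ Unit)) x
    have e2 := convExpand_convX_inr (Equiv.refl (σ ⊕ Unit)) ()
    change convExpand (Equiv.refl (σ ⊕ Unit)) (convRename Function.Embedding.inl x) = _ at e1
    change convExpand (Equiv.refl (σ ⊕ Unit)) (convX (Sum.inr ())) = _ at e2
    rw [e1, e2, coeff_C_mul, X_pow_eq, coeff_monomial]
    simp [(Finsupp.single_injective ()).eq_iff]
  rw [map_sum, map_sum, Finset.sum_congr rfl fun j _ => h1 _ j, Finset.sum_ite_eq]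
  split_ifs with h
  · rfl
  · apply Subtype.ext
    ext m
    rw [coeff_convExpand]
    refine hr _ ?_
    have := expEquiv_inr (Equiv.refl (σ ⊕ Unit)) m (Finsupp.single () a) ()
    rw [Equiv.refl_apply] at this
    rw [this]
    simpa using h

/-- The Weierstrass division theorem: the quotient by a series regular of order `b` in `z` is
generated by `1, z, …, z ^ (b - 1)` as a module over the series in the other variables. -/
theorem exists_sum_sub_mem_span [Finite σ] (b : ℕ) {f : Conv (σ ⊕ Unit)}
    (hlt : ∀ j < b, coeff (Finsupp.single (Sum.inr ()) j) f.1 = 0)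
    (hb : coeff (Finsupp.single (Sum.inr ()) b) f.1 ≠ 0) (g : Conv (σ ⊕ Unit)) :
    ∃ a : ℕ → Conv σ, g - ∑ j ∈ Finset.range b,
      convRename Function.Embedding.inl (a j) * convX (Sum.inr ()) ^ j ∈ Ideal.span {f} := by
  set u := coeff (Finsupp.single (Sum.inr ()) b) f.1 with hu
  obtain ⟨q, hq⟩ := exists_weierstrass_div (Sum.inr ()) b (f := u⁻¹ • f)
    (fun j hj => by
      change coeff _ (u⁻¹ • f.1) = 0
      rw [coeff_smul, hlt j hj, mul_zero])
    (by
      change coeff _ (u⁻¹ • f.1) = 1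
      rw [coeff_smul, ← hu, inv_mul_cancel₀ hb]) g
  have := eq_sum_of_coeff_eq_zero b _ hq
  refine ⟨fun j => coeff (Finsupp.single () j)
    (convExpand (Equiv.refl (σ ⊕ Unit)) (g - q * u⁻¹ • f)), ?_⟩
  rw [← this, sub_sub_cancel, mul_smul_comm, ← smul_mul_assoc]
  exact Ideal.mul_mem_left _ _ (Ideal.mem_span_singleton_self f)

theorem finite_quotient_of_regular [Finite σ] (b : ℕ) {f : Conv (σ ⊕ Unit)}
    (hlt : ∀ j < b, coeff (Finsupp.single (Sum.inr ()) j) f.1 = 0)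
    (hb : coeff (Finsupp.single (Sum.inr ()) b) f.1 ≠ 0) :
    letI := (convRename (Function.Embedding.inl : σ ↪ σ ⊕ Unit)).toAlgebra
    Module.Finite (Conv σ) (Conv (σ ⊕ Unit) ⧸ Ideal.span {f}) := by
  let _ := (convRename (Function.Embedding.inl : σ ↪ σ ⊕ Unit)).toAlgebra
  refine Module.Finite.of_surjective (R := Conv σ) (M := Fin b → Conv σ)
    (Fintype.linearCombination (Conv σ) fun j : Fin b =>
      Ideal.Quotient.mk (Ideal.span {f}) (convX (Sum.inr ()) ^ (j : ℕ))) fun g => ?_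
  obtain ⟨g, rfl⟩ := Ideal.Quotient.mk_surjective g
  obtain ⟨a, ha⟩ := exists_sum_sub_mem_span b hlt hb g
  refine ⟨fun j => a j, ?_⟩
  rw [(Ideal.Quotient.mk_eq_mk_iff_sub_mem _ _).2 ha, Fintype.linearCombination_apply, map_sum,
    ← Fin.sum_univ_eq_sum_range (fun j => Ideal.Quotient.mk (Ideal.span {f})
      (convRename Function.Embedding.inl (a j) * convX (Sum.inr ()) ^ j))]
  refine Finset.sum_congr rfl fun j _ => ?_
  change Ideal.Quotient.mk _ (a j • (convX (Sum.inr ()) ^ (j : ℕ) : Conv (σ ⊕ Unit))) = _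
  rw [Algebra.smul_def]
  rfl

/-- One variable at a time: after a shear, Weierstrass division by a nonzero series `f` makes the
quotient by `f` finite over the series in the other variables. -/
theorem isNoetherianRing_conv_step [Finite σ] [IsNoetherianRing (Conv σ)] :
    IsNoetherianRing (Conv (σ ⊕ Unit)) := by
  let _ := (convRename (Function.Embedding.inl : σ ↪ σ ⊕ Unit)).toAlgebra
  refine isNoetherianRing_of_finite_quotient (A := Conv σ) fun f hf => ?_
  obtain ⟨c, hz, b, hlt, hb⟩ := exists_shear_regular (Sum.inr ()) hf
  exact ⟨(shearEquiv (Sum.inr ()) c hz).toRingEquiv, finite_quotient_of_regular b hlt hb⟩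

instance [Finite σ] : IsNoetherianRing (Conv σ) := by
  induction σ using Finite.induction_empty_option with
  | of_equiv e h => exact isNoetherianRing_of_ringEquiv _ (convRenameEquiv e).toRingEquiv
  | h_empty =>
    have h := maximalIdeal_conv (σ := PEmpty)
    rw [Set.range_eq_empty, Ideal.span_empty] at h
    have := (IsLocalRing.isField_iff_maximalIdeal_eq (R := Conv PEmpty)).2 h
    let _ := this.toField
    infer_instance
  | h_option h =>
    have := @isNoetherianRing_conv_step _ _ h
    exact isNoetherianRing_of_ringEquiv _
      (convRenameEquiv (Equiv.optionEquivSumPUnit _).symm).toRingEquiv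

end Weierstrass

/-! ### Coefficientwise membership and flatness -/

section CoeffExt

open MvPowerSeries

/-- The properties of an extension `φ : R → S` of coordinate rings by the variables `τ` which are
shared by polynomials and by convergent power series: `c` expands the elements of `S` with respect
to the new variables, and membership in an extended submodule of a free module can be tested on
the coefficients. The map `ψ : T → S` is the inclusion of the functions of the new variables,
whose expansions have constant coefficients. -/
structure IsExpansion {R S T τ : Type} [CommRing R] [CommRing S] [CommRing T] [Algebra ℂ R]
    (φ : R →+* S) (ψ : T →+* S) (c : S →+* MvPowerSeries τ R) : Prop where
  map_left : ∀ r, c (φ r) = C r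
  map_right : ∀ t α, ∃ a : ℂ, coeff α (c (ψ t)) = algebraMap ℂ R a
  mem_span : ∀ {ι : Type} [Finite ι] (K : Submodule R (ι → R)) (g : ι → S),
    (∀ α, (fun i => coeff α (c (g i))) ∈ K) →
      g ∈ Submodule.span S ((fun v i => φ (v i)) '' (K : Set (ι → R)))

variable {σ τ ρ : Type}

theorem map_mem_ideal_smul_top {R ι : Type} [CommRing R] [Finite ι] {I : Ideal R} {v : ι → R}
    (hv : ∀ i, v i ∈ I) : v ∈ I • (⊤ : Submodule R (ι → R)) := by
  classical
  cases nonempty_fintype ι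
  rw [pi_eq_sum_univ' v]
  exact Submodule.sum_mem _ fun i _ => Submodule.smul_mem_smul (hv i) trivial

/-- The monomial `y ^ α` in the second group of variables. -/
def convMonomial (E : σ ⊕ τ ≃ ρ) (α : τ →₀ ℕ) : Conv ρ :=
  α.prod fun j a => convX (E (Sum.inr j)) ^ a

theorem convExpand_convMonomial (E : σ ⊕ τ ≃ ρ) (α : τ →₀ ℕ) :
    convExpand E (convMonomial E α) = monomial α 1 := by
  rw [convMonomial, map_finsuppProd, monomial_one_eq]
  exact Finsupp.prod_congr fun j _ => by rw [map_pow, convExpand_convX_inr]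

/-- The expansion of a convergent power series up to terms of order `N`. -/
theorem sub_sum_mem_maximalIdeal_pow [Finite σ] [Finite τ] (E : σ ⊕ τ ≃ ρ) (N : ℕ)
    (f : Conv ρ) : f - ∑ α ∈ (Finsupp.finite_of_degree_lt (σ := τ) N).toFinset,
      convMonomial E α * convRename (Function.Embedding.inl.trans E.toEmbedding)
        (coeff α (convExpand E f)) ∈ IsLocalRing.maximalIdeal (Conv ρ) ^ N := by
  classical
  have : Finite ρ := Finite.of_equiv _ E
  cases nonempty_fintype ρ
  refine mem_maximalIdeal_pow_of_coeff_eq_zero N fun m hm => ?_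
  obtain ⟨⟨m, α⟩, rfl⟩ := (expEquiv E).surjective m
  rw [degree_expEquiv] at hm
  rw [← coeff_convExpand, map_sub, map_sub, map_sum, map_sum]
  have h1 : ∀ β : τ →₀ ℕ, coeff α (convExpand E (convMonomial E β *
      convRename (Function.Embedding.inl.trans E.toEmbedding) (coeff β (convExpand E f)))) =
      if β = α then coeff α (convExpand E f) else 0 := by
    intro β
    rw [map_mul, convExpand_convMonomial, convExpand_convRename, coeff_mul_C, coeff_monomial]
    by_cases h : β = α
    · subst h
      simp
    · rw [if_neg h, if_neg (Ne.symm h), zero_mul]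
  rw [Finset.sum_congr rfl fun β _ => h1 β, Finset.sum_ite_eq',
    if_pos ((Set.Finite.mem_toFinset _).2 (by simp only [Set.mem_ofPred_eq]; omega)), sub_self]
  exact map_zero _

theorem isExpansion_conv [Finite σ] [Finite τ] (E : σ ⊕ τ ≃ ρ) :
    IsExpansion (convRename (Function.Embedding.inl.trans E.toEmbedding))
      (convRename (Function.Embedding.inr.trans E.toEmbedding)) (convExpand E) where
  map_left := convExpand_convRename E
  map_right t α := ⟨_, coeff_convExpand_convRename_inr E t α⟩
  mem_span {ι} _ K g hg := by
    have : Finite ρ := Finite.of_equiv _ E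
    set W := Submodule.span (Conv ρ)
      ((fun v i => convRename (Function.Embedding.inl.trans E.toEmbedding) (v i)) ''
        (K : Set (ι → Conv σ))) with hW
    -- By Krull's intersection theorem it suffices to work modulo powers of the maximal ideal.
    have hkrull := Ideal.iInf_pow_smul_eq_bot_of_isLocalRing (M := (ι → Conv ρ) ⧸ W)
      (IsLocalRing.maximalIdeal (Conv ρ)) (Ideal.IsPrime.ne_top inferInstance)
    rw [← Submodule.Quotient.mk_eq_zero, ← Submodule.mem_bot (Conv ρ), ← hkrull,
      Submodule.mem_iInf]
    intro N
    set s := (Finsupp.finite_of_degree_lt (σ := τ) N).toFinset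
    set g' : ι → Conv ρ := ∑ α ∈ s, convMonomial E α • fun i =>
      convRename (Function.Embedding.inl.trans E.toEmbedding) (coeff α (convExpand E (g i)))
    have h1 : g' ∈ W := Submodule.sum_mem _ fun α _ => Submodule.smul_mem _ _
      (Submodule.subset_span ⟨_, hg α, rfl⟩)
    have h2 : g - g' ∈
        IsLocalRing.maximalIdeal (Conv ρ) ^ N • (⊤ : Submodule (Conv ρ) (ι → Conv ρ)) := by
      refine map_mem_ideal_smul_top fun i => ?_
      have := sub_sum_mem_maximalIdeal_pow E N (g i)
      simpa only [Pi.sub_apply, g', Finset.sum_apply, Pi.smul_apply, smul_eq_mul] using this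
    have h3 : W.mkQ g = W.mkQ (g - g') := by
      rw [map_sub, (Submodule.Quotient.mk_eq_zero W).2 h1 |> fun h => (h : W.mkQ g' = 0), sub_zero]
    change W.mkQ g ∈ _
    rw [h3]
    have h4 := Submodule.mem_map_of_mem (f := W.mkQ) h2
    rw [Submodule.map_smul''] at h4
    exact Submodule.smul_mono le_rfl le_top h4

/-- The expansion of a polynomial with respect to some of the variables. -/
def polyExpand (E : σ ⊕ τ ≃ ρ) :
    MvPolynomial ρ ℂ →ₐ[ℂ] MvPolynomial τ (MvPolynomial σ ℂ) :=
  MvPolynomial.aeval fun r =>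
    Sum.elim (fun i => MvPolynomial.C (MvPolynomial.X i)) MvPolynomial.X (E.symm r)

theorem polyExpand_rename_inl (E : σ ⊕ τ ≃ ρ) (f : MvPolynomial σ ℂ) :
    polyExpand E (MvPolynomial.rename (Function.Embedding.inl.trans E.toEmbedding) f) =
      MvPolynomial.C f := by
  rw [polyExpand, MvPolynomial.aeval_rename]
  induction f using MvPolynomial.induction_on with
  | C a => simp [MvPolynomial.algebraMap_eq, IsScalarTower.algebraMap_apply ℂ (MvPolynomial σ ℂ)]
  | add p q hp hq => rw [map_add, map_add, hp, hq]
  | mul_X p i hp => rw [map_mul, map_mul, hp, MvPolynomial.aeval_X]; simp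

theorem polyExpand_rename_inr (E : σ ⊕ τ ≃ ρ) (f : MvPolynomial τ ℂ) :
    polyExpand E (MvPolynomial.rename (Function.Embedding.inr.trans E.toEmbedding) f) =
      MvPolynomial.map (algebraMap ℂ (MvPolynomial σ ℂ)) f := by
  rw [polyExpand, MvPolynomial.aeval_rename]
  induction f using MvPolynomial.induction_on with
  | C a => simp [MvPolynomial.algebraMap_eq, IsScalarTower.algebraMap_apply ℂ (MvPolynomial σ ℂ)]
  | add p q hp hq => rw [map_add, map_add, hp, hq]
  | mul_X p i hp => rw [map_mul, map_mul, hp, MvPolynomial.aeval_X]; simp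

theorem eval₂_polyExpand (E : σ ⊕ τ ≃ ρ) (f : MvPolynomial ρ ℂ) :
    MvPolynomial.eval₂
      (MvPolynomial.rename (R := ℂ) (Function.Embedding.inl.trans E.toEmbedding)).toRingHom
      (fun j => MvPolynomial.X (E (Sum.inr j))) (polyExpand E f) = f := by
  induction f using MvPolynomial.induction_on with
  | C a =>
    simp [polyExpand, MvPolynomial.algebraMap_eq,
      IsScalarTower.algebraMap_apply ℂ (MvPolynomial σ ℂ)]
  | add p q hp hq => rw [map_add, MvPolynomial.eval₂_add, hp, hq]
  | mul_X p r hp =>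
    rw [map_mul, MvPolynomial.eval₂_mul, hp, polyExpand, MvPolynomial.aeval_X]
    obtain ⟨i | j, rfl⟩ := E.surjective r <;> simp

/-- The expansion of a polynomial, as a power series. -/
def polySeries (E : σ ⊕ τ ≃ ρ) : MvPolynomial ρ ℂ →+* MvPowerSeries τ (MvPolynomial σ ℂ) :=
  (MvPolynomial.coeToMvPowerSeries.ringHom).comp (polyExpand E).toRingHom

theorem coeff_polySeries (E : σ ⊕ τ ≃ ρ) (f : MvPolynomial ρ ℂ) (α : τ →₀ ℕ) :
    coeff α (polySeries E f) = MvPolynomial.coeff α (polyExpand E f) :=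
  MvPolynomial.coeff_coe _ _

theorem isExpansion_poly (E : σ ⊕ τ ≃ ρ) :
    IsExpansion
      (MvPolynomial.rename (R := ℂ) (Function.Embedding.inl.trans E.toEmbedding)).toRingHom
      (MvPolynomial.rename (R := ℂ) (Function.Embedding.inr.trans E.toEmbedding)).toRingHom
      (polySeries E) where
  map_left r := by
    refine MvPowerSeries.ext fun α => ?_
    classical
    have := polyExpand_rename_inl E r
    rw [coeff_polySeries]
    erw [this]
    rw [MvPolynomial.coeff_C, coeff_C]
    simp only [eq_comm]
  map_right t α := by
    refine ⟨MvPolynomial.coeff α t, ?_⟩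
    have := polyExpand_rename_inr E t
    rw [coeff_polySeries]
    erw [this]
    rw [MvPolynomial.coeff_map]
  mem_span {ι} _ K g hg := by
    classical
    cases nonempty_fintype ι
    set s := Finset.univ.biUnion fun i => (polyExpand E (g i)).support
    have h : g = ∑ α ∈ s,
        (α.prod fun j a => (MvPolynomial.X (E (Sum.inr j)) : MvPolynomial ρ ℂ) ^ a) • fun i =>
        (MvPolynomial.rename (R := ℂ) (Function.Embedding.inl.trans E.toEmbedding)).toRingHom
          (coeff α (polySeries E (g i))) := by
      funext i
      conv_lhs => rw [← eval₂_polyExpand E (g i)]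
      rw [MvPolynomial.eval₂_eq, Finset.sum_apply]
      have hs : (polyExpand E (g i)).support ⊆ s := fun α hα =>
        Finset.mem_biUnion.2 ⟨i, Finset.mem_univ i, hα⟩
      refine (Finset.sum_subset hs fun α _ hα => ?_).trans (Finset.sum_congr rfl fun α _ => ?_)
      · rw [MvPolynomial.notMem_support_iff.1 hα, map_zero, zero_mul]
      · rw [Pi.smul_apply, smul_eq_mul, mul_comm, coeff_polySeries]
        rfl
    rw [h]
    exact Submodule.sum_mem _ fun α _ => Submodule.smul_mem _ _
      (Submodule.subset_span ⟨_, hg α, rfl⟩)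

section Consequences

variable {R S T : Type} [CommRing R] [CommRing S] [CommRing T] [Algebra ℂ R]
  {φ : R →+* S} {ψ : T →+* S} {c : S →+* MvPowerSeries τ R}

theorem IsExpansion.mem_map_iff (h : IsExpansion φ ψ c) (I : Ideal R) {s : S} :
    s ∈ I.map φ ↔ ∀ α, coeff α (c s) ∈ I := by
  constructor
  · intro hs α
    refine Submodule.span_induction (p := fun s _ => ∀ α, coeff α (c s) ∈ I) ?_ ?_ ?_ ?_ hs α
    · rintro _ ⟨r, hr, rfl⟩ α
      classical
      rw [h.map_left, coeff_C]
      split_ifs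
      · exact hr
      · exact I.zero_mem
    · intro α
      rw [map_zero, map_zero]
      exact I.zero_mem
    · intro x y _ _ hx hy α
      rw [map_add, map_add]
      exact I.add_mem (hx α) (hy α)
    · intro a x _ hx α
      classical
      rw [smul_eq_mul, map_mul, coeff_mul]
      exact I.sum_mem fun p _ => I.mul_mem_left _ (hx _)
  · intro hs
    have := h.mem_span (ι := Unit)
      (Submodule.comap (LinearMap.proj (R := R) (φ := fun _ : Unit => R) ()) I) (fun _ => s)
      (fun α => hs α)
    have h2 := Submodule.mem_map_of_mem (f := LinearMap.proj (R := S) (φ := fun _ : Unit => S) ())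
      this
    rw [Submodule.map_span] at h2
    refine Submodule.span_mono ?_ h2
    rintro _ ⟨_, ⟨v, hv, rfl⟩, rfl⟩
    exact ⟨v (), hv, rfl⟩

theorem IsExpansion.injective (h : IsExpansion φ ψ c) : Function.Injective c := by
  refine (injective_iff_map_eq_zero c).2 fun s hs => ?_
  have : s ∈ (⊥ : Ideal R).map φ := (h.mem_map_iff ⊥).2 fun α => by simp [hs]
  simpa using this

theorem IsExpansion.injective_left (h : IsExpansion φ ψ c) : Function.Injective φ := by
  refine (injective_iff_map_eq_zero φ).2 fun r hr => ?_
  have := h.map_left r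
  rw [hr, map_zero] at this
  exact (C_injective (σ := τ) (R := R)) (by rw [← this, map_zero])

/-- The restriction to `y = 0`, which is a retraction of `φ`. -/
def IsExpansion.retraction (_ : IsExpansion φ ψ c) : S →+* R := constantCoeff.comp c

theorem IsExpansion.retraction_map (h : IsExpansion φ ψ c) (r : R) : h.retraction (φ r) = r := by
  rw [IsExpansion.retraction, RingHom.comp_apply, h.map_left, constantCoeff_C]

theorem IsExpansion.comap_map (h : IsExpansion φ ψ c) (I : Ideal R) : (I.map φ).comap φ = I := by
  refine le_antisymm (fun r hr => ?_) Ideal.le_comap_map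
  have := (h.mem_map_iff I).1 hr 0
  rwa [h.map_left, coeff_zero_C] at this

/-- A relation over `S` with coefficients in `R` is a combination of relations over `R`; by the
equational criterion, `S` is flat over `R`. -/
theorem IsExpansion.flat (h : IsExpansion φ ψ c) : φ.Flat := by
  algebraize [φ]
  refine Module.Flat.of_forall_isTrivialRelation fun {l f x} hfx => ?_
  have h1 := h.mem_span (LinearMap.ker (Fintype.linearCombination R f)) x fun α => by
    rw [LinearMap.mem_ker, Fintype.linearCombination_apply]
    have := congrArg (fun s => coeff α (c s)) hfx
    simp only [map_sum, map_zero, Algebra.smul_def, map_mul] at this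
    rw [← this]
    refine Finset.sum_congr rfl fun i _ => ?_
    rw [show c (algebraMap R S (f i)) = C (f i) from h.map_left _, coeff_C_mul, smul_eq_mul,
      mul_comm]
  obtain ⟨t, ht, b, hb⟩ := (Submodule.mem_span_image_iff_exists_fun S).1 h1
  refine ⟨t.card, fun i j => (t.equivFin.symm j : Fin l → R) i, fun j => b (t.equivFin.symm j),
    fun i => ?_, fun j => ?_⟩
  · rw [← hb, Finset.sum_apply,
      t.equivFin.symm.sum_comp fun j : t => (j : Fin l → R) i • b j]
    refine Finset.sum_congr rfl fun j _ => ?_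
    rw [Pi.smul_apply, smul_eq_mul, mul_comm, Algebra.smul_def]
    rfl
  · have := ht (t.equivFin.symm j).2
    rw [SetLike.mem_coe, LinearMap.mem_ker, Fintype.linearCombination_apply] at this
    simpa only [smul_eq_mul, mul_comm] using this

end Consequences

end CoeffExt

/-! ### Normalization at a prime: the inductive step -/

section Normalization

/-- For some `m`, the prime `p` contains a regular sequence of length `m` and satisfies the Jacobian
criterion with `m` functions of `p`: the matrix of the derivatives of the functions `f` along `D`
is triangular modulo `p`, with nonzero diagonal. Here `n` stands for the dimension of `S`, and the
last condition makes `m` at least the codimension `n - dim S / p`, without subtraction. -/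
def NormalAt {S : Type} [CommRing S] [Algebra ℂ S] (n : ℕ) (p : Ideal S) : Prop :=
  ∃ (m : ℕ) (D : Fin m → Derivation ℂ S S) (f : Fin m → S) (rs : List S),
    (∀ i, f i ∈ p) ∧ (∀ i j, j < i → D i (f j) ∈ p) ∧ (∀ i, D i (f i) ∉ p) ∧
    RingTheory.Sequence.IsWeaklyRegular S rs ∧ rs.length = m ∧ (∀ r ∈ rs, r ∈ p) ∧
    (n : WithBot ℕ∞) ≤ ringKrullDim (S ⧸ p) + m

/-- By going up, chains of primes lift along an integral injection. -/
theorem ringKrullDim_le_of_isIntegral {A B : Type} [CommRing A] [CommRing B] [Algebra A B]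
    [IsDomain B] [Algebra.IsIntegral A B] (h : Function.Injective (algebraMap A B)) :
    ringKrullDim A ≤ ringKrullDim B := by
  refine iSup_le fun l => ?_
  obtain ⟨P, hP, hl⟩ := Ideal.exists_ideal_over_prime_of_isIntegral_of_isDomain (S := B)
    (RelSeries.head l).asIdeal (by rw [(RingHom.injective_iff_ker_eq_bot _).1 h]; exact bot_le)
  have : P.LiesOver (RelSeries.head l).asIdeal := ⟨hl.symm⟩
  obtain ⟨L, hL, -⟩ := Ideal.exists_ltSeries_of_hasGoingUp l P
  rw [← hL]
  exact Order.LTSeries.length_le_krullDim L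

/-- A derivation transported along an isomorphism. -/
def conjDerivation {S S' : Type} [CommRing S] [Algebra ℂ S] [CommRing S'] [Algebra ℂ S']
    (θ : S ≃ₐ[ℂ] S') (D : Derivation ℂ S S) : Derivation ℂ S' S' :=
  Derivation.mk' (θ.toLinearMap ∘ₗ (D : S →ₗ[ℂ] S) ∘ₗ θ.symm.toLinearMap) fun a b => by
    simp

theorem conjDerivation_apply {S S' : Type} [CommRing S] [Algebra ℂ S] [CommRing S'] [Algebra ℂ S']
    (θ : S ≃ₐ[ℂ] S') (D : Derivation ℂ S S) (a : S) :
    conjDerivation θ D (θ a) = θ (D a) :=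
  congrArg (fun b => θ (D b)) (θ.symm_apply_apply a)

theorem NormalAt.of_equiv {S S' : Type} [CommRing S] [Algebra ℂ S] [CommRing S'] [Algebra ℂ S']
    (θ : S ≃ₐ[ℂ] S') {n : ℕ} {p : Ideal S'} (h : NormalAt n (p.comap θ)) : NormalAt n p := by
  obtain ⟨m, D, f, rs, h1, h2, h3, h4, h5, h6, h7⟩ := h
  refine ⟨m, fun i => conjDerivation θ (D i), fun i => θ (f i), rs.map θ, h1, fun i j hij => ?_,
    fun i => ?_, ?_, by simpa using h5, by simpa using h6, ?_⟩
  · simpa [conjDerivation_apply] using h2 i j hij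
  · simpa [conjDerivation_apply] using h3 i
  · refine (AddEquiv.isWeaklyRegular_congr (e := θ.toRingEquiv.toAddEquiv) ?_).1 h4
    exact List.forall₂_map_right_iff.mpr (List.forall₂_same.mpr fun r _ x => map_mul θ r x)
  · rwa [← ringKrullDim_eq_of_ringEquiv (Ideal.quotientEquiv (p.comap θ) p θ.toRingEquiv
      (Ideal.map_comap_of_surjective _ θ.surjective p).symm)]

theorem derivation_aeval {A S : Type} [CommRing A] [CommRing S] [Algebra ℂ S] [Algebra A S]
    (D : Derivation ℂ S S) (hD : ∀ a, D (algebraMap A S a) = 0) {z : S} (hz : D z = 1)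
    (P : Polynomial A) : D (Polynomial.aeval z P) = Polynomial.aeval z P.derivative := by
  induction P using Polynomial.induction_on' with
  | add P Q hP hQ => simp only [map_add, hP, hQ]
  | monomial n a =>
    rw [Polynomial.derivative_monomial, Polynomial.aeval_monomial, Polynomial.aeval_monomial,
      D.leibniz, hD, D.leibniz_pow, hz]
    simp [mul_assoc]

/-- In characteristic zero, an integral element satisfies, modulo a prime `p`, an equation `P` whose
derivative does not vanish modulo `p`. -/
theorem exists_aeval_mem_derivative_notMem {A S : Type} [CommRing A] [CommRing S] [Algebra A S]
    [Algebra ℂ A] {p : Ideal S} [p.IsPrime] {z : S} {P : Polynomial A} (hP : P.Monic)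
    (hPz : Polynomial.aeval z P ∈ p) :
    ∃ P : Polynomial A, Polynomial.aeval z P ∈ p ∧ Polynomial.aeval z P.derivative ∉ p := by
  classical
  set q := p.comap (algebraMap A S) with hq
  have hex : ∃ d, ∃ P : Polynomial A, P.natDegree = d ∧ Polynomial.aeval z P ∈ p ∧
      ∃ i, P.coeff i ∉ q := by
    refine ⟨_, P, rfl, hPz, P.natDegree, ?_⟩
    rw [hP.coeff_natDegree]
    exact (Ideal.ne_top_iff_one q).1 (Ideal.IsPrime.ne_top inferInstance)
  obtain ⟨Q, hQd, hQz, i, hi⟩ := Nat.find_spec hex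
  have hmin := fun {d} => Nat.find_min (m := d) hex
  refine ⟨Q, hQz, fun hder => ?_⟩
  have hcoe : ∀ j, Q.coeff (j + 1) ∈ q := by
    by_contra! hcon
    obtain ⟨j, hj⟩ := hcon
    refine hmin (d := Q.derivative.natDegree) ?_ ⟨_, rfl, hder, j, fun hmem => hj ?_⟩
    · rw [← hQd]
      refine Polynomial.natDegree_derivative_lt fun h0 => hj ?_
      rw [Polynomial.coeff_eq_zero_of_natDegree_lt (by omega)]
      exact q.zero_mem
    · rw [Polynomial.coeff_derivative] at hmem
      have := q.mul_mem_left (algebraMap ℂ A ((j : ℂ) + 1)⁻¹) hmem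
      have hj0 : ((j : ℂ) + 1) ≠ 0 := by exact_mod_cast Nat.succ_ne_zero j
      rwa [show ((j : A) + 1) = algebraMap ℂ A ((j : ℂ) + 1) by simp, mul_comm (Q.coeff _),
        ← mul_assoc, ← map_mul, inv_mul_cancel₀ hj0, map_one, one_mul] at this
  have h0 : Q.coeff 0 ∈ q := by
    rw [hq, Ideal.mem_comap]
    have h1 : Polynomial.aeval z Q = z * Polynomial.aeval z Q.divX +
        algebraMap A S (Q.coeff 0) := by
      conv_lhs => rw [← Polynomial.X_mul_divX_add Q]
      rw [map_add, map_mul, Polynomial.aeval_X, Polynomial.aeval_C]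
    have h2 : Polynomial.aeval z Q.divX ∈ p := by
      rw [Polynomial.aeval_eq_sum_range]
      refine p.sum_mem fun j _ => ?_
      rw [Polynomial.coeff_divX, Algebra.smul_def]
      exact p.mul_mem_right _ (hcoe j)
    rw [h1] at hQz
    exact (p.add_mem_iff_right (p.mul_mem_left z h2)).1 hQz
  cases i with
  | zero => exact hi h0
  | succ i => exact hi (hcoe i)

/-- The inductive step of the normalization: `S` is an extension of `A` by one variable `z`, and the
prime `p` contains an element `g` such that `S / g` is finite over `A`. -/
theorem NormalAt.step {A S : Type} [CommRing A] [CommRing S] [Algebra ℂ A] [Algebra ℂ S]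
    [Algebra A S] [Module.Flat A S] {n : ℕ} {p : Ideal S} [p.IsPrime] {z g : S}
    (E : Derivation ℂ S S) (hE : ∀ a, E (algebraMap A S a) = 0) (hz : E z = 1)
    (hext : ∀ D : Derivation ℂ A A, ∃ D' : Derivation ℂ S S,
      ∀ a, D' (algebraMap A S a) = algebraMap A S (D a))
    (hgp : g ∈ p) (hfin : Module.Finite A (S ⧸ Ideal.span {g}))
    (hreg : ∀ (I : Ideal A) (s : S), g * s ∈ I.map (algebraMap A S) → s ∈ I.map (algebraMap A S))
    (h : NormalAt n (p.comap (algebraMap A S))) : NormalAt (n + 1) p := by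
  obtain ⟨m, D, f, rs, h1, h2, h3, h4, h5, h6, h7⟩ := h
  choose ext hext using hext
  have hint : Algebra.IsIntegral A (S ⧸ p) := by
    have : Algebra.IsIntegral A (S ⧸ Ideal.span {g}) := inferInstance
    refine ⟨fun x => ?_⟩
    obtain ⟨x, rfl⟩ := Ideal.Quotient.mk_surjective x
    have h := this.isIntegral (Ideal.Quotient.mk _ x)
    exact h.map (Ideal.Quotient.factorₐ A
      ((Ideal.span_singleton_le_iff_mem p).2 hgp) : (S ⧸ Ideal.span {g}) →ₐ[A] S ⧸ p)
  obtain ⟨P, hP, hPz⟩ := hint.isIntegral (Ideal.Quotient.mk p z)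
  have hPz' : Polynomial.aeval z P ∈ p := by
    rw [← Ideal.Quotient.eq_zero_iff_mem]
    have := Polynomial.aeval_algHom_apply (Ideal.Quotient.mkₐ A p) z P
    rw [Ideal.Quotient.mkₐ_eq_mk] at this
    rw [← this]
    exact hPz
  obtain ⟨Q, hQ, hQ'⟩ := exists_aeval_mem_derivative_notMem hP hPz'
  refine ⟨m + 1, Fin.snoc (fun i => ext (D i)) E,
    Fin.snoc (fun i => algebraMap A S (f i)) (Polynomial.aeval z Q),
    rs.map (algebraMap A S) ++ [g], ?_, ?_, ?_, ?_, by simp [h5], ?_, ?_⟩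
  · refine Fin.lastCases ?_ fun i => ?_
    · rwa [Fin.snoc_last]
    · rw [Fin.snoc_castSucc]
      exact h1 i
  · refine Fin.lastCases ?_ fun i => ?_ <;> refine Fin.lastCases ?_ fun j => ?_
    · exact fun h => absurd h (lt_irrefl _)
    · intro _
      rw [Fin.snoc_last, Fin.snoc_castSucc, hE]
      exact p.zero_mem
    · exact fun h => absurd h (not_lt_of_ge (Fin.le_last _))
    · intro hij
      rw [Fin.snoc_castSucc, Fin.snoc_castSucc, hext]
      exact h2 i j hij
  · refine Fin.lastCases ?_ fun i => ?_
    · rwa [Fin.snoc_last, Fin.snoc_last, derivation_aeval E hE hz]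
    · rw [Fin.snoc_castSucc, Fin.snoc_castSucc, hext]
      exact h3 i
  · rw [RingTheory.Sequence.isWeaklyRegular_append_iff]
    refine ⟨h4.of_flat, (RingTheory.Sequence.isWeaklyRegular_singleton_iff _ _).2 ?_⟩
    have hI : (Ideal.ofList (rs.map (algebraMap A S)) • ⊤ : Submodule S S) =
        (Ideal.ofList rs).map (algebraMap A S) := by
      rw [Ideal.map_ofList, smul_eq_mul]
      exact Ideal.mul_top _
    rw [hI]
    refine isSMulRegular_iff_right_eq_zero_of_smul.2 fun x hx => ?_
    obtain ⟨x, rfl⟩ := Submodule.Quotient.mk_surjective _ x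
    rw [← Submodule.Quotient.mk_smul, Submodule.Quotient.mk_eq_zero] at hx
    exact (Submodule.Quotient.mk_eq_zero _).2 (hreg _ x hx)
  · intro r hr
    rw [List.mem_append, List.mem_map, List.mem_singleton] at hr
    rcases hr with ⟨r, hr, rfl⟩ | rfl
    · exact h6 r hr
    · exact hgp
  · have hle : ringKrullDim (A ⧸ p.comap (algebraMap A S)) ≤ ringKrullDim (S ⧸ p) := by
      have : Algebra.IsIntegral (A ⧸ p.comap (algebraMap A S)) (S ⧸ p) :=
        Algebra.IsIntegral.tower_top (R := A)
      exact ringKrullDim_le_of_isIntegral Ideal.algebraMap_quotient_injective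
    push_cast
    rw [← add_assoc]
    gcongr
    exact h7.trans (by gcongr)

end Normalization

/-! ### Normalization at a prime: convergent power series -/

section ConvNormalization

open MvPowerSeries

variable {σ τ : Type}

theorem convPDeriv_convX [DecidableEq σ] (i j : σ) :
    convPDeriv i (convX j) = if i = j then 1 else 0 := by
  apply Subtype.ext
  change MvPowerSeries.pderiv ℂ i (MvPowerSeries.X j) = _
  refine MvPowerSeries.ext fun m => ?_
  rw [coeff_pderiv, coeff_X]
  have h1 : (coeff m) ((if i = j then 1 else 0 : Conv σ).1) =
      if m = 0 ∧ i = j then 1 else 0 := by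
    by_cases hij : i = j
    · simp only [hij, if_true, and_true]
      exact coeff_one m
    · simp only [hij, if_false, and_false]
      exact coeff_zero m
  rw [h1]
  by_cases hij : i = j
  · subst hij
    by_cases hm : m = 0
    · simp [hm]
    · rw [if_neg (fun h => hm (by simpa using h)), if_neg (fun h => hm h.1), zero_mul]
  · rw [if_neg fun h => ?_, if_neg fun h => hij h.2, zero_mul]
    have := DFunLike.congr_fun h i
    simp [Ne.symm hij] at this

theorem derivation_sum_apply {S ι : Type} [CommRing S] [Algebra ℂ S] (s : Finset ι)
    (D : ι → Derivation ℂ S S) (f : S) : (∑ i ∈ s, D i) f = ∑ i ∈ s, D i f := by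
  have := congrFun (map_sum (Derivation.coeFnAddMonoidHom (R := ℂ) (A := S) (M := S)) D s) f
  rw [Finset.sum_apply] at this
  exact this

/-- A derivation of the ring of convergent power series is determined by its values on the
coordinates, by Krull's intersection theorem. -/
theorem conv_derivation_ext [Finite σ] {D D' : Derivation ℂ (Conv σ) (Conv σ)}
    (h : ∀ i, D (convX i) = D' (convX i)) : D = D' := by
  cases nonempty_fintype σ
  have key : ∀ N f, (D - D') f ∈ IsLocalRing.maximalIdeal (Conv σ) ^ N := by
    intro N
    induction N with
    | zero => intro f; simp
    | succ N ih =>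
      intro f
      obtain ⟨g, hg, -⟩ := exists_eq_sum_convX_mul (N := 0)
        (f := f - algebraMap ℂ (Conv σ) (coeff 0 f.1)) (fun m hm => by
          rw [zero_add, Nat.lt_one_iff, Finsupp.degree_eq_zero_iff] at hm
          subst hm
          change coeff 0 (f.1 - C (coeff 0 f.1)) = 0
          rw [map_sub, coeff_zero_C, sub_self])
      have h1 : (D - D') f = ∑ i, convX i * (D - D') (g i) := by
        rw [sub_eq_iff_eq_add.1 hg, map_add, Derivation.map_algebraMap, add_zero, map_sum]
        refine Finset.sum_congr rfl fun i _ => ?_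
        rw [Derivation.leibniz, show (D - D') (convX i) = 0 from sub_eq_zero.2 (h i),
          smul_zero, add_zero, smul_eq_mul]
      rw [h1, pow_succ']
      exact Ideal.sum_mem _ fun i _ => Ideal.mul_mem_mul (convX_mem_maximalIdeal i) (ih _)
  rw [← sub_eq_zero]
  ext1 f
  have := Ideal.iInf_pow_eq_bot_of_isLocalRing (IsLocalRing.maximalIdeal (Conv σ))
    (Ideal.IsPrime.ne_top inferInstance)
  rw [Derivation.zero_apply, ← Submodule.mem_bot (Conv σ), ← this, Submodule.mem_iInf]
  exact fun N => key N f

theorem conv_derivation_apply [Fintype σ] (D : Derivation ℂ (Conv σ) (Conv σ)) (f : Conv σ) :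
    D f = ∑ i, D (convX i) * convPDeriv i f := by
  classical
  have : D = ∑ i, D (convX i) • convPDeriv i := by
    refine conv_derivation_ext fun j => ?_
    simp [derivation_sum_apply, convPDeriv_convX]
  conv_lhs => rw [this]
  simp [derivation_sum_apply]

theorem convPDeriv_convRename (e : σ ↪ τ) (i : σ) (f : Conv σ) :
    convPDeriv (e i) (convRename e f) = convRename e (convPDeriv i f) := by
  classical
  apply Subtype.ext
  refine MvPowerSeries.ext fun m => ?_
  change coeff m (MvPowerSeries.pderiv ℂ (e i) (rename e f.1)) =
    coeff m (rename e (MvPowerSeries.pderiv ℂ i f.1))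
  rw [coeff_pderiv]
  by_cases hm : m ∈ Set.range (Finsupp.embDomain e)
  · obtain ⟨m, rfl⟩ := hm
    rw [coeff_embDomain_rename, coeff_pderiv, ← Finsupp.embDomain_single, ← Finsupp.embDomain_add,
      coeff_embDomain_rename, Finsupp.embDomain_apply_self]
  · have h (m) (hm : m ∉ Set.range (Finsupp.embDomain e)) (g : MvPowerSeries σ ℂ) :
        coeff m (rename e g) = 0 := by
      rw [coeff_rename_eq_zero]
      rintro ⟨x, rfl⟩
      exact hm ⟨x, Finsupp.embDomain_eq_mapDomain e x⟩
    rw [h m hm, h, zero_mul]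
    rintro ⟨n, hn⟩
    refine hm ⟨n - Finsupp.single i 1, ?_⟩
    ext j
    by_cases hj : j ∈ Set.range e
    · obtain ⟨j, rfl⟩ := hj
      have := DFunLike.congr_fun hn (e j)
      rw [Finsupp.embDomain_apply_self] at this ⊢
      rw [Finsupp.tsub_apply, this, Finsupp.add_apply]
      simp [Finsupp.single_apply, e.injective.eq_iff]
    · rw [Finsupp.embDomain_of_notMem_range _ _ _ hj]
      have := DFunLike.congr_fun hn j
      rw [Finsupp.embDomain_of_notMem_range _ _ _ hj, Finsupp.add_apply] at this
      omega

theorem convPDeriv_convRename_of_notMem (e : σ ↪ τ) {j : τ} (hj : j ∉ Set.range e) (f : Conv σ) :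
    convPDeriv j (convRename e f) = 0 := by
  apply Subtype.ext
  refine MvPowerSeries.ext fun m => ?_
  change coeff m (MvPowerSeries.pderiv ℂ j (rename e f.1)) = 0
  rw [coeff_pderiv, coeff_rename_eq_zero, zero_mul]
  rintro ⟨x, hx⟩
  have := DFunLike.congr_fun hx j
  rw [Finsupp.mapDomain_of_notMem_range _ _ hj] at this
  simp at this

/-- A series which is regular in the last variable is a nonzerodivisor modulo the ideals generated
by series in the other variables. -/
theorem mem_map_of_regular_mul_mem [Finite σ] {b : ℕ} {g : Conv (σ ⊕ Unit)}
    (hb : coeff (Finsupp.single (Sum.inr ()) b) g.1 ≠ 0)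
    (I : Ideal (Conv σ)) (s : Conv (σ ⊕ Unit))
    (hs : g * s ∈ I.map (convRename (Function.Embedding.inl : σ ↪ σ ⊕ Unit))) :
    s ∈ I.map (convRename (Function.Embedding.inl : σ ↪ σ ⊕ Unit)) := by
  have hE := isExpansion_conv (Equiv.refl (σ ⊕ Unit))
  have hmem := fun s => hE.mem_map_iff I (s := s)
  change ∀ s, s ∈ I.map (convRename (Function.Embedding.inl : σ ↪ σ ⊕ Unit)) ↔ _ at hmem
  rw [hmem] at hs ⊢
  by_cases hI : I = ⊤
  · simp [hI]
  have : Nontrivial (Conv σ ⧸ I) := Ideal.Quotient.nontrivial_iff.2 hI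
  have : IsLocalRing (Conv σ ⧸ I) :=
    IsLocalRing.of_surjective' (Ideal.Quotient.mk I) Ideal.Quotient.mk_surjective
  set G : PowerSeries (Conv σ ⧸ I) :=
    MvPowerSeries.map (Ideal.Quotient.mk I) (convExpand (Equiv.refl (σ ⊕ Unit)) g) with hG
  set Q : PowerSeries (Conv σ ⧸ I) :=
    MvPowerSeries.map (Ideal.Quotient.mk I) (convExpand (Equiv.refl (σ ⊕ Unit)) s) with hQ
  have hGQ : G * Q = 0 := by
    rw [hG, hQ, ← map_mul, ← map_mul]
    refine MvPowerSeries.ext fun α => ?_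
    rw [coeff_map, Ideal.Quotient.eq_zero_iff_mem.2 (hs α), map_zero]
  have hunit : IsUnit (coeff (Finsupp.single () b) (convExpand (Equiv.refl (σ ⊕ Unit)) g)) := by
    rw [isUnit_conv_iff, convConst_apply, coeff_convExpand, expEquiv_single_right]
    exact hb
  have hdiv : G.IsWeierstrassDivisor := by
    refine PowerSeries.IsWeierstrassDivisor.of_map_ne_zero fun h0 => ?_
    have h1 := congrArg (MvPowerSeries.coeff (Finsupp.single () b)) h0
    change IsLocalRing.residue _ (coeff (Finsupp.single () b) G) = 0 at h1
    rw [hG, coeff_map] at h1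
    exact ((hunit.map (Ideal.Quotient.mk I)).map (IsLocalRing.residue _)).ne_zero h1
  have hQ0 := (hdiv.eq_zero_of_mul_eq (q := Q) (r := 0) (by
    rw [Polynomial.degree_zero]
    exact WithBot.bot_lt_coe _) (by rw [hGQ]; simp)).1
  intro α
  rw [← Ideal.Quotient.eq_zero_iff_mem, ← coeff_map, ← hQ, hQ0, map_zero]

/-- Each further variable is a nonzerodivisor whose vanishing locus has the ring in the previous
variables as coordinate ring, so it raises the dimension by at least one. -/
theorem natCard_le_ringKrullDim_conv (σ : Type) [Finite σ] :
    (Nat.card σ : WithBot ℕ∞) ≤ ringKrullDim (Conv σ) := by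
  induction σ using Finite.induction_empty_option with
  | of_equiv e h =>
    rwa [← Nat.card_congr e, ← ringKrullDim_eq_of_ringEquiv (convRenameEquiv e).toRingEquiv]
  | h_empty =>
    rw [Nat.card_of_isEmpty]
    exact ringKrullDim_nonneg_of_nontrivial
  | @h_option α _ h =>
    rw [ringKrullDim_eq_of_ringEquiv (convRenameEquiv (Equiv.optionEquivSumPUnit α)).toRingEquiv,
      Finite.card_option]
    push_cast
    refine le_trans (by gcongr) (ringKrullDim_succ_le_of_surjective
      (isExpansion_conv (Equiv.refl (α ⊕ PUnit))).retraction
      (fun a => ⟨_, (isExpansion_conv (Equiv.refl (α ⊕ PUnit))).retraction_map a⟩)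
      (r := convX (Sum.inr ())) (mem_nonZeroDivisors_of_ne_zero fun h => ?_) ?_)
    · have h1 := congrArg (coeff (Finsupp.single (Sum.inr ()) 1)) (congrArg Subtype.val h)
      change coeff _ (MvPowerSeries.X _) = coeff _ 0 at h1
      rw [coeff_index_single_self_X, coeff_zero] at h1
      exact one_ne_zero h1
    · change constantCoeff (convExpand (Equiv.refl (α ⊕ Unit)) (convX (Sum.inr ()))) = 0
      have h1 := convExpand_convX_inr (Equiv.refl (α ⊕ Unit)) ()
      rw [Equiv.refl_apply] at h1
      rw [h1, constantCoeff_X]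

theorem ringKrullDim_conv_le (σ : Type) [Finite σ] :
    ringKrullDim (Conv σ) ≤ (Nat.card σ : WithBot ℕ∞) := by
  cases nonempty_fintype σ
  rw [← IsLocalRing.maximalIdeal_height_eq_ringKrullDim]
  have h1 := Ideal.height_le_spanFinrank (IsLocalRing.maximalIdeal (Conv σ))
    (Ideal.IsPrime.ne_top inferInstance)
  have h2 : (IsLocalRing.maximalIdeal (Conv σ)).spanFinrank ≤ Nat.card σ := by
    rw [maximalIdeal_conv]
    refine (Submodule.spanFinrank_span_le_ncard_of_finite (Set.finite_range _)).trans ?_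
    rw [← Set.image_univ]
    exact (Set.ncard_image_le Set.finite_univ).trans (by rw [Set.ncard_univ])
  have h3 := h1.trans (Nat.cast_le.2 h2)
  exact_mod_cast h3

/-- At the zero ideal, empty families will do. -/
theorem NormalAt.bot {S : Type} [CommRing S] [Algebra ℂ S] {n : ℕ}
    (h : (n : WithBot ℕ∞) ≤ ringKrullDim S) : NormalAt n (⊥ : Ideal S) :=
  ⟨0, Fin.elim0, Fin.elim0, [], fun i => i.elim0, fun i => i.elim0, fun i => i.elim0, .nil _ _, rfl,
    by simp, by
      rw [ringKrullDim_eq_of_ringEquiv (RingEquiv.quotientBot S)]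
      simpa using h⟩

/-- By induction on the number of variables: a nonzero element of `p` becomes regular in one
variable after a shear, and `NormalAt.step` applies. -/
theorem normalAt_conv (σ : Type) [Finite σ] (p : Ideal (Conv σ)) (hp : p.IsPrime) :
    NormalAt (Nat.card σ) p := by
  induction σ using Finite.induction_empty_option with
  | of_equiv e h =>
    rw [← Nat.card_congr e]
    exact NormalAt.of_equiv (convRenameEquiv e) (h _ (hp.comap _))
  | h_empty =>
    have h := maximalIdeal_conv (σ := PEmpty)
    rw [Set.range_eq_empty, Ideal.span_empty] at h
    have hpb : p = ⊥ := le_bot_iff.1 (h ▸ IsLocalRing.le_maximalIdeal hp.ne_top)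
    rw [hpb]
    exact NormalAt.bot (natCard_le_ringKrullDim_conv _)
  | @h_option α _ h =>
    by_cases hp0 : p = ⊥
    · rw [hp0]
      exact NormalAt.bot (natCard_le_ringKrullDim_conv _)
    rw [Finite.card_option]
    set e := convRenameEquiv (Equiv.optionEquivSumPUnit α) with he
    obtain ⟨f, hf, hf0⟩ := Submodule.exists_mem_ne_zero_of_ne_bot hp0
    obtain ⟨c, hz, b, hlt, hb⟩ := exists_shear_regular (Sum.inr PUnit.unit) (f := e f)
      ((map_ne_zero_iff _ e.injective).2 hf0)
    set θ := e.trans (shearEquiv (Sum.inr PUnit.unit) c hz) with hθ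
    have hp' : (p.comap θ.symm).IsPrime := hp.comap _
    refine NormalAt.of_equiv θ.symm ?_
    let _ := (convRename (Function.Embedding.inl : α ↪ α ⊕ PUnit)).toAlgebra
    have : Module.Flat (Conv α) (Conv (α ⊕ PUnit)) :=
      (isExpansion_conv (Equiv.refl (α ⊕ PUnit))).flat
    refine NormalAt.step (A := Conv α) (z := convX (Sum.inr PUnit.unit)) (g := θ f)
      (convPDeriv (Sum.inr PUnit.unit)) (fun a => ?_) ?_ (fun D => ?_) ?_
      (finite_quotient_of_regular b hlt hb) (mem_map_of_regular_mul_mem hb) (h _ (hp'.comap _))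
    · exact convPDeriv_convRename_of_notMem Function.Embedding.inl (by simp) a
    · classical
      rw [convPDeriv_convX, if_pos rfl]
    · cases nonempty_fintype α
      refine ⟨∑ i, convRename (Function.Embedding.inl : α ↪ α ⊕ PUnit) (D (convX i)) •
        convPDeriv (Sum.inl i), fun a => ?_⟩
      rw [conv_derivation_apply D a, map_sum, derivation_sum_apply]
      refine Finset.sum_congr rfl fun i _ => ?_
      rw [map_mul, Derivation.smul_apply, smul_eq_mul]
      exact congrArg _ (convPDeriv_convRename Function.Embedding.inl i a)
    · rw [Ideal.mem_comap, AlgEquiv.symm_apply_apply]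
      exact hf

end ConvNormalization

/-! ### Normalization at a prime: polynomials -/

section PolyNormalization

open MvPolynomial

variable {σ ι : Type}

theorem coeff_prod_sum_of_natDegree_le {A : Type} [CommRing A] (s : Finset ι)
    (L : ι → Polynomial A) (e : ι → ℕ) (h : ∀ i ∈ s, (L i).natDegree ≤ e i) :
    (∏ i ∈ s, L i).coeff (∑ i ∈ s, e i) = ∏ i ∈ s, (L i).coeff (e i) := by
  classical
  induction s using Finset.induction_on with
  | empty => simp
  | insert i s hi ih =>
    rw [Finset.prod_insert hi, Finset.sum_insert hi, Finset.prod_insert hi,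
      Polynomial.coeff_mul_add_eq_of_natDegree_le (h i (Finset.mem_insert_self i s)),
      ih fun j hj => h j (Finset.mem_insert_of_mem hj)]
    exact (Polynomial.natDegree_prod_le _ _).trans
      (Finset.sum_le_sum fun j hj => h j (Finset.mem_insert_of_mem hj))

/-- The degree and the top coefficient of a polynomial after a substitution of polynomials of degree
at most one, whose linear coefficients are the constants `a i`. -/
theorem natDegree_aeval_le {A : Type} [CommRing A] [Algebra ℂ A] (L : ι → Polynomial A) (a : ι → ℂ)
    (hL : ∀ i, (L i).natDegree ≤ 1) (ha : ∀ i, (L i).coeff 1 = algebraMap ℂ A (a i))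
    (f : MvPolynomial ι ℂ) : (aeval L f).natDegree ≤ f.totalDegree ∧
      (aeval L f).coeff f.totalDegree =
        algebraMap ℂ A (eval a (homogeneousComponent f.totalDegree f)) := by
  have hmon : ∀ m : ι →₀ ℕ, (m.prod fun i e => L i ^ e).natDegree ≤ m.degree ∧
      (m.prod fun i e => L i ^ e).coeff m.degree =
        algebraMap ℂ A (m.prod fun i e => a i ^ e) := by
    intro m
    have h1 : ∀ i ∈ m.support, (L i ^ m i).natDegree ≤ m i := fun i _ =>
      Polynomial.natDegree_pow_le_of_le _ (hL i) |>.trans (by simp)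
    constructor
    · rw [Finsupp.prod, Finsupp.degree_apply]
      exact (Polynomial.natDegree_prod_le _ _).trans (Finset.sum_le_sum h1)
    · rw [Finsupp.prod, Finsupp.degree_apply, Finsupp.prod, map_prod]
      rw [coeff_prod_sum_of_natDegree_le _ _ _ h1]
      refine Finset.prod_congr rfl fun i _ => ?_
      have := Polynomial.coeff_pow_of_natDegree_le (m := m i) (hL i)
      rw [mul_one] at this
      rw [this, ha, map_pow]
  have hf : aeval L f = ∑ m ∈ f.support, Polynomial.C (algebraMap ℂ A (coeff m f)) *
      m.prod fun i e => L i ^ e := by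
    rw [aeval_def, eval₂_eq]
    rfl
  constructor
  · rw [hf]
    refine Polynomial.natDegree_sum_le_of_forall_le _ _ fun m hm => ?_
    refine (Polynomial.natDegree_C_mul_le _ _).trans ((hmon m).1.trans ?_)
    exact le_totalDegree hm
  · rw [hf, Polynomial.finsetSum_coeff, homogeneousComponent_apply, map_sum, map_sum,
      Finset.sum_filter]
    refine Finset.sum_congr rfl fun m hm => ?_
    rw [Polynomial.coeff_C_mul]
    split_ifs with h
    · rw [← h, (hmon m).2, eval_monomial, map_mul]
    · rw [Polynomial.coeff_eq_zero_of_natDegree_lt, mul_zero]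
      exact lt_of_le_of_lt (hmon m).1 (lt_of_le_of_ne (le_totalDegree hm) h)

/-- The linear change of coordinates `xᵢ ↦ xᵢ + cᵢ z`, followed by the identification of polynomials
with polynomials in `z`. -/
def polyShear (c : σ → ℂ) : MvPolynomial (Option σ) ℂ ≃ₐ[ℂ] Polynomial (MvPolynomial σ ℂ) :=
  (AlgEquiv.ofAlgHom
    (aeval fun o => o.elim (X none) fun i => X (some i) + C (c i) * X none)
    (aeval fun o => o.elim (X none) fun i => X (some i) - C (c i) * X none)
    (by ext o; cases o <;> simp) (by ext o; cases o <;> simp)).trans (optionEquivLeft ℂ σ)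

theorem polyShear_apply (c : σ → ℂ) (f : MvPolynomial (Option σ) ℂ) :
    polyShear c f = aeval (fun o => o.elim Polynomial.X fun i =>
      Polynomial.C (X i) + Polynomial.C (C (c i)) * Polynomial.X) f := by
  have : (polyShear c : MvPolynomial (Option σ) ℂ →ₐ[ℂ] Polynomial (MvPolynomial σ ℂ)) =
      aeval (fun o => o.elim Polynomial.X fun i =>
        Polynomial.C (X i) + Polynomial.C (C (c i)) * Polynomial.X) := by
    ext1 o
    cases o <;> simp [polyShear]
  exact DFunLike.congr_fun this f

/-- The Noether normalization trick: a linear change of coordinates makes a nonzero polynomial monic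
in one variable, up to a constant. -/
theorem exists_polyShear_monic {f : MvPolynomial (Option σ) ℂ} (hf : f ≠ 0) :
    ∃ (c : σ → ℂ) (u : ℂ), (u • polyShear c f).Monic := by
  have hF : homogeneousComponent f.totalDegree f ≠ 0 := by
    obtain ⟨m, hm, hmd⟩ := Finset.exists_mem_eq_sup f.support (support_nonempty.2 hf)
      fun m => m.sum fun _ e => e
    intro h0
    have h1 := congrArg (coeff m) h0
    rw [coeff_homogeneousComponent, if_pos (by rw [totalDegree, hmd]; rfl), coeff_zero] at h1
    exact mem_support_iff.1 hm h1
  obtain ⟨x, hx⟩ : ∃ x, eval x (homogeneousComponent f.totalDegree f * X none) ≠ 0 := by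
    by_contra! h
    exact mul_ne_zero hF (X_ne_zero none) (funext fun x => by rw [h x, map_zero])
  rw [map_mul, eval_X] at hx
  have hxz := right_ne_zero_of_mul hx
  set a : Option σ → ℂ := fun o => x o / x none with ha
  have hFa : eval a (homogeneousComponent f.totalDegree f) ≠ 0 := by
    have h1 : eval x (homogeneousComponent f.totalDegree f) = x none ^ f.totalDegree *
        eval a (homogeneousComponent f.totalDegree f) := by
      rw [homogeneousComponent_apply, map_sum, map_sum, Finset.mul_sum]
      refine Finset.sum_congr rfl fun m hm => ?_
      rw [eval_monomial, eval_monomial, ← (Finset.mem_filter.1 hm).2, Finsupp.degree_apply,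
        ← Finset.prod_pow_eq_pow_sum, mul_left_comm, Finsupp.prod, Finsupp.prod,
        ← Finset.prod_mul_distrib]
      refine congrArg _ (Finset.prod_congr rfl fun i _ => ?_)
      rw [← mul_pow, ha, mul_div_cancel₀ _ hxz]
    exact fun h0 => left_ne_zero_of_mul hx (by rw [h1, h0, mul_zero])
  refine ⟨fun i => a (some i), (eval a (homogeneousComponent f.totalDegree f))⁻¹, ?_⟩
  obtain ⟨h1, h2⟩ := natDegree_aeval_le (fun o => o.elim Polynomial.X fun i =>
      Polynomial.C (X i) + Polynomial.C (C (a (some i))) * Polynomial.X) a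
    (fun o => by
      cases o
      · simp
      · simp only [Option.elim_some]
        compute_degree)
    (fun o => by
      cases o
      · simp [ha, hxz]
      · simp [algebraMap_eq, Polynomial.coeff_C]) f
  rw [← polyShear_apply] at h1 h2
  refine Polynomial.monic_of_natDegree_le_of_coeff_eq_one f.totalDegree
    ((Polynomial.natDegree_smul_le _ _).trans h1) ?_
  rw [Polynomial.coeff_smul, h2, ← algebraMap_smul (MvPolynomial σ ℂ), smul_eq_mul, ← map_mul,
    inv_mul_cancel₀ hFa, map_one]

/-- A monic polynomial is a nonzerodivisor modulo the ideals generated by constants. -/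
theorem mem_map_C_of_monic_mul_mem {A : Type} [CommRing A] {g : Polynomial A} (hg : g.Monic)
    (I : Ideal A) (s : Polynomial A) (hs : g * s ∈ I.map (algebraMap A (Polynomial A))) :
    s ∈ I.map (algebraMap A (Polynomial A)) := by
  rw [Polynomial.algebraMap_eq] at hs ⊢
  rw [Ideal.mem_map_C_iff] at hs ⊢
  have h1 : g.map (Ideal.Quotient.mk I) * s.map (Ideal.Quotient.mk I) = 0 := by
    rw [← Polynomial.map_mul]
    ext n
    rw [Polynomial.coeff_map, Ideal.Quotient.eq_zero_iff_mem.2 (hs n), Polynomial.coeff_zero]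
  rw [(hg.map _).mul_right_eq_zero_iff] at h1
  intro n
  rw [← Ideal.Quotient.eq_zero_iff_mem, ← Polynomial.coeff_map, h1, Polynomial.coeff_zero]

/-- By induction on the number of variables: a nonzero element of `p` becomes monic in one
variable, up to a constant, after a shear, and `NormalAt.step` applies. -/
theorem normalAt_poly (σ : Type) [Finite σ] (p : Ideal (MvPolynomial σ ℂ)) (hp : p.IsPrime) :
    NormalAt (Nat.card σ) p := by
  have hbot : ∀ (σ : Type) [Finite σ], (Nat.card σ : WithBot ℕ∞) ≤
      ringKrullDim (MvPolynomial σ ℂ) := by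
    intro σ _
    rw [MvPolynomial.ringKrullDim_of_isNoetherianRing]
    simp
  induction σ using Finite.induction_empty_option with
  | of_equiv e h =>
    rw [← Nat.card_congr e]
    exact NormalAt.of_equiv (renameEquiv ℂ e) (h _ (hp.comap _))
  | h_empty =>
    have hpb : p = ⊥ := by
      refine le_bot_iff.1 fun f hf => ?_
      rw [eq_C_of_isEmpty f] at hf ⊢
      by_contra h
      refine hp.ne_top (Ideal.eq_top_of_isUnit_mem _ hf ?_)
      exact (IsUnit.mk0 _ fun h0 => h (by simp [h0])).map C
    rw [hpb]
    exact NormalAt.bot (hbot _)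
  | @h_option α _ h =>
    by_cases hp0 : p = ⊥
    · rw [hp0]
      exact NormalAt.bot (hbot _)
    rw [Finite.card_option]
    obtain ⟨f, hf, hf0⟩ := Submodule.exists_mem_ne_zero_of_ne_bot hp0
    obtain ⟨c, u, hmonic⟩ := exists_polyShear_monic hf0
    have hp' : (p.comap (polyShear c).symm).IsPrime := hp.comap _
    refine NormalAt.of_equiv (polyShear c).symm ?_
    refine NormalAt.step (A := MvPolynomial α ℂ) (z := Polynomial.X) (g := u • polyShear c f)
      (Polynomial.derivative'.restrictScalars ℂ) (fun a => ?_) ?_ (fun D => ?_) ?_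
      hmonic.finite_quotient (mem_map_C_of_monic_mul_mem hmonic) (h _ (hp'.comap _))
    · exact Polynomial.derivative_C
    · exact Polynomial.derivative_X
    · refine ⟨(PolynomialModule.equivPolynomialSelf.compDer D.mapCoeffs : Derivation ℂ _ _),
        fun a => ?_⟩
      change PolynomialModule.equivPolynomialSelf (D.mapCoeffs (Polynomial.C a)) =
        Polynomial.C (D a)
      rw [Derivation.mapCoeffs_C, PolynomialModule.equivPolynomialSelf_apply_eq,
        PolynomialModule.equivPolynomial_single, Polynomial.monomial_zero_left]
    · rw [Ideal.mem_comap, map_smul, AlgEquiv.symm_apply_apply]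
      exact Submodule.smul_of_tower_mem p u hf

end PolyNormalization

/-! ### Regular sequences and projective dimension -/

section Depth

open CategoryTheory CategoryTheory.Abelian

variable {S : Type} [CommRing S]

theorem ext_smul_eq_zero {L M : ModuleCat.{0} S} {r : S} (hL : ∀ x : L, r • x = 0) {i : ℕ}
    (x : Ext L M i) : r • x = 0 := by
  have h : r • 𝟙 L = 0 := by
    ext y
    exact hL y
  rw [← Ext.mk₀_id_comp x, ← Ext.smul_comp, ← Ext.mk₀_smul, h, Ext.mk₀_zero, Ext.zero_comp]

/-- If a regular sequence on `M` annihilates `L`, the groups `Ext (L, M)` vanish in degrees less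
than its length. -/
theorem ext_eq_zero_of_isWeaklyRegular (L : ModuleCat.{0} S) (rs : List S)
    (hL : ∀ r ∈ rs, ∀ x : L, r • x = 0) (M : Type) [AddCommGroup M] [Module S M]
    (h : RingTheory.Sequence.IsWeaklyRegular M rs) {i : ℕ} (hi : i < rs.length)
    (x : Ext L (ModuleCat.of S M) i) : x = 0 := by
  induction rs generalizing M i with
  | nil => exact absurd hi (Nat.not_lt_zero _)
  | cons r rs ih =>
    obtain ⟨h1, h2⟩ := (RingTheory.Sequence.isWeaklyRegular_cons_iff M r rs).1 h
    have hS := IsSMulRegular.smulShortComplex_shortExact (M := ModuleCat.of S M) h1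
    have h0 : x.comp (Ext.mk₀ (ModuleCat.smulShortComplex (ModuleCat.of S M) r).f) (add_zero i)
        = 0 := by
      have := ext_smul_eq_zero (hL r List.mem_cons_self) x
      rw [Ext.smul_eq_comp_mk₀] at this
      exact this
    cases i with
    | zero =>
      have := hS.mono_f
      exact Ext.postcomp_mk₀_injective_of_mono (hf := this) L _ (h0.trans (map_zero _).symm)
    | succ i =>
      obtain ⟨y, rfl⟩ := Ext.covariant_sequence_exact₁ L hS x h0 rfl
      have hy := ih (fun r hr => hL r (List.mem_cons_of_mem _ hr)) _ h2
        (by simpa using hi) y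
      exact (congrArg (fun y => Ext.comp y hS.extClass rfl) hy).trans (Ext.zero_comp _ _ _ _ _)

theorem isWeaklyRegular_of_flat (P : Type) [AddCommGroup P] [Module S P] [Module.Flat S P]
    {rs : List S} (h : RingTheory.Sequence.IsWeaklyRegular S rs) :
    RingTheory.Sequence.IsWeaklyRegular P rs :=
  ((TensorProduct.lid S P).isWeaklyRegular_congr rs).1 h.isWeaklyRegular_rTensor

/-- The vanishing of `Ext` for modules of small projective dimension, by dimension shifting. -/
theorem ext_eq_zero_of_hasProjectiveDimensionLT (L : ModuleCat.{0} S) {rs : List S}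
    (hL : ∀ r ∈ rs, ∀ x : L, r • x = 0) (h : RingTheory.Sequence.IsWeaklyRegular S rs)
    (j : ℕ) (Q : ModuleCat.{0} S) (hQ : HasProjectiveDimensionLT Q (j + 1)) {i : ℕ}
    (hi : i + j < rs.length) (x : Ext L Q i) : x = 0 := by
  have hproj : ∀ (P : ModuleCat.{0} S) [Projective P] {i : ℕ}, i < rs.length →
      ∀ x : Ext L P i, x = 0 := by
    intro P _ i hi x
    have : Module.Projective S P := (IsProjective.iff_projective P).2 inferInstance
    exact ext_eq_zero_of_isWeaklyRegular L rs hL P (isWeaklyRegular_of_flat P h) hi x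
  induction j generalizing Q i with
  | zero =>
    have : Projective Q := projective_iff_hasProjectiveDimensionLT_one.2 hQ
    exact hproj Q (by omega) x
  | succ j ih =>
    set T := ShortComplex.mk (Limits.kernel.ι (Projective.π Q)) (Projective.π Q)
      (Limits.kernel.condition _) with hT
    have hTe : T.ShortExact :=
      { exact := ShortComplex.exact_of_f_is_kernel _ (Limits.kernelIsKernel _)
        mono_f := inferInstanceAs (Mono (Limits.kernel.ι _))
        epi_g := inferInstanceAs (Epi (Projective.π Q)) }
    have hproj2 : Projective T.X₂ := inferInstanceAs (Projective (Projective.over Q))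
    have h1 : HasProjectiveDimensionLT T.X₁ (j + 1) :=
      hTe.hasProjectiveDimensionLT_X₁ (j + 1) inferInstance hQ
    obtain ⟨y, hy⟩ := Ext.covariant_sequence_exact₃ L hTe x rfl (ih _ h1 (by omega) _)
    rw [← hy, hproj T.X₂ (by omega) y, Ext.zero_comp]

/-- If `M ⊆ F` with `F` projective and the projective dimension of `M` is less than the length of a
regular sequence minus one, then `M` contains every element which the regular sequence moves
into `M`. -/
theorem mem_of_forall_smul_mem {F : Type} [AddCommGroup F] [Module S F] [Module.Projective S F]
    (M : Submodule S F) {rs : List S} (h : RingTheory.Sequence.IsWeaklyRegular S rs) {k : ℕ}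
    (hk : k + 1 ≤ rs.length) (hM : HasProjectiveDimensionLT (ModuleCat.of S M) k) {q : F}
    (hq : ∀ r ∈ rs, r • q ∈ M) : q ∈ M := by
  set T : ShortComplex (ModuleCat.{0} S) := ModuleCat.shortComplexOfCompEqZero M.subtype M.mkQ
    (by ext x; simp) with hT
  have hTe : T.ShortExact :=
    { exact := ModuleCat.shortComplex_exact _ (LinearMap.exact_subtype_mkQ M)
      mono_f := (ModuleCat.mono_iff_injective _).2 M.injective_subtype
      epi_g := (ModuleCat.epi_iff_surjective _).2 M.mkQ_surjective }
  have hF : Projective T.X₂ := (IsProjective.iff_projective F).1 inferInstance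
  have hQ : HasProjectiveDimensionLT T.X₃ (k + 1) :=
    hTe.hasProjectiveDimensionLT_X₃ k hM inferInstance
  set I := Ideal.ofList rs
  have hI : I ≤ LinearMap.ker (LinearMap.toSpanSingleton S (F ⧸ M) (M.mkQ q)) := by
    refine Ideal.span_le.2 fun r hr => ?_
    rw [SetLike.mem_coe, LinearMap.mem_ker, LinearMap.toSpanSingleton_apply, ← map_smul]
    exact (Submodule.Quotient.mk_eq_zero M).2 (hq r hr)
  have h0 := ext_eq_zero_of_hasProjectiveDimensionLT (ModuleCat.of S (S ⧸ I)) (rs := rs)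
    (fun r hr x => by
      obtain ⟨x, rfl⟩ := Ideal.Quotient.mk_surjective x
      change Ideal.Quotient.mk I (r • x) = 0
      rw [Ideal.Quotient.eq_zero_iff_mem]
      exact I.mul_mem_right _ (Ideal.subset_span hr)) h k T.X₃ hQ (i := 0) (by omega)
    (Ext.mk₀ (ModuleCat.ofHom (Submodule.liftQ I _ hI)))
  have h1 : ModuleCat.ofHom (Submodule.liftQ I _ hI) = 0 :=
    (Ext.mk₀_bijective _ _).1 (h0.trans (Ext.mk₀_zero _ _).symm)
  have h2 := congrArg (fun f => f.hom (Submodule.Quotient.mk (1 : S))) h1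
  change LinearMap.toSpanSingleton S (F ⧸ M) (M.mkQ q) 1 = 0 at h2
  rw [LinearMap.toSpanSingleton_apply, one_smul] at h2
  exact (Submodule.Quotient.mk_eq_zero M).1 h2

end Depth

/-! ### Logarithmic multivector fields and the lower bound for their projective dimension -/

section LowerBound

variable {S : Type} [CommRing S]

theorem height_add_ringKrullDim_quotient_le (p : Ideal S) [hp : p.IsPrime] :
    (p.height : WithBot ℕ∞) + ringKrullDim (S ⧸ p) ≤ ringKrullDim S := by
  have h0 : Nonempty (PrimeSpectrum S) := ⟨⟨p, hp⟩⟩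
  have h1 := PrimeSpectrum.height_eq_orderHeight (⟨p, hp⟩ : PrimeSpectrum S)
  have h2 : ringKrullDim (S ⧸ p) = Order.coheight (⟨p, hp⟩ : PrimeSpectrum S) := by
    rw [ringKrullDim_quotient, Order.coheight_eq_krullDim_Ici]
    congr 2
  rw [show p.height = _ from h1, h2, ringKrullDim,
    Order.krullDim_eq_iSup_height_add_coheight_of_nonempty]
  exact_mod_cast le_iSup (fun a : PrimeSpectrum S => Order.height a + Order.coheight a) ⟨p, hp⟩

/-- A minimal prime `p` of a radical ideal `I` is generically equal to `I`: some `u ∉ p` moves it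
into `I`. -/
theorem exists_notMem_mul_mem [IsNoetherianRing S] {I : Ideal S} (hI : I.IsRadical) {p : Ideal S}
    (hp : p ∈ I.minimalPrimes) : ∃ u ∉ p, ∀ a ∈ p, u * a ∈ I := by
  classical
  have hfin := I.finite_minimalPrimes_of_isNoetherianRing S
  have hpr : p.IsPrime := hp.1.1
  have h1 : ¬ (hfin.toFinset.erase p).inf id ≤ p := by
    intro h
    obtain ⟨q, hq, hqp⟩ := (hpr.inf_le').1 h
    rw [Finset.mem_erase, Set.Finite.mem_toFinset] at hq
    exact hq.1 (le_antisymm hqp (hp.2 hq.2.1 hqp))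
  obtain ⟨u, hu, hup⟩ := Set.not_subset.1 h1
  refine ⟨u, hup, fun a ha => ?_⟩
  rw [← hI.radical, ← I.sInf_minimalPrimes, Submodule.mem_sInf]
  intro q hq
  by_cases hqp : q = p
  · exact hqp ▸ p.mul_mem_left u ha
  · have h2 : (hfin.toFinset.erase p).inf id ≤ q :=
      Finset.inf_le (f := id) (Finset.mem_erase.2 ⟨hqp, hfin.mem_toFinset.2 hq⟩)
    exact Ideal.mul_mem_right _ _ (h2 hu)

/-- The determinant of derivatives does not lie in `p`, by triangularity. -/
theorem det_notMem_of_triangular {p : Ideal S} [p.IsPrime] {k : ℕ} (A : Matrix (Fin k) (Fin k) S)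
    (h : ∀ i j, j < i → A i j ∈ p) (hd : ∀ i, A i i ∉ p) : A.det ∉ p := by
  rw [← Ideal.Quotient.eq_zero_iff_mem, RingHom.map_det, Matrix.det_of_isUpperTriangular]
  · rw [Finset.prod_eq_zero_iff]
    rintro ⟨i, -, hi⟩
    exact hd i (Ideal.Quotient.eq_zero_iff_mem.1 hi)
  · intro i j hij
    exact Ideal.Quotient.eq_zero_iff_mem.2 (h i j hij)

variable [Algebra ℂ S] {σ : Type} [Fintype σ]

theorem differential_apply (d : σ → Derivation ℂ S S) (f : S) (v : σ → S) :
    differential d f v = ∑ i, d i f * v i := by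
  simp [differential, LinearMap.sum_apply]

theorem pairing_ιMulti (d : σ → Derivation ℂ S S) {k : ℕ} (v : Fin k → σ → S) (f : Fin k → S) :
    pairing d (exteriorPower.ιMulti S k v) f =
      (Matrix.of fun a b => ∑ i, d i (f b) * v a i).det := by
  rw [pairing, exteriorPower.pairingDual_ιMulti_ιMulti]
  congr 1
  ext a b
  simp only [Matrix.of_apply, differential_apply]

/-- The module of logarithmic `(k + 1)`-vector fields of a reduced subspace of codimension `k + 1`
has projective dimension at least `k`. At a component `p`, the multivector `D₁ ∧ ⋯ ∧ D_{k + 1}` of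
normal fields, multiplied by a function `u` cutting out the other components, is not logarithmic
but becomes so after multiplication by any element of `p`. -/
theorem not_hasProjectiveDimensionLT_logModule [IsNoetherianRing S] {d : σ → Derivation ℂ S S}
    (x : σ → S) (hx : ∀ (D : Derivation ℂ S S) (f : S), D f = ∑ i, D (x i) * d i f) {n : ℕ}
    (hdim : ringKrullDim S ≤ n) {I : Ideal S} (hI : I.IsRadical) {p : Ideal S}
    (hp : p ∈ I.minimalPrimes) {k : ℕ} (hk : p.height = (k + 1 : ℕ)) (hn : NormalAt n p) :
    ¬ CategoryTheory.HasProjectiveDimensionLT (ModuleCat.of S (logModule d I (k + 1))) k := by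
  intro hpd
  obtain ⟨m, D, f, rs, h1, h2, h3, h4, h5, h6, h7⟩ := hn
  have hpr : p.IsPrime := hp.1.1
  have hkm : k + 1 ≤ m := by
    have h8 := (height_add_ringKrullDim_quotient_le p).trans (hdim.trans h7)
    have h9 : ringKrullDim (S ⧸ p) ≤ n := (ringKrullDim_quotient_le p).trans hdim
    have h10 : 0 ≤ ringKrullDim (S ⧸ p) := ringKrullDim_nonneg_of_nontrivial
    rw [hk] at h8
    obtain ⟨e, he⟩ : ∃ e : ℕ, ringKrullDim (S ⧸ p) = e := by
      obtain ⟨e, he⟩ := WithBot.ne_bot_iff_exists.1 (ne_of_gt (lt_of_lt_of_le (WithBot.bot_lt_coe 0)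
        h10))
      rw [← he] at h9 ⊢
      have h9' : e ≤ n := by exact_mod_cast h9
      obtain ⟨e', rfl⟩ := ENat.ne_top_iff_exists.1 (ne_top_of_le_ne_top (ENat.natCast_ne_top n) h9')
      exact ⟨e', rfl⟩
    rw [he] at h8
    have h11 : k + 1 + e ≤ e + m := by exact_mod_cast h8
    omega
  obtain ⟨u, hup, hu⟩ := exists_notMem_mul_mem hI hp
  set v : Fin (k + 1) → σ → S := fun a i => D (Fin.castLE hkm a) (x i) with hv
  have hdet : ∀ g : Fin (k + 1) → S, pairing d (exteriorPower.ιMulti S (k + 1) v) g =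
      (Matrix.of fun a b => D (Fin.castLE hkm a) (g b)).det := by
    intro g
    rw [pairing_ιMulti]
    congr 1
    ext a b
    rw [Matrix.of_apply, Matrix.of_apply, hx]
    exact Finset.sum_congr rfl fun i _ => mul_comm _ _
  have hmem : u • exteriorPower.ιMulti S (k + 1) v ∈ logModule d I (k + 1) := by
    refine mem_of_forall_smul_mem _ h4 (by omega) hpd fun r hr g hg => ?_
    have : pairing d (r • u • exteriorPower.ιMulti S (k + 1) v) g =
        r * (u * pairing d (exteriorPower.ιMulti S (k + 1) v) g) := by
      simp only [pairing, map_smul, smul_eq_mul]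
    rw [this, mul_left_comm, ← mul_assoc]
    exact I.mul_mem_right _ (hu r (h6 r hr))
  have h8 := hmem (fun b => u * f (Fin.castLE hkm b)) fun b => hu _ (h1 _)
  have h9 : pairing d (u • exteriorPower.ιMulti S (k + 1) v)
      (fun b => u * f (Fin.castLE hkm b)) ∈ p := hp.1.2 h8
  have h10 : pairing d (u • exteriorPower.ιMulti S (k + 1) v)
      (fun b => u * f (Fin.castLE hkm b)) =
      u * pairing d (exteriorPower.ιMulti S (k + 1) v) (fun b => u * f (Fin.castLE hkm b)) := by
    simp only [pairing, map_smul, smul_eq_mul]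
  rw [h10, hdet] at h9
  refine det_notMem_of_triangular _ (fun i j hij => ?_) (fun i => ?_)
    ((hpr.mem_or_mem h9).resolve_left hup)
  · rw [Matrix.of_apply, Derivation.leibniz, smul_eq_mul, smul_eq_mul]
    exact p.add_mem (p.mul_mem_left _ (h2 _ _ hij)) (p.mul_mem_right _ (h1 _))
  · rw [Matrix.of_apply, Derivation.leibniz, smul_eq_mul, smul_eq_mul,
      p.add_mem_iff_left (p.mul_mem_right _ (h1 _))]
    exact fun h => (hpr.mem_or_mem h).elim hup (h3 _)

end LowerBound

/-! ### Coordinate projections on multivector fields -/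

section CoordProj

variable {S : Type} [CommRing S] {ρ : Type}

open Classical in
/-- The projection of vector fields which keeps the components with index in `s`. -/
def coordProj (S : Type) [CommRing S] (s : Set ρ) : (ρ → S) →ₗ[S] (ρ → S) where
  toFun v r := if r ∈ s then v r else 0
  map_add' v w := by ext r; by_cases h : r ∈ s <;> simp [h]
  map_smul' c v := by ext r; by_cases h : r ∈ s <;> simp [h]

variable [DecidableEq ρ]

theorem coordProj_single_of_mem {s : Set ρ} {r : ρ} (h : r ∈ s) (a : S) :
    coordProj S s (Pi.single r a) = Pi.single r a := by
  ext r'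
  by_cases hr : r' = r
  · subst hr; simp [coordProj, h]
  · simp [coordProj, hr]

theorem coordProj_single_of_notMem {s : Set ρ} {r : ρ} (h : r ∉ s) (a : S) :
    coordProj S s (Pi.single r a) = 0 := by
  ext r'
  by_cases hr : r' = r
  · subst hr; simp [coordProj, h]
  · simp [coordProj, hr]

/-- The wedge product of the coordinate fields with indices `g 0, g 1, …`. -/
def coordWedge (S : Type) [CommRing S] {k : ℕ} (g : Fin k → ρ) : ⋀[S]^k (ρ → S) :=
  exteriorPower.ιMulti S k fun a => Pi.single (g a) (1 : S)

theorem span_range_coordWedge [Finite ρ] (k : ℕ) :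
    Submodule.span S (Set.range (coordWedge S : (Fin k → ρ) → ⋀[S]^k (ρ → S))) = ⊤ := by
  have h : Submodule.span S (Set.range fun r : ρ => (Pi.single r 1 : ρ → S)) = ⊤ := by
    have := (Pi.basisFun S ρ).span_eq
    rwa [show (⇑(Pi.basisFun S ρ) : ρ → ρ → S) = fun r => Pi.single r 1 from
      funext fun r => Pi.basisFun_apply S ρ r] at this
  rw [eq_top_iff, ← exteriorPower.ιMulti_span_of_span S k _ h]
  refine Submodule.span_mono ?_
  rintro _ ⟨v, hv, rfl⟩
  choose g hg using fun a => hv ⟨a, rfl⟩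
  exact ⟨g, congrArg _ (funext hg)⟩

theorem map_coordProj_coordWedge_of_mem {s : Set ρ} {k : ℕ} {g : Fin k → ρ} (h : ∀ a, g a ∈ s) :
    exteriorPower.map k (coordProj S s) (coordWedge S g) = coordWedge S g := by
  rw [coordWedge, exteriorPower.map_apply_ιMulti]
  exact congrArg _ (funext fun a => coordProj_single_of_mem (h a) 1)

theorem map_coordProj_coordWedge_of_notMem {s : Set ρ} {k : ℕ} {g : Fin k → ρ} {a : Fin k}
    (h : g a ∉ s) : exteriorPower.map k (coordProj S s) (coordWedge S g) = 0 := by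
  rw [coordWedge, exteriorPower.map_apply_ιMulti]
  exact AlternatingMap.map_coord_zero _ a (coordProj_single_of_notMem h 1)

end CoordProj

/-! ### Logarithmic multivector fields on a product -/

theorem det_mem_of_row_mem {S : Type} [CommRing S] {k : ℕ} {J : Ideal S}
    (A : Matrix (Fin k) (Fin k) S) (a : Fin k) (h : ∀ b, A a b ∈ J) : A.det ∈ J := by
  rw [Matrix.det_apply]
  refine J.sum_mem fun τ _ => ?_
  rw [Units.smul_def, zsmul_eq_mul]
  refine J.mul_mem_left _ ?_
  rw [← Finset.mul_prod_erase _ _ (Finset.mem_univ (τ.symm a)), Equiv.apply_symm_apply]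
  exact J.mul_mem_right _ (h _)

section General

variable {S : Type} [CommRing S] [Algebra ℂ S] {ρ : Type} [Fintype ρ]
  {d : ρ → Derivation ℂ S S}

theorem pairing_add {k : ℕ} (δ ε : ⋀[S]^k (ρ → S)) (f : Fin k → S) :
    pairing d (δ + ε) f = pairing d δ f + pairing d ε f := map_add _ _ _

theorem pairing_smul {k : ℕ} (s : S) (δ : ⋀[S]^k (ρ → S)) (f : Fin k → S) :
    pairing d (s • δ) f = s * pairing d δ f := map_smul _ _ _

theorem pairing_sum {k : ℕ} {ι : Type} (A : Finset ι) (δ : ι → ⋀[S]^k (ρ → S)) (f : Fin k → S) :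
    pairing d (∑ i ∈ A, δ i) f = ∑ i ∈ A, pairing d (δ i) f := map_sum _ _ _

/-- If one factor of a decomposable multivector field is logarithmic along `J`, then so is the
multivector field. -/
theorem ιMulti_mem_logModule {k : ℕ} {J : Ideal S} (v : Fin k → ρ → S) (a : Fin k)
    (h : ∀ f ∈ J, ∑ r, d r f * v a r ∈ J) : exteriorPower.ιMulti S k v ∈ logModule d J k := by
  intro f hf
  rw [pairing_ιMulti]
  exact det_mem_of_row_mem _ a fun b => h _ (hf b)

theorem coordWedge_mem_logModule [DecidableEq ρ] {k : ℕ} {J : Ideal S} {g : Fin k → ρ} {a : Fin k}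
    (h : ∀ f ∈ J, d (g a) f ∈ J) : coordWedge S g ∈ logModule d J k := by
  refine ιMulti_mem_logModule _ a fun f hf => ?_
  rw [Finset.sum_eq_single (g a) (fun r _ hr => by rw [Pi.single_eq_of_ne hr, mul_zero])
    (fun hr => absurd (Finset.mem_univ _) hr), Pi.single_eq_same, mul_one]
  exact h f hf

theorem logModule_inf_le (d : ρ → Derivation ℂ S S) (J₁ J₂ : Ideal S) (k : ℕ) :
    logModule d J₁ k ⊓ logModule d J₂ k ≤ logModule d (J₁ ⊓ J₂) k :=
  fun _ hδ f hf => ⟨hδ.1 f fun j => (hf j).1, hδ.2 f fun j => (hf j).2⟩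

theorem differential_smul (s f : S) :
    differential d (s * f) = s • differential d f + f • differential d s := by
  ext v
  simp only [differential_apply, LinearMap.add_apply, LinearMap.smul_apply, smul_eq_mul,
    Derivation.leibniz, Finset.mul_sum, ← Finset.sum_add_distrib]
  exact Finset.sum_congr rfl fun _ _ => by ring

theorem differential_add (f g : S) :
    differential d (f + g) = differential d f + differential d g := by
  ext v
  simp only [differential_apply, LinearMap.add_apply, map_add, ← Finset.sum_add_distrib]
  exact Finset.sum_congr rfl fun _ _ => by ring

/-- Logarithmicity along the ideal generated by `G` can be tested on `G`. -/
theorem mem_logModule_of_span {k : ℕ} {G : Set S} {δ : ⋀[S]^k (ρ → S)}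
    (h : ∀ f : Fin k → S, (∀ j, f j ∈ G) → pairing d δ f ∈ Ideal.span G) :
    δ ∈ logModule d (Ideal.span G) k := by
  classical
  -- The entries with index in `A` are arbitrary elements of the ideal, the others generators.
  suffices H : ∀ A : Finset (Fin k), ∀ f : Fin k → S, (∀ j ∈ A, f j ∈ Ideal.span G) →
      (∀ j ∉ A, f j ∈ G) → pairing d δ f ∈ Ideal.span G from
    fun f hf => H Finset.univ f (fun j _ => hf j) fun j hj => absurd (Finset.mem_univ j) hj
  intro A
  induction A using Finset.induction_on with
  | empty => exact fun f _ hf => h f fun j => hf j (Finset.notMem_empty j)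
  | insert a A ha ih =>
    intro f hf hf'
    have key : ∀ y ∈ Ideal.span G, pairing d δ (Function.update f a y) ∈ Ideal.span G := by
      have hcomp : ∀ y, (fun j => differential d (Function.update f a y j)) =
          Function.update (fun j => differential d (f j)) a (differential d y) := by
        intro y
        ext1 j
        by_cases hj : j = a
        · subst hj; simp
        · simp [hj]
      intro y hy
      induction hy using Submodule.span_induction with
      | mem y hy =>
        refine ih _ (fun j hj => ?_) fun j hj => ?_
        · rw [Function.update_of_ne (ne_of_mem_of_not_mem hj ha)]
          exact hf j (Finset.mem_insert_of_mem hj)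
        · by_cases hja : j = a
          · subst hja; rwa [Function.update_self]
          · rw [Function.update_of_ne hja]
            exact hf' j fun h => (Finset.mem_insert.1 h).elim hja hj
      | zero =>
        have h0 : differential d (0 : S) = 0 := by
          ext v; simp [differential_apply]
        rw [pairing, hcomp, h0, AlternatingMap.map_update_zero, map_zero, LinearMap.zero_apply]
        exact Submodule.zero_mem _
      | add y z _ _ hy hz =>
        rw [pairing, hcomp, differential_add, AlternatingMap.map_update_add, map_add,
          LinearMap.add_apply, ← hcomp, ← hcomp]
        exact Submodule.add_mem _ hy hz
      | smul s y hy' hy =>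
        rw [pairing, smul_eq_mul, hcomp, differential_smul, AlternatingMap.map_update_add,
          AlternatingMap.map_update_smul, AlternatingMap.map_update_smul, map_add,
          LinearMap.add_apply, map_smul, map_smul, LinearMap.smul_apply, LinearMap.smul_apply,
          ← hcomp, ← hcomp]
        exact Submodule.add_mem _ (Ideal.mul_mem_left _ _ hy) (Ideal.mul_mem_right _ _ hy')
    have := key (f a) (hf a (Finset.mem_insert_self _ _))
    rwa [Function.update_eq_self] at this

theorem derivation_mem_map {R : Type} [CommRing R] {φ : R →+* S} (D : Derivation ℂ S S)
    (hD : ∀ r, D (φ r) = 0) {I : Ideal R} {f : S} (hf : f ∈ I.map φ) : D f ∈ I.map φ := by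
  induction hf using Submodule.span_induction with
  | mem y hy =>
    obtain ⟨r, -, rfl⟩ := hy
    rw [hD]
    exact Submodule.zero_mem _
  | zero => rw [map_zero]; exact Submodule.zero_mem _
  | add y z _ _ hy hz => rw [map_add]; exact Submodule.add_mem _ hy hz
  | smul s y hy' hy =>
    rw [smul_eq_mul, Derivation.leibniz]
    exact Submodule.add_mem _ (Submodule.smul_mem _ _ hy) (Ideal.mul_mem_right _ _ hy')

end General

section Wedge

variable {R S σ ρ : Type} [CommRing R] [CommRing S] [Fintype σ] [DecidableEq σ] [DecidableEq ρ]
  {e₁ : σ → ρ} {φ : R →+* S}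

theorem extendField_apply_single (i : σ) :
    extendField φ e₁ (Pi.single i (1 : R)) = Pi.single (e₁ i) (1 : S) := by
  change ∑ j, _ = _
  rw [Finset.sum_eq_single i (fun j _ hj => by rw [Pi.single_eq_of_ne hj, map_zero, zero_smul])
    (fun hr => absurd (Finset.mem_univ _) hr), Pi.single_eq_same, map_one, one_smul]

theorem wedgeMap_coordWedge {k : ℕ} (g : Fin k → σ) :
    wedgeMap φ (extendField φ e₁) k (coordWedge R g) = coordWedge S (e₁ ∘ g) := by
  rw [coordWedge, wedgeMap_ιMulti]
  exact congrArg _ (funext fun a => extendField_apply_single (g a))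

end Wedge

/-- Every multivector field in the directions `e₁` is a combination of coordinate ones. -/
theorem exists_eq_sum_coordWedge {σ ρ : Type} [Fintype σ] [Finite ρ] [DecidableEq ρ] (S : Type)
    [CommRing S] (e₁ : σ → ρ) {k : ℕ} (δ : ⋀[S]^k (ρ → S)) : ∃ s : (Fin k → σ) → S,
      exteriorPower.map k (coordProj S (Set.range e₁)) δ = ∑ g, s g • coordWedge S (e₁ ∘ g) := by
  suffices H : exteriorPower.map k (coordProj S (Set.range e₁)) δ ∈
      Submodule.span S (Set.range fun g : Fin k → σ => coordWedge S (e₁ ∘ g)) by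
    obtain ⟨s, hs⟩ := (Submodule.mem_span_range_iff_exists_fun S).1 H
    exact ⟨s, hs.symm⟩
  have hδ : δ ∈ Submodule.span S (Set.range (coordWedge S : (Fin k → ρ) → ⋀[S]^k (ρ → S))) := by
    rw [span_range_coordWedge]; trivial
  induction hδ using Submodule.span_induction with
  | mem y hy =>
    obtain ⟨g, rfl⟩ := hy
    by_cases hg : ∀ a, g a ∈ Set.range e₁
    · rw [map_coordProj_coordWedge_of_mem hg]
      choose g' hg' using hg
      exact Submodule.subset_span ⟨g', congrArg _ (funext hg')⟩
    · push Not at hg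
      obtain ⟨a, ha⟩ := hg
      rw [map_coordProj_coordWedge_of_notMem ha]
      exact Submodule.zero_mem _
  | zero => rw [map_zero]; exact Submodule.zero_mem _
  | add y z _ _ hy hz => rw [map_add]; exact Submodule.add_mem _ hy hz
  | smul s y _ hy => rw [map_smul]; exact Submodule.smul_mem _ _ hy

/-- The coordinate ring `S` with coordinates `ρ`, decomposed into the coordinates `e₁ : σ → ρ`
with coordinate ring `R` and the coordinates `e₂ : τ → ρ` with coordinate ring `T`. -/
structure IsProduct {R S T σ τ ρ : Type} [CommRing R] [CommRing S] [CommRing T] [Algebra ℂ R]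
    [Algebra ℂ S] (dR : σ → Derivation ℂ R R) (dS : ρ → Derivation ℂ S S) (e₁ : σ → ρ)
    (e₂ : τ → ρ) (φ : R →+* S) (ψ : T →+* S) (c : S →+* MvPowerSeries τ R) : Prop
    extends IsExpansion φ ψ c where
  deriv_left : ∀ i r, dS (e₁ i) (φ r) = φ (dR i r)
  deriv_inr_left : ∀ j r, dS (e₂ j) (φ r) = 0
  deriv_inl_right : ∀ i t, dS (e₁ i) (ψ t) = 0
  injective_right : Function.Injective ψ
  injective_inl : Function.Injective e₁
  mem_range_iff : ∀ r, r ∈ Set.range e₁ ↔ r ∉ Set.range e₂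

/-- A nonzero function of the new variables is a nonzerodivisor modulo the extension of a radical
ideal: modulo each prime `q ⊇ I` its expansion stays nonzero, having constant coefficients. -/
theorem IsExpansion.mem_of_mul_mem {R S T τ : Type} [CommRing R] [CommRing S] [CommRing T]
    [Algebra ℂ R] {φ : R →+* S} {ψ : T →+* S} {c : S →+* MvPowerSeries τ R}
    (h : IsExpansion φ ψ c) {I : Ideal R} (hI : I.IsRadical) {t : T} (ht : ψ t ≠ 0) {s : S}
    (hs : ψ t * s ∈ I.map φ) : s ∈ I.map φ := by
  rw [h.mem_map_iff] at hs ⊢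
  intro α
  rw [← hI.radical, Ideal.radical_eq_sInf, Submodule.mem_sInf]
  rintro q ⟨hIq, hq⟩
  have : IsDomain (MvPowerSeries τ (R ⧸ q)) := NoZeroDivisors.to_isDomain _
  set M : MvPowerSeries τ R →+* MvPowerSeries τ (R ⧸ q) :=
    MvPowerSeries.map (Ideal.Quotient.mk q) with hM
  have h1 : M (c (ψ t)) * M (c s) = 0 := by
    rw [← map_mul, ← map_mul]
    refine MvPowerSeries.ext fun β => ?_
    rw [hM, MvPowerSeries.coeff_map, map_zero]
    exact Ideal.Quotient.eq_zero_iff_mem.2 (hIq (hs β))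
  have h2 : M (c (ψ t)) ≠ 0 := by
    intro h0
    refine ht (h.injective ?_)
    rw [map_zero]
    refine MvPowerSeries.ext fun β => ?_
    obtain ⟨a, ha⟩ := h.map_right t β
    have h3 : Ideal.Quotient.mk q (algebraMap ℂ R a) = 0 := by
      rw [← ha, ← MvPowerSeries.coeff_map, ← hM, h0, map_zero]
    have h4 : a = 0 := by
      by_contra h4
      refine hq.ne_top (Ideal.eq_top_of_isUnit_mem _ (Ideal.Quotient.eq_zero_iff_mem.1 h3) ?_)
      exact (IsUnit.mk0 a h4).map (algebraMap ℂ R)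
    rw [ha, h4, map_zero, map_zero]
  have h5 := congrArg (MvPowerSeries.coeff α) ((mul_eq_zero.1 h1).resolve_left h2)
  rw [hM, MvPowerSeries.coeff_map, map_zero] at h5
  exact Ideal.Quotient.eq_zero_iff_mem.1 h5

/-- The part of a multivector field which involves some direction `e₂` is logarithmic along the
cylinder over a subspace of the first factor, because the derivations `dS (e₂ j)` preserve the
extension of `I₁`. -/
theorem IsProduct.sub_map_coordProj_mem {R S T σ τ ρ : Type} [CommRing R] [CommRing S] [CommRing T]
    [Algebra ℂ R] [Algebra ℂ S] [Fintype ρ] [DecidableEq ρ] {dR : σ → Derivation ℂ R R}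
    {dS : ρ → Derivation ℂ S S} {e₁ : σ → ρ} {e₂ : τ → ρ} {φ : R →+* S} {ψ : T →+* S}
    {c : S →+* MvPowerSeries τ R} (h : IsProduct dR dS e₁ e₂ φ ψ c) {k : ℕ} (I₁ : Ideal R)
    (δ : ⋀[S]^k (ρ → S)) :
    δ - exteriorPower.map k (coordProj S (Set.range e₁)) δ ∈ logModule dS (I₁.map φ) k := by
  have hδ : δ ∈ Submodule.span S (Set.range (coordWedge S : (Fin k → ρ) → ⋀[S]^k (ρ → S))) := by
    rw [span_range_coordWedge]; trivial
  induction hδ using Submodule.span_induction with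
  | mem y hy =>
    obtain ⟨g, rfl⟩ := hy
    by_cases hg : ∀ a, g a ∈ Set.range e₁
    · rw [map_coordProj_coordWedge_of_mem hg, sub_self]
      exact Submodule.zero_mem _
    · push Not at hg
      obtain ⟨a, ha⟩ := hg
      rw [map_coordProj_coordWedge_of_notMem ha, sub_zero]
      rw [h.mem_range_iff, not_not] at ha
      obtain ⟨j, hj⟩ := ha
      exact coordWedge_mem_logModule (a := a) fun f hf =>
        derivation_mem_map _ (hj ▸ h.deriv_inr_left j) hf
  | zero => rw [map_zero, sub_self]; exact Submodule.zero_mem _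
  | add y z _ _ hy hz => rw [map_add, add_sub_add_comm]; exact Submodule.add_mem _ hy hz
  | smul s y _ hy => rw [map_smul, ← smul_sub]; exact Submodule.smul_mem _ _ hy

section Product

variable {R S T σ τ ρ : Type} [CommRing R] [CommRing S] [CommRing T] [Algebra ℂ R]
  [Algebra ℂ S] [Fintype σ] [Fintype ρ] [DecidableEq σ] [DecidableEq ρ]
  {dR : σ → Derivation ℂ R R} {dS : ρ → Derivation ℂ S S} {e₁ : σ → ρ} {e₂ : τ → ρ}
  {φ : R →+* S} {ψ : T →+* S} {c : S →+* MvPowerSeries τ R}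

theorem IsProduct.pairing_coordWedge (h : IsProduct dR dS e₁ e₂ φ ψ c) {k : ℕ} (g : Fin k → σ)
    (u : T) (f : Fin k → R) : pairing dS (coordWedge S (e₁ ∘ g)) (fun b => ψ u * φ (f b)) =
      ψ u ^ k * φ (pairing dR (coordWedge R g) f) := by
  have h0 : ∀ A : Matrix (Fin k) (Fin k) S, ψ u ^ k * A.det = (ψ u • A).det := by
    intro A
    rw [Matrix.det_smul, Fintype.card_fin]
  rw [coordWedge, coordWedge, pairing_ιMulti, pairing_ιMulti, RingHom.map_det, h0]
  congr 1
  ext a b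
  have h1 : ∀ (r : ρ) (x : ρ → S), ∑ i, x i * (Pi.single r (1 : S) : ρ → S) i = x r := by
    intro r x
    simp [Pi.single_apply]
  have h2 : ∀ (r : σ) (x : σ → R), ∑ i, x i * (Pi.single r (1 : R) : σ → R) i = x r := by
    intro r x
    simp [Pi.single_apply]
  rw [Matrix.of_apply, h1, Matrix.smul_apply, RingHom.mapMatrix_apply, Matrix.map_apply,
    Matrix.of_apply, h2, Derivation.leibniz, Function.comp_apply, h.deriv_left,
    h.deriv_inl_right, smul_zero, add_zero]

theorem IsProduct.pairing_sum_coordWedge (h : IsProduct dR dS e₁ e₂ φ ψ c) {k : ℕ}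
    (s : (Fin k → σ) → S) (u : T) (f : Fin k → R) :
    pairing dS (∑ g, s g • coordWedge S (e₁ ∘ g)) (fun b => ψ u * φ (f b)) =
      ψ u ^ k * ∑ g, s g * φ (pairing dR (coordWedge R g) f) := by
  rw [pairing_sum, Finset.mul_sum]
  refine Finset.sum_congr rfl fun g _ => ?_
  rw [pairing_smul, h.pairing_coordWedge, mul_left_comm]

theorem IsProduct.pairing_wedgeMap (h : IsProduct dR dS e₁ e₂ φ ψ c) {k : ℕ}
    (δ : ⋀[R]^k (σ → R)) (f : Fin k → R) :
    pairing dS (wedgeMap φ (extendField φ e₁) k δ) (fun b => φ (f b)) = φ (pairing dR δ f) := by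
  have hδ : δ ∈ Submodule.span R (Set.range (coordWedge R : (Fin k → σ) → ⋀[R]^k (σ → R))) := by
    rw [span_range_coordWedge]; trivial
  induction hδ using Submodule.span_induction with
  | mem y hy =>
    obtain ⟨g, rfl⟩ := hy
    have := h.pairing_coordWedge g 1 f
    simpa only [map_one, one_mul, one_pow, wedgeMap_coordWedge] using this
  | zero => simp [pairing]
  | add y z _ _ hy hz => rw [map_add, pairing_add, pairing_add, map_add, hy, hz]
  | smul s y _ hy => rw [map_smulₛₗ, pairing_smul, pairing_smul, map_mul, hy]

/-- Logarithmic multivector fields of the first factor are logarithmic along the second cylinder for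
lack of derivatives in its directions; this needs `k ≠ 0`. -/
theorem IsProduct.extendSubmodule_logModule_le (h : IsProduct dR dS e₁ e₂ φ ψ c) {k : ℕ}
    (hk : k ≠ 0) (I₁ : Ideal R) (I₂ : Ideal T) :
    extendSubmodule φ e₁ k (logModule dR I₁ k) ≤
      logModule dS (I₁.map φ ⊓ I₂.map ψ) k := by
  refine le_trans (Submodule.span_le.2 ?_) (logModule_inf_le dS _ _ k)
  rintro _ ⟨δ, hδ, rfl⟩
  refine ⟨mem_logModule_of_span ?_, ?_⟩
  · intro f hf
    choose r hr hrf using hf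
    obtain rfl : (fun b => φ (r b)) = f := funext hrf
    rw [h.pairing_wedgeMap]
    exact Ideal.mem_map_of_mem φ (hδ r hr)
  · clear hδ
    have hδ : δ ∈ Submodule.span R (Set.range (coordWedge R : (Fin k → σ) → ⋀[R]^k (σ → R))) := by
      rw [span_range_coordWedge]; trivial
    change _ ∈ logModule dS (I₂.map ψ) k
    induction hδ using Submodule.span_induction with
    | mem y hy =>
      obtain ⟨g, rfl⟩ := hy
      rw [wedgeMap_coordWedge]
      exact coordWedge_mem_logModule (a := ⟨0, Nat.pos_of_ne_zero hk⟩) fun f hf =>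
        derivation_mem_map _ (h.deriv_inl_right _) hf
    | zero => rw [map_zero]; exact Submodule.zero_mem _
    | add y z _ _ hy hz => rw [map_add]; exact Submodule.add_mem _ hy hz
    | smul s y _ hy => rw [map_smulₛₗ]; exact Submodule.smul_mem _ _ hy

/-- The component in the directions `e₁` of a multivector field which is logarithmic along the
union is a combination of extensions of logarithmic multivector fields: testing on products
`u h₁, …, u h_k`, where `u` is a fixed function of the other variables, bounds the coefficients
of its expansion. -/
theorem IsProduct.map_coordProj_mem (h : IsProduct dR dS e₁ e₂ φ ψ c) {k : ℕ} {I₁ : Ideal R}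
    {I₂ : Ideal T} (hI₁ : I₁.IsRadical) (hI₂ : I₂ ≠ ⊥) {δ : ⋀[S]^k (ρ → S)}
    (hδ : δ ∈ logModule dS (I₁.map φ ⊓ I₂.map ψ) k) :
    exteriorPower.map k (coordProj S (Set.range e₁)) δ ∈
      extendSubmodule φ e₁ k (logModule dR I₁ k) := by
  obtain ⟨u, hu, hu0⟩ := Submodule.exists_mem_ne_zero_of_ne_bot hI₂
  have hψu : ψ u ≠ 0 := fun h0 => hu0 (h.injective_right (h0.trans (map_zero ψ).symm))
  obtain ⟨s, hs⟩ := exists_eq_sum_coordWedge S e₁ δ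
  have h1 : ∀ f : Fin k → R, (∀ b, f b ∈ I₁) →
      ∑ g, s g * φ (pairing dR (coordWedge R g) f) ∈ I₁.map φ := by
    intro f hf
    have hf₁ : ∀ b, ψ u * φ (f b) ∈ I₁.map φ := fun b =>
      Ideal.mul_mem_left _ _ (Ideal.mem_map_of_mem φ (hf b))
    have h2 : pairing dS (exteriorPower.map k (coordProj S (Set.range e₁)) δ)
        (fun b => ψ u * φ (f b)) ∈ I₁.map φ := by
      have h3 := hδ (fun b => ψ u * φ (f b)) fun b =>
        ⟨hf₁ b, Ideal.mul_mem_right _ _ (Ideal.mem_map_of_mem ψ hu)⟩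
      have h4 := h.sub_map_coordProj_mem I₁ δ _ hf₁
      rw [← sub_add_cancel δ (exteriorPower.map k (coordProj S (Set.range e₁)) δ),
        pairing_add] at h3
      exact (Ideal.add_mem_iff_right _ h4).1 h3.1
    rw [hs, h.pairing_sum_coordWedge] at h2
    have h5 : ∀ (m : ℕ) (x : S), ψ u ^ m * x ∈ I₁.map φ → x ∈ I₁.map φ := by
      intro m x
      induction m with
      | zero => rw [pow_zero, one_mul]; exact id
      | succ m ih => rw [pow_succ', mul_assoc]; exact fun hx => ih (h.mem_of_mul_mem hI₁ hψu hx)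
    exact h5 k _ h2
  have h5 : s ∈ Submodule.span S ((fun v g => φ (v g)) ''
      (((logModule dR I₁ k).comap (Fintype.linearCombination R (coordWedge R)) :
        Submodule R ((Fin k → σ) → R)) : Set ((Fin k → σ) → R))) := by
    refine h.mem_span _ s fun α => ?_
    intro f hf
    have h6 := (h.mem_map_iff I₁).1 (h1 f hf) α
    rw [Fintype.linearCombination_apply, pairing_sum]
    rw [map_sum, map_sum] at h6
    convert h6 using 2 with g
    rw [pairing_smul, map_mul, h.map_left, MvPowerSeries.coeff_mul_C]
  have h7 := Submodule.mem_map_of_mem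
    (f := Fintype.linearCombination S fun g => coordWedge S (e₁ ∘ g)) h5
  rw [Submodule.map_span, Fintype.linearCombination_apply, ← hs] at h7
  refine Submodule.span_mono ?_ h7
  rintro _ ⟨_, ⟨v, hv, rfl⟩, rfl⟩
  refine ⟨_, hv, ?_⟩
  rw [Fintype.linearCombination_apply, Fintype.linearCombination_apply, map_sum]
  refine Finset.sum_congr rfl fun g _ => ?_
  rw [map_smulₛₗ, wedgeMap_coordWedge]

end Product

/-! ### The direct sum decomposition -/

section Mixed

/-- The free module of `k`-vector fields has a basis of wedge products of coordinate fields, whose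
shape does not depend on the ring. -/
theorem exists_basis_coordWedge (σ : Type) [Finite σ] [DecidableEq σ] (k : ℕ) :
    ∃ (ι : Type) (g : ι → Fin k → σ), ∀ (R : Type) [CommRing R],
      ∃ b : Module.Basis ι R (⋀[R]^k (σ → R)), ∀ i, b i = coordWedge R (g i) := by
  classical
  let _ : LinearOrder σ := linearOrderOfSTO WellOrderingRel
  refine ⟨Set.powersetCard σ k, fun s => Set.powersetCard.ofFinEmbEquiv.symm s, fun R _ =>
    ⟨(Pi.basisFun R σ).exteriorPower k, fun s => ?_⟩⟩
  rw [exteriorPower.basis_apply, coordWedge, exteriorPower.ιMulti_family]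
  refine congrArg _ (funext fun a => ?_)
  rw [Function.comp_apply, Pi.basisFun_apply]

variable (S : Type) [CommRing S] (σ τ : Type) [DecidableEq σ] [DecidableEq τ] (k : ℕ)

/-- The projection of multivector fields onto the part which is mixed in two groups of
variables. -/
def mixedProj : ⋀[S]^k (σ ⊕ τ → S) →ₗ[S] ⋀[S]^k (σ ⊕ τ → S) :=
  LinearMap.id - exteriorPower.map k (coordProj S (Set.range Sum.inl)) -
    exteriorPower.map k (coordProj S (Set.range Sum.inr))

variable {S σ τ k}

theorem mixedProj_coordWedge (hk : k ≠ 0) (g : Fin k → σ ⊕ τ) :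
    (mixedProj S σ τ k (coordWedge S g) = coordWedge S g ∧ coordWedge S g ∈ mixed S σ τ k) ∨
      mixedProj S σ τ k (coordWedge S g) = 0 := by
  simp only [mixedProj, LinearMap.sub_apply, LinearMap.id_apply]
  let a₀ : Fin k := ⟨0, Nat.pos_of_ne_zero hk⟩
  by_cases h1 : ∀ a, (g a).isLeft = true
  · right
    have h2 : ∀ a, g a ∈ Set.range (Sum.inl : σ → σ ⊕ τ) := fun a => by
      obtain ⟨i, hi⟩ := Sum.isLeft_iff.1 (h1 a)
      exact ⟨i, hi.symm⟩
    have h3 : g a₀ ∉ Set.range (Sum.inr : τ → σ ⊕ τ) := by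
      obtain ⟨i, hi⟩ := Sum.isLeft_iff.1 (h1 a₀)
      simp [hi]
    rw [map_coordProj_coordWedge_of_mem h2, map_coordProj_coordWedge_of_notMem h3, sub_self,
      sub_zero]
  · push Not at h1
    obtain ⟨b, hb⟩ := h1
    have hb' : (g b).isRight = true := by simpa using hb
    have h3 : g b ∉ Set.range (Sum.inl : σ → σ ⊕ τ) := by
      obtain ⟨i, hi⟩ := Sum.isRight_iff.1 hb'
      simp [hi]
    rw [map_coordProj_coordWedge_of_notMem h3, sub_zero]
    by_cases h2 : ∀ a, (g a).isRight = true
    · right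
      rw [map_coordProj_coordWedge_of_mem, sub_self]
      intro a
      obtain ⟨i, hi⟩ := Sum.isRight_iff.1 (h2 a)
      exact ⟨i, hi.symm⟩
    · left
      push Not at h2
      obtain ⟨a, ha⟩ := h2
      have ha' : (g a).isLeft = true := by simpa using ha
      have h4 : g a ∉ Set.range (Sum.inr : τ → σ ⊕ τ) := by
        obtain ⟨i, hi⟩ := Sum.isLeft_iff.1 ha'
        simp [hi]
      rw [map_coordProj_coordWedge_of_notMem h4, sub_zero]
      exact ⟨rfl, Submodule.subset_span ⟨g, ⟨a, ha'⟩, ⟨b, hb'⟩, rfl⟩⟩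

theorem mixedProj_mem [Finite σ] [Finite τ] (hk : k ≠ 0) (δ : ⋀[S]^k (σ ⊕ τ → S)) :
    mixedProj S σ τ k δ ∈ mixed S σ τ k := by
  have h1 : Submodule.span S (Set.range (coordWedge S : (Fin k → σ ⊕ τ) → ⋀[S]^k (σ ⊕ τ → S))) ≤
      (mixed S σ τ k).comap (mixedProj S σ τ k) := by
    refine Submodule.span_le.2 ?_
    rintro _ ⟨g, rfl⟩
    change _ ∈ mixed S σ τ k
    obtain ⟨h1, h2⟩ | h := mixedProj_coordWedge (S := S) hk g
    · rwa [h1]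
    · rw [h]; exact Submodule.zero_mem _
  rw [span_range_coordWedge] at h1
  exact h1 trivial

theorem mixed_le_ker_inl : mixed S σ τ k ≤
    LinearMap.ker (exteriorPower.map k (coordProj S (Set.range (Sum.inl : σ → σ ⊕ τ)))) := by
  refine Submodule.span_le.2 ?_
  rintro _ ⟨g, -, ⟨b, hb⟩, rfl⟩
  refine map_coordProj_coordWedge_of_notMem (a := b) ?_
  obtain ⟨i, hi⟩ := Sum.isRight_iff.1 hb
  simp [hi]

theorem mixed_le_ker_inr : mixed S σ τ k ≤
    LinearMap.ker (exteriorPower.map k (coordProj S (Set.range (Sum.inr : τ → σ ⊕ τ)))) := by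
  refine Submodule.span_le.2 ?_
  rintro _ ⟨g, ⟨a, ha⟩, -, rfl⟩
  refine map_coordProj_coordWedge_of_notMem (a := a) ?_
  obtain ⟨i, hi⟩ := Sum.isLeft_iff.1 ha
  simp [hi]

theorem mixedProj_eq_self {w : ⋀[S]^k (σ ⊕ τ → S)} (hw : w ∈ mixed S σ τ k) :
    mixedProj S σ τ k w = w := by
  rw [mixedProj, LinearMap.sub_apply, LinearMap.sub_apply, LinearMap.id_apply,
    LinearMap.mem_ker.1 (mixed_le_ker_inl hw), LinearMap.mem_ker.1 (mixed_le_ker_inr hw), sub_zero,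
    sub_zero]

theorem free_mixed (S σ τ : Type) [CommRing S] [Finite σ] [Finite τ] [DecidableEq σ]
    [DecidableEq τ] {k : ℕ} (hk : k ≠ 0) : Module.Free S (mixed S σ τ k) := by
  obtain ⟨ι, g, hg⟩ := exists_basis_coordWedge (σ ⊕ τ) k
  obtain ⟨b, hb⟩ := hg S
  set A : Set ι := {i | coordWedge S (g i) ∈ mixed S σ τ k}
  have h1 : mixed S σ τ k = Submodule.span S (Set.range fun i : A => b i) := by
    apply le_antisymm
    · intro w hw
      have h2 : mixedProj S σ τ k w ∈ Submodule.map (mixedProj S σ τ k) (Submodule.span S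
          (Set.range b)) := Submodule.mem_map_of_mem (b.mem_span w)
      rw [mixedProj_eq_self hw, Submodule.map_span] at h2
      refine Submodule.span_le.2 ?_ h2
      rintro _ ⟨_, ⟨i, rfl⟩, rfl⟩
      rw [hb]
      obtain ⟨h1, h2⟩ | h := mixedProj_coordWedge (S := S) hk (g i)
      · rw [h1, ← hb]
        exact Submodule.subset_span ⟨⟨i, h2⟩, rfl⟩
      · rw [h]; exact Submodule.zero_mem _
    · refine Submodule.span_le.2 ?_
      rintro _ ⟨⟨i, hi⟩, rfl⟩
      change b i ∈ mixed S σ τ k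
      rw [hb]
      exact hi
  rw [h1]
  exact Module.Free.of_basis
    (Module.Basis.span (b.linearIndependent.comp _ Subtype.val_injective))

end Mixed

section Extend

variable {R S σ ρ : Type} [CommRing R] [CommRing S] [Fintype σ] [DecidableEq σ] [DecidableEq ρ]
  {e₁ : σ → ρ} {φ : R →+* S} {k : ℕ}

theorem extendSubmodule_le_span (N : Submodule R (⋀[R]^k (σ → R))) :
    extendSubmodule φ e₁ k N ≤
      Submodule.span S (Set.range fun g : Fin k → σ => coordWedge S (e₁ ∘ g)) := by
  refine Submodule.span_le.2 ?_
  rintro _ ⟨δ, -, rfl⟩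
  have hδ : δ ∈ Submodule.span R (Set.range (coordWedge R : (Fin k → σ) → ⋀[R]^k (σ → R))) := by
    rw [span_range_coordWedge]; trivial
  rw [SetLike.mem_coe]
  induction hδ using Submodule.span_induction with
  | mem y hy =>
    obtain ⟨g, rfl⟩ := hy
    rw [wedgeMap_coordWedge]
    exact Submodule.subset_span ⟨g, rfl⟩
  | zero => rw [map_zero]; exact Submodule.zero_mem _
  | add y z _ _ hy hz => rw [map_add]; exact Submodule.add_mem _ hy hz
  | smul s y _ hy => rw [map_smulₛₗ]; exact Submodule.smul_mem _ _ hy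

theorem map_coordProj_eq_self {N : Submodule R (⋀[R]^k (σ → R))} {w : ⋀[S]^k (ρ → S)}
    (hw : w ∈ extendSubmodule φ e₁ k N) :
    exteriorPower.map k (coordProj S (Set.range e₁)) w = w := by
  have h1 : Submodule.span S (Set.range fun g : Fin k → σ => coordWedge S (e₁ ∘ g)) ≤
      LinearMap.eqLocus (exteriorPower.map k (coordProj S (Set.range e₁))) LinearMap.id := by
    refine Submodule.span_le.2 ?_
    rintro _ ⟨g, rfl⟩
    exact map_coordProj_coordWedge_of_mem fun a => ⟨g a, rfl⟩
  exact h1 (extendSubmodule_le_span N hw)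

theorem map_coordProj_eq_zero {N : Submodule R (⋀[R]^k (σ → R))} (hk : k ≠ 0) {s : Set ρ}
    (hs : ∀ i, e₁ i ∉ s) {w : ⋀[S]^k (ρ → S)} (hw : w ∈ extendSubmodule φ e₁ k N) :
    exteriorPower.map k (coordProj S s) w = 0 := by
  have h1 : Submodule.span S (Set.range fun g : Fin k → σ => coordWedge S (e₁ ∘ g)) ≤
      LinearMap.ker (exteriorPower.map k (coordProj S s)) := by
    refine Submodule.span_le.2 ?_
    rintro _ ⟨g, rfl⟩
    exact map_coordProj_coordWedge_of_notMem (a := ⟨0, Nat.pos_of_ne_zero hk⟩) (hs _)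
  exact h1 (extendSubmodule_le_span N hw)

end Extend

theorem iSupIndep_of_projections {S M ι : Type} [CommRing S] [AddCommGroup M] [Module S M]
    {A : ι → Submodule S M} (Q : ι → M →ₗ[S] M) (h1 : ∀ i, ∀ w ∈ A i, Q i w = w)
    (h2 : ∀ i j, j ≠ i → ∀ w ∈ A j, Q i w = 0) : iSupIndep A := by
  intro i
  rw [Submodule.disjoint_def]
  intro w hw hw'
  have h3 : ⨆ j, ⨆ (_ : j ≠ i), A j ≤ LinearMap.ker (Q i) :=
    iSup₂_le fun j hj x hx => h2 i j hj x hx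
  rw [← h1 i w hw]
  exact h3 hw'

theorem iSupIndep_extendSubmodule {R S T σ τ : Type} [CommRing R] [CommRing S]
    [CommRing T] [Fintype σ] [Fintype τ] [DecidableEq σ] [DecidableEq τ] (φ : R →+* S)
    (ψ : T →+* S) {k : ℕ} (hk : k ≠ 0)
    (N₁ : Submodule R (⋀[R]^k (σ → R))) (N₂ : Submodule T (⋀[T]^k (τ → T))) :
    iSupIndep ![extendSubmodule φ Sum.inl k N₁, extendSubmodule ψ Sum.inr k N₂,
      mixed S σ τ k] := by
  refine iSupIndep_of_projections ![exteriorPower.map k (coordProj S (Set.range Sum.inl)),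
    exteriorPower.map k (coordProj S (Set.range Sum.inr)), mixedProj S σ τ k] ?_ ?_
  · intro i
    fin_cases i
    · exact fun w hw => map_coordProj_eq_self hw
    · exact fun w hw => map_coordProj_eq_self hw
    · exact fun w hw => mixedProj_eq_self hw
  · have h1 : ∀ w ∈ extendSubmodule φ (Sum.inl : σ → σ ⊕ τ) k N₁,
        exteriorPower.map k (coordProj S (Set.range (Sum.inr : τ → σ ⊕ τ))) w = 0 :=
      fun w hw => map_coordProj_eq_zero hk (fun i => by simp) hw
    have h2 : ∀ w ∈ extendSubmodule ψ (Sum.inr : τ → σ ⊕ τ) k N₂,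
        exteriorPower.map k (coordProj S (Set.range (Sum.inl : σ → σ ⊕ τ))) w = 0 :=
      fun w hw => map_coordProj_eq_zero hk (fun i => by simp) hw
    intro i j hij w hw
    fin_cases i <;> fin_cases j
    · exact absurd rfl hij
    · exact h2 w hw
    · exact mixed_le_ker_inl hw
    · exact h1 w hw
    · exact absurd rfl hij
    · exact mixed_le_ker_inr hw
    · change w - _ - _ = 0
      rw [h1 w hw, map_coordProj_eq_self hw, sub_self, sub_zero]
    · change w - _ - _ = 0
      rw [h2 w hw, map_coordProj_eq_self hw, sub_zero, sub_self]
    · exact absurd rfl hij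

section Decomposition

variable {R S T σ τ : Type} [CommRing R] [CommRing S] [CommRing T] [Algebra ℂ R] [Algebra ℂ S]
  [Algebra ℂ T] [Fintype σ] [Fintype τ] [DecidableEq σ] [DecidableEq τ]
  {dR : σ → Derivation ℂ R R} {dT : τ → Derivation ℂ T T} {dS : σ ⊕ τ → Derivation ℂ S S}
  {φ : R →+* S} {ψ : T →+* S} {c₁ : S →+* MvPowerSeries τ R} {c₂ : S →+* MvPowerSeries σ T}

theorem mixed_le_logModule (h₁ : IsProduct dR dS Sum.inl Sum.inr φ ψ c₁)
    (h₂ : IsProduct dT dS Sum.inr Sum.inl ψ φ c₂) {k : ℕ} (I₁ : Ideal R) (I₂ : Ideal T) :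
    mixed S σ τ k ≤ logModule dS (I₁.map φ ⊓ I₂.map ψ) k := by
  refine le_trans (Submodule.span_le.2 ?_) (logModule_inf_le dS _ _ k)
  rintro _ ⟨g, ⟨a, ha⟩, ⟨b, hb⟩, rfl⟩
  obtain ⟨i, hi⟩ := Sum.isLeft_iff.1 ha
  obtain ⟨j, hj⟩ := Sum.isRight_iff.1 hb
  exact ⟨coordWedge_mem_logModule (a := b) fun f hf =>
      derivation_mem_map _ (hj ▸ h₁.deriv_inr_left j) hf,
    coordWedge_mem_logModule (a := a) fun f hf =>
      derivation_mem_map _ (hi ▸ h₂.deriv_inr_left i) hf⟩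

theorem logModule_inf_eq (h₁ : IsProduct dR dS Sum.inl Sum.inr φ ψ c₁)
    (h₂ : IsProduct dT dS Sum.inr Sum.inl ψ φ c₂) {k : ℕ} (hk : k ≠ 0) {I₁ : Ideal R}
    {I₂ : Ideal T} (hI₁ : I₁.IsRadical) (hI₂ : I₂.IsRadical) (h0₁ : I₁ ≠ ⊥) (h0₂ : I₂ ≠ ⊥) :
    logModule dS (I₁.map φ ⊓ I₂.map ψ) k =
      extendSubmodule φ Sum.inl k (logModule dR I₁ k) ⊔
      extendSubmodule ψ Sum.inr k (logModule dT I₂ k) ⊔ mixed S σ τ k := by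
  apply le_antisymm
  · intro δ hδ
    have h3 := h₁.map_coordProj_mem hI₁ h0₂ hδ
    have h4 := h₂.map_coordProj_mem hI₂ h0₁ (inf_comm (I₁.map φ) (I₂.map ψ) ▸ hδ)
    have h5 := mixedProj_mem hk δ
    have h6 : δ = exteriorPower.map k (coordProj S (Set.range Sum.inl)) δ +
        exteriorPower.map k (coordProj S (Set.range Sum.inr)) δ + mixedProj S σ τ k δ := by
      rw [mixedProj, LinearMap.sub_apply, LinearMap.sub_apply, LinearMap.id_apply]
      abel
    rw [h6]
    exact Submodule.add_mem_sup (Submodule.add_mem_sup h3 h4) h5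
  · refine sup_le (sup_le (h₁.extendSubmodule_logModule_le hk I₁ I₂) ?_)
      (mixed_le_logModule h₁ h₂ I₁ I₂)
    rw [inf_comm]
    exact h₂.extendSubmodule_logModule_le hk I₂ I₁

end Decomposition

/-! ### Projective dimension and extension of coordinate rings -/

section ProjectiveDimension

open CategoryTheory TensorProduct

theorem hasProjectiveDimensionLT_of_linearEquiv {R : Type} [CommRing R] {M N : Type}
    [AddCommGroup M] [Module R M] [AddCommGroup N] [Module R N] (e : M ≃ₗ[R] N) {n : ℕ}
    (h : HasProjectiveDimensionLT (ModuleCat.of R M) n) :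
    HasProjectiveDimensionLT (ModuleCat.of R N) n :=
  hasProjectiveDimensionLT_of_iso e.toModuleIso n

theorem hasProjectiveDimensionLT_of_comp_eq_id {R : Type} [CommRing R] {M N : Type}
    [AddCommGroup M] [Module R M] [AddCommGroup N] [Module R N] (i : M →ₗ[R] N) (r : N →ₗ[R] M)
    (hir : r ∘ₗ i = LinearMap.id) {n : ℕ} (h : HasProjectiveDimensionLT (ModuleCat.of R N) n) :
    HasProjectiveDimensionLT (ModuleCat.of R M) n :=
  Retract.hasProjectiveDimensionLT (Y := ModuleCat.of R N)
    { i := ModuleCat.ofHom i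
      r := ModuleCat.ofHom r
      retract := by rw [← ModuleCat.ofHom_comp, hir]; rfl } n

theorem hasProjectiveDimensionLT_prod {R : Type} [CommRing R] {M N : Type}
    [AddCommGroup M] [Module R M] [AddCommGroup N] [Module R N] {n : ℕ}
    (hM : HasProjectiveDimensionLT (ModuleCat.of R M) n)
    (hN : HasProjectiveDimensionLT (ModuleCat.of R N) n) :
    HasProjectiveDimensionLT (ModuleCat.of R (M × N)) n :=
  hasProjectiveDimensionLT_of_iso
    (ModuleCat.biprodIsoProd (ModuleCat.of R M) (ModuleCat.of R N)) n

theorem hasProjectiveDimensionLT_zero_iff {R : Type} [CommRing R] {M : Type}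
    [AddCommGroup M] [Module R M] :
    HasProjectiveDimensionLT (ModuleCat.of R M) 0 ↔ Subsingleton M := by
  rw [hasProjectiveDimensionLT_zero_iff_isZero, ModuleCat.isZero_iff_subsingleton]

theorem hasProjectiveDimensionLT_one_iff {R : Type} [CommRing R] {M : Type}
    [AddCommGroup M] [Module R M] :
    HasProjectiveDimensionLT (ModuleCat.of R M) 1 ↔ Module.Projective R M := by
  rw [← projective_iff_hasProjectiveDimensionLT_one, ← IsProjective.iff_projective]

theorem hasProjectiveDimensionLT_add_two_iff {R : Type} [CommRing R] {K P N : Type}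
    [AddCommGroup K] [Module R K] [AddCommGroup P] [Module R P] [AddCommGroup N] [Module R N]
    [Module.Projective R P] {f : K →ₗ[R] P} {g : P →ₗ[R] N} (hf : Function.Injective f)
    (hfg : Function.Exact f g) (hg : Function.Surjective g) (n : ℕ) :
    HasProjectiveDimensionLT (ModuleCat.of R N) (n + 2) ↔
      HasProjectiveDimensionLT (ModuleCat.of R K) (n + 1) := by
  have hP : Projective (ModuleCat.of R P) := (IsProjective.iff_projective _).1 inferInstance
  set T : ShortComplex (ModuleCat.{0} R) :=
    ModuleCat.shortComplexOfCompEqZero f g hfg.linearMap_comp_eq_zero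
  have hT : T.ShortExact := ModuleCat.shortComplex_shortExact T hfg hf hg
  exact hT.hasProjectiveDimensionLT_X₃_iff n hP

/-- Along a flat ring extension with a retraction, the projective dimension does not change. -/
theorem hasProjectiveDimensionLT_baseChange_iff {R S : Type} [CommRing R] [CommRing S]
    [Algebra R S] [Module.Flat R S] (r : S →+* R) (hr : ∀ a, r (algebraMap R S a) = a) (n : ℕ)
    (N : Type) [AddCommGroup N] [Module R N] :
    HasProjectiveDimensionLT (ModuleCat.of S (S ⊗[R] N)) n ↔
      HasProjectiveDimensionLT (ModuleCat.of R N) n := by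
  let _ : Algebra S R := r.toAlgebra
  have : IsScalarTower R S R := IsScalarTower.of_algebraMap_eq fun a => (hr a).symm
  let e (N : Type) [AddCommGroup N] [Module R N] : R ⊗[S] (S ⊗[R] N) ≃ₗ[R] N :=
    (AlgebraTensorModule.cancelBaseChange R S R R N).trans (TensorProduct.lid R N)
  induction n using Nat.strong_induction_on generalizing N with
  | _ n ih =>
    match n with
    | 0 =>
      rw [hasProjectiveDimensionLT_zero_iff, hasProjectiveDimensionLT_zero_iff]
      exact ⟨fun h => (e N).symm.toEquiv.subsingleton, fun h => inferInstance⟩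
    | 1 =>
      rw [hasProjectiveDimensionLT_one_iff, hasProjectiveDimensionLT_one_iff]
      exact ⟨fun h => Module.Projective.of_equiv (e N), fun h => inferInstance⟩
    | n + 2 =>
      set g : (N →₀ R) →ₗ[R] N := Finsupp.linearCombination R id
      have hg : Function.Surjective g := Finsupp.linearCombination_id_surjective R N
      have hex : Function.Exact (LinearMap.ker g).subtype g := g.exact_subtype_ker_map
      have hR := hasProjectiveDimensionLT_add_two_iff (K := LinearMap.ker g)
        (P := N →₀ R) (f := (LinearMap.ker g).subtype) (g := g) (LinearMap.ker g).injective_subtype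
        hex hg n
      refine Iff.trans ?_ ((ih (n + 1) (Nat.lt_succ_self _) (LinearMap.ker g)).trans hR.symm)
      refine hasProjectiveDimensionLT_add_two_iff
        (f := (LinearMap.ker g).subtype.baseChange S) (g := g.baseChange S) ?_ ?_ ?_ n
      · exact Module.Flat.lTensor_preserves_injective_linearMap _
          (LinearMap.ker g).injective_subtype
      · exact Module.Flat.lTensor_exact (M := S) (N := LinearMap.ker g) (N' := N →₀ R)
          (N'' := N) hex
      · exact LinearMap.lTensor_surjective S hg

/-- A submodule of a free module is compatible with flat base change. -/
theorem nonempty_linearEquiv_span_image {R S : Type} [CommRing R] [CommRing S] [Algebra R S]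
    [Module.Flat R S] {F G ι : Type} [AddCommGroup F] [Module R F] [AddCommGroup G] [Module S G]
    (w : F →ₛₗ[algebraMap R S] G) (b : Module.Basis ι R F)
    (hb : LinearIndependent S fun i => w (b i)) (N : Submodule R F) :
    Nonempty (S ⊗[R] N ≃ₗ[S] Submodule.span S (w '' (N : Set F))) := by
  let _ : Module R G := Module.compHom G (algebraMap R S)
  have : IsScalarTower R S G := IsScalarTower.of_algebraMap_smul fun _ _ => rfl
  let w' : F →ₗ[R] G :=
    { toFun := w
      map_add' := map_add w
      map_smul' := fun c x => map_smulₛₗ w c x }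
  have h1 : Function.Injective (w'.liftBaseChange S) := by
    have h2 : w'.liftBaseChange S =
        Finsupp.linearCombination S (fun i => w (b i)) ∘ₗ (b.baseChange S).repr.toLinearMap := by
      refine (b.baseChange S).ext fun i => ?_
      rw [LinearMap.comp_apply, LinearEquiv.coe_coe, Module.Basis.repr_self,
        Finsupp.linearCombination_single, one_smul, Module.Basis.baseChange_apply,
        LinearMap.liftBaseChange_tmul, one_smul]
      rfl
    rw [h2, LinearMap.coe_comp]
    exact Function.Injective.comp hb (b.baseChange S).repr.injective
  have h3 : Function.Injective ((w' ∘ₗ N.subtype).liftBaseChange S) := by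
    have h4 : (w' ∘ₗ N.subtype).liftBaseChange S =
        w'.liftBaseChange S ∘ₗ N.subtype.baseChange S := by
      ext x
      simp
    rw [h4, LinearMap.coe_comp]
    exact h1.comp (Module.Flat.lTensor_preserves_injective_linearMap _ N.injective_subtype)
  refine ⟨(LinearEquiv.ofInjective _ h3).trans (LinearEquiv.ofEq _ _ ?_)⟩
  rw [LinearMap.range_liftBaseChange]
  congr 1
  ext x
  simp [w']

end ProjectiveDimension

section Extend

open CategoryTheory TensorProduct

variable {R S T σ τ ρ : Type} [CommRing R] [CommRing S] [CommRing T] [Algebra ℂ R]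

theorem IsExpansion.hasProjectiveDimensionLT_extendSubmodule_iff [Fintype σ] [DecidableEq σ]
    [DecidableEq ρ] {φ : R →+* S} {ψ : T →+* S} {c : S →+* MvPowerSeries τ R}
    (h : IsExpansion φ ψ c) {e₁ : σ → ρ} (he : Function.Injective e₁) {k : ℕ}
    (N : Submodule R (⋀[R]^k (σ → R))) (n : ℕ) :
    HasProjectiveDimensionLT (ModuleCat.of S (extendSubmodule φ e₁ k N)) n ↔
      HasProjectiveDimensionLT (ModuleCat.of R N) n := by
  have hflat := h.flat
  algebraize [φ]
  rw [← hasProjectiveDimensionLT_baseChange_iff h.retraction h.retraction_map n N]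
  obtain ⟨ι, g, hg⟩ := exists_basis_coordWedge σ k
  obtain ⟨b, hb⟩ := hg R
  obtain ⟨b', hb'⟩ := hg S
  obtain ⟨e⟩ := nonempty_linearEquiv_span_image (S := S) (wedgeMap φ (extendField φ e₁) k) b
    (by
      refine LinearIndependent.of_comp (exteriorPower.map k (LinearMap.funLeft S S e₁)) ?_
      convert b'.linearIndependent using 1
      ext1 i
      rw [Function.comp_apply, hb, hb', wedgeMap_coordWedge, coordWedge, coordWedge,
        exteriorPower.map_apply_ιMulti]
      refine congrArg _ (funext fun a => funext fun j => ?_)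
      simp only [Function.comp_apply, LinearMap.funLeft_apply, Pi.single_apply, he.eq_iff]) N
  exact ⟨hasProjectiveDimensionLT_of_linearEquiv e.symm, hasProjectiveDimensionLT_of_linearEquiv e⟩

end Extend

section Union

open CategoryTheory

variable {R S T σ τ : Type} [CommRing R] [CommRing S] [CommRing T] [Algebra ℂ R] [Algebra ℂ S]
  [Algebra ℂ T] [Fintype σ] [Fintype τ] [DecidableEq σ] [DecidableEq τ]
  {dR : σ → Derivation ℂ R R} {dT : τ → Derivation ℂ T T} {dS : σ ⊕ τ → Derivation ℂ S S}
  {φ : R →+* S} {ψ : T →+* S} {c₁ : S →+* MvPowerSeries τ R} {c₂ : S →+* MvPowerSeries σ T}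

/-- Upper bounds for the projective dimension of a direct sum with a free summand, read on the
summands, which are flat base changes. -/
theorem hasProjectiveDimensionLT_logModule_inf_iff (h₁ : IsProduct dR dS Sum.inl Sum.inr φ ψ c₁)
    (h₂ : IsProduct dT dS Sum.inr Sum.inl ψ φ c₂) {k : ℕ} (hk : k ≠ 0) {I₁ : Ideal R}
    {I₂ : Ideal T} (hI₁ : I₁.IsRadical) (hI₂ : I₂.IsRadical) (h0₁ : I₁ ≠ ⊥) (h0₂ : I₂ ≠ ⊥) {n : ℕ}
    (hn : n ≠ 0) :
    HasProjectiveDimensionLT (ModuleCat.of S (logModule dS (I₁.map φ ⊓ I₂.map ψ) k)) n ↔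
      HasProjectiveDimensionLT (ModuleCat.of R (logModule dR I₁ k)) n ∧
      HasProjectiveDimensionLT (ModuleCat.of T (logModule dT I₂ k)) n := by
  rw [← h₁.hasProjectiveDimensionLT_extendSubmodule_iff h₁.injective_inl,
    ← h₂.hasProjectiveDimensionLT_extendSubmodule_iff h₂.injective_inl]
  set L := logModule dS (I₁.map φ ⊓ I₂.map ψ) k with hL
  have hx : ∀ δ ∈ L, exteriorPower.map k (coordProj S (Set.range Sum.inl)) δ ∈
      extendSubmodule φ Sum.inl k (logModule dR I₁ k) :=
    fun δ hδ => h₁.map_coordProj_mem hI₁ h0₂ hδ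
  have hy : ∀ δ ∈ L, exteriorPower.map k (coordProj S (Set.range Sum.inr)) δ ∈
      extendSubmodule ψ Sum.inr k (logModule dT I₂ k) :=
    fun δ hδ => h₂.map_coordProj_mem hI₂ h0₁ (inf_comm (I₁.map φ) (I₂.map ψ) ▸ hδ)
  have hm : ∀ δ ∈ L, mixedProj S σ τ k δ ∈ mixed S σ τ k := fun δ _ => mixedProj_mem hk δ
  have hLe := logModule_inf_eq h₁ h₂ hk hI₁ hI₂ h0₁ h0₂
  have hA : extendSubmodule φ Sum.inl k (logModule dR I₁ k) ≤ L := by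
    rw [hL, hLe]; exact le_sup_left.trans le_sup_left
  have hB : extendSubmodule ψ Sum.inr k (logModule dT I₂ k) ≤ L := by
    rw [hL, hLe]; exact le_sup_right.trans le_sup_left
  have hC : mixed S σ τ k ≤ L := by
    rw [hL, hLe]; exact le_sup_right
  constructor
  · intro h
    refine ⟨hasProjectiveDimensionLT_of_comp_eq_id (Submodule.inclusion hA)
      (LinearMap.restrict _ hx) ?_ h, hasProjectiveDimensionLT_of_comp_eq_id
      (Submodule.inclusion hB) (LinearMap.restrict _ hy) ?_ h⟩
    · exact LinearMap.ext fun w => Subtype.ext (map_coordProj_eq_self w.2)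
    · exact LinearMap.ext fun w => Subtype.ext (map_coordProj_eq_self w.2)
  · rintro ⟨h3, h4⟩
    have h5 : HasProjectiveDimensionLT (ModuleCat.of S (mixed S σ τ k)) n := by
      have := free_mixed S σ τ hk
      have h6 : HasProjectiveDimensionLT (ModuleCat.of S (mixed S σ τ k)) 1 :=
        hasProjectiveDimensionLT_one_iff.2 inferInstance
      exact hasProjectiveDimensionLT_of_ge _ 1 n (by omega)
    refine hasProjectiveDimensionLT_of_comp_eq_id
      ((LinearMap.restrict _ hx).prod ((LinearMap.restrict _ hy).prod (LinearMap.restrict _ hm)))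
      ((Submodule.inclusion hA).coprod
        ((Submodule.inclusion hB).coprod (Submodule.inclusion hC))) ?_
      (hasProjectiveDimensionLT_prod h3 (hasProjectiveDimensionLT_prod h4 h5))
    refine LinearMap.ext fun w => Subtype.ext ?_
    change exteriorPower.map k (coordProj S (Set.range Sum.inl)) w.1 +
      (exteriorPower.map k (coordProj S (Set.range Sum.inr)) w.1 + mixedProj S σ τ k w.1) = w.1
    rw [mixedProj, LinearMap.sub_apply, LinearMap.sub_apply, LinearMap.id_apply]
    abel

end Union

/-! ### Primes and heights in an extended coordinate ring -/

section Heights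

theorem eq_bot_of_height_minimalPrimes_eq_zero {R : Type} [CommRing R] [IsDomain R] {I : Ideal R}
    (hI : I ≠ ⊤) (h : ∀ p ∈ I.minimalPrimes, p.height = 0) : I = ⊥ := by
  obtain ⟨p, hp⟩ := Ideal.nonempty_minimalPrimes hI
  have hpp : p.IsPrime := hp.1.1
  have h1 := Ideal.height_eq_zero_iff.1 (h p hp)
  rw [IsDomain.minimalPrimes_eq_singleton_bot] at h1
  exact le_bot_iff.1 (hp.1.2.trans h1.le)

theorem ne_bot_of_height_minimalPrimes_ne_zero {R : Type} [CommRing R] [IsDomain R] {I : Ideal R}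
    (hI : I ≠ ⊤) {k : ℕ∞}
    (hk : k ≠ 0) (h : ∀ p ∈ I.minimalPrimes, p.height = k) : I ≠ ⊥ := by
  rintro rfl
  refine hk ((h ⊥ ?_).symm.trans Ideal.height_bot)
  rw [Ideal.minimalPrimes_eq_subsingleton_self]
  exact Set.mem_singleton _

variable {R S T τ : Type} [CommRing R] [CommRing S] [CommRing T] [Algebra ℂ R]
  {φ : R →+* S} {ψ : T →+* S} {c : S →+* MvPowerSeries τ R}

/-- The extension of `p` is the kernel of the expansion modulo `p`, which takes values in a
domain. -/
theorem IsExpansion.isPrime_map (h : IsExpansion φ ψ c) (p : Ideal R) [hp : p.IsPrime] :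
    (p.map φ).IsPrime := by
  have : IsDomain (MvPowerSeries τ (R ⧸ p)) := NoZeroDivisors.to_isDomain _
  have h1 : p.map φ = RingHom.ker ((MvPowerSeries.map (Ideal.Quotient.mk p)).comp c) := by
    ext s
    rw [h.mem_map_iff, RingHom.mem_ker, RingHom.comp_apply, MvPowerSeries.ext_iff]
    simp only [MvPowerSeries.coeff_map, map_zero, Ideal.Quotient.eq_zero_iff_mem]
  rw [h1]
  exact RingHom.ker_isPrime _

theorem IsExpansion.isRadical_map (h : IsExpansion φ ψ c) {I : Ideal R} (hI : I.IsRadical) :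
    (I.map φ).IsRadical := by
  rintro s ⟨n, hn⟩
  rw [h.mem_map_iff]
  intro α
  rw [← hI.radical, Ideal.radical_eq_sInf, Submodule.mem_sInf]
  rintro q ⟨hIq, hq⟩
  have := h.isPrime_map q
  exact (h.mem_map_iff q).1 (this.mem_of_pow_mem n (Ideal.map_mono hIq hn)) α

theorem IsExpansion.map_ne_top (h : IsExpansion φ ψ c) {I : Ideal R} (hI : I ≠ ⊤) :
    I.map φ ≠ ⊤ := by
  intro h1
  refine hI ?_
  rw [← h.comap_map I, h1, Ideal.comap_top]

/-- Heights are additive in a flat extension, and `p.map φ` is the minimal prime of its fiber. -/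
theorem IsExpansion.height_map [IsNoetherianRing R] [IsNoetherianRing S]
    (h : IsExpansion φ ψ c) (p : Ideal R) [hp : p.IsPrime] : (p.map φ).height = p.height := by
  have hflat := h.flat
  have hP := h.isPrime_map p
  have hc := h.comap_map p
  algebraize [φ]
  have : (p.map φ).LiesOver p := ⟨hc.symm⟩
  have h1 := Ideal.height_eq_height_add_of_liesOver_of_hasGoingDown p (p.map φ)
  have h2 : ((p.map φ).map (Ideal.Quotient.mk (p.map (algebraMap R S)))) = ⊥ :=
    Ideal.map_quotient_self _
  have : (⊥ : Ideal (S ⧸ p.map (algebraMap R S))).height = 0 := by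
    have : IsDomain (S ⧸ p.map (algebraMap R S)) := (Ideal.Quotient.isDomain_iff_prime _).2 hP
    exact Ideal.height_bot
  rw [h1, h2, this, add_zero]

/-- The minimal primes of the ideal of a union of cylinders are extensions of minimal primes of the
two factors. -/
theorem height_of_mem_minimalPrimes_inf [IsNoetherianRing R] [IsNoetherianRing T]
    [IsNoetherianRing S] [Algebra ℂ T] {σ : Type} {c₂ : S →+* MvPowerSeries σ T}
    (h₁ : IsExpansion φ ψ c) (h₂ : IsExpansion ψ φ c₂) {I₁ : Ideal R} {I₂ : Ideal T} {k : ℕ∞}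
    (hk₁ : ∀ p ∈ I₁.minimalPrimes, p.height = k) (hk₂ : ∀ p ∈ I₂.minimalPrimes, p.height = k)
    {P : Ideal S} (hP : P ∈ (I₁.map φ ⊓ I₂.map ψ).minimalPrimes) : P.height = k := by
  have hPp : P.IsPrime := hP.1.1
  obtain h | h := hPp.inf_le.1 hP.1.2
  · obtain ⟨q, hq, hqP⟩ := Ideal.exists_minimalPrimes_le (Ideal.map_le_iff_le_comap.1 h)
    have hqp : q.IsPrime := hq.1.1
    have h1 : P ≤ q.map φ := hP.2 ⟨h₁.isPrime_map q, inf_le_left.trans (Ideal.map_mono hq.1.2)⟩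
      (Ideal.map_le_iff_le_comap.2 hqP)
    rw [le_antisymm h1 (Ideal.map_le_iff_le_comap.2 hqP), h₁.height_map, hk₁ q hq]
  · obtain ⟨q, hq, hqP⟩ := Ideal.exists_minimalPrimes_le (Ideal.map_le_iff_le_comap.1 h)
    have hqp : q.IsPrime := hq.1.1
    have h1 : P ≤ q.map ψ := hP.2 ⟨h₂.isPrime_map q, inf_le_right.trans (Ideal.map_mono hq.1.2)⟩
      (Ideal.map_le_iff_le_comap.2 hqP)
    rw [le_antisymm h1 (Ideal.map_le_iff_le_comap.2 hqP), h₂.height_map, hk₂ q hq]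

end Heights

/-! ### Freeness of a union -/

section Free

/-- The properties of the ring `S` of polynomials, or of convergent power series, in `σ` variables
which enter the study of logarithmic multivector fields: it is a Noetherian domain of the expected
dimension, its derivations are determined by the coordinates `x`, and there are enough
derivations along each of its primes. -/
structure IsCoordinateRing {S σ : Type} [CommRing S] [Algebra ℂ S] [Fintype σ]
    (d : σ → Derivation ℂ S S) (x : σ → S) : Prop where
  isDomain : IsDomain S
  isNoetherianRing : IsNoetherianRing S
  derivation_apply : ∀ (D : Derivation ℂ S S) (f : S), D f = ∑ i, D (x i) * d i f
  ringKrullDim_le : ringKrullDim S ≤ Nat.card σ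
  normalAt : ∀ p : Ideal S, p.IsPrime → NormalAt (Nat.card σ) p

/-- Since `k - 1` is always a lower bound for the projective dimension, freeness amounts to an
upper bound. -/
theorem IsCoordinateRing.projectiveDimension_add_one_eq_iff {S σ : Type} [CommRing S]
    [Algebra ℂ S] [Fintype σ] {d : σ → Derivation ℂ S S} {x : σ → S} (h : IsCoordinateRing d x)
    {I : Ideal S} (hI : I.IsRadical) (hI' : I ≠ ⊤) {k : ℕ} (hk : k ≠ 0)
    (hht : ∀ p ∈ I.minimalPrimes, p.height = k) :
    CategoryTheory.projectiveDimension (ModuleCat.of S (logModule d I k)) + 1 = k ↔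
      CategoryTheory.HasProjectiveDimensionLT (ModuleCat.of S (logModule d I k)) k := by
  obtain ⟨k, rfl⟩ := Nat.exists_eq_succ_of_ne_zero hk
  obtain ⟨p, hp⟩ := Ideal.nonempty_minimalPrimes hI'
  have := h.isNoetherianRing
  have h1 := not_hasProjectiveDimensionLT_logModule x h.derivation_apply h.ringKrullDim_le hI hp
    (hht p hp) (h.normalAt p hp.1.1)
  rw [← CategoryTheory.projectiveDimension_ge_iff] at h1
  rw [← CategoryTheory.projectiveDimension_lt_iff]
  generalize CategoryTheory.projectiveDimension (ModuleCat.of S (logModule d I (k + 1))) = a at *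
  induction a with
  | bot => simp at h1
  | coe a =>
    have h1' : (k : ℕ∞) ≤ a := by exact_mod_cast h1
    constructor
    · intro h2
      have h3 : a + 1 = ((k + 1 : ℕ) : ℕ∞) := by exact_mod_cast h2
      have h4 : a < ((k + 1 : ℕ) : ℕ∞) := by
        rw [← h3]
        refine (ENat.lt_add_one_iff ?_).2 le_rfl
        rintro rfl
        rw [top_add] at h3
        exact ENat.natCast_ne_top (k + 1) h3.symm
      exact_mod_cast h4
    · intro h2
      have h3 : a < ((k + 1 : ℕ) : ℕ∞) := by exact_mod_cast h2
      have h4 : a ≤ k := Order.le_of_lt_add_one (by exact_mod_cast h3)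
      rw [le_antisymm h4 h1']
      norm_cast

/-- In codimension zero the ideal is zero, and the only logarithmic `0`-vector field is zero. -/
theorem logModule_bot_zero {S σ : Type} [CommRing S] [Algebra ℂ S] [Fintype σ]
    (d : σ → Derivation ℂ S S) : logModule d ⊥ 0 = ⊥ := by
  classical
  rw [eq_bot_iff]
  intro δ hδ
  obtain ⟨s, rfl⟩ : ∃ s : S, s • (exteriorPower.ιMulti S 0 (Fin.elim0 : Fin 0 → σ → S)) = δ := by
    refine ⟨exteriorPower.zeroEquiv S _ δ, (exteriorPower.zeroEquiv S _).injective ?_⟩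
    rw [map_smul, exteriorPower.zeroEquiv_ιMulti, smul_eq_mul, mul_one]
  have h1 := hδ Fin.elim0 fun j => j.elim0
  rw [pairing_smul, pairing_ιMulti, Matrix.det_fin_zero, mul_one] at h1
  rw [(Submodule.mem_bot S).1 h1, zero_smul]
  exact Submodule.zero_mem _

theorem mixed_zero (S σ τ : Type) [CommRing S] [DecidableEq σ] [DecidableEq τ] :
    mixed S σ τ 0 = ⊥ := by
  rw [mixed, Submodule.span_eq_bot]
  rintro _ ⟨g, ⟨a, -⟩, -⟩
  exact a.elim0

theorem extendSubmodule_bot {R S σ ρ : Type} [CommRing R] [CommRing S] [Fintype σ]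
    [DecidableEq ρ] (φ : R →+* S) (e : σ → ρ) (k : ℕ) :
    extendSubmodule φ e k (⊥ : Submodule R (⋀[R]^k (σ → R))) = ⊥ := by
  rw [extendSubmodule, Submodule.span_eq_bot]
  rintro _ ⟨δ, hδ, rfl⟩
  rw [(Submodule.mem_bot R).1 hδ, map_zero]

theorem projectiveDimension_bot_add_one_ne {S M : Type} [CommRing S] [AddCommGroup M]
    [Module S M] : CategoryTheory.projectiveDimension
      (ModuleCat.of S (⊥ : Submodule S M)) + 1 ≠ ((0 : ℕ) : WithBot ℕ∞) := by
  have h1 : CategoryTheory.projectiveDimension (ModuleCat.of S (⊥ : Submodule S M)) = ⊥ := by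
    rw [CategoryTheory.projectiveDimension_eq_bot_iff, ModuleCat.isZero_iff_subsingleton]
    infer_instance
  rw [h1]
  simp

variable {R S T σ τ : Type} [CommRing R] [CommRing S] [CommRing T] [Algebra ℂ R] [Algebra ℂ S]
  [Algebra ℂ T] [Fintype σ] [Fintype τ] [DecidableEq σ] [DecidableEq τ]
  {dR : σ → Derivation ℂ R R} {dT : τ → Derivation ℂ T T} {dS : σ ⊕ τ → Derivation ℂ S S}
  {xR : σ → R} {xT : τ → T} {xS : σ ⊕ τ → S}
  {φ : R →+* S} {ψ : T →+* S} {c₁ : S →+* MvPowerSeries τ R} {c₂ : S →+* MvPowerSeries σ T}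

/-- The decomposition in all codimensions. Codimension zero is degenerate: the ideals vanish,
and with them all the modules involved. -/
theorem logModule_inf_eq_and_iSupIndep (h₁ : IsProduct dR dS Sum.inl Sum.inr φ ψ c₁)
    (h₂ : IsProduct dT dS Sum.inr Sum.inl ψ φ c₂) (hR : IsCoordinateRing dR xR)
    (hT : IsCoordinateRing dT xT) {k : ℕ} {I₁ : Ideal R} {I₂ : Ideal T} (hI₁ : I₁.IsRadical)
    (hI₂ : I₂.IsRadical) (ht₁ : I₁ ≠ ⊤) (ht₂ : I₂ ≠ ⊤)
    (hk₁ : ∀ p ∈ I₁.minimalPrimes, p.height = k) (hk₂ : ∀ p ∈ I₂.minimalPrimes, p.height = k) :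
    logModule dS (I₁.map φ ⊓ I₂.map ψ) k =
        extendSubmodule φ Sum.inl k (logModule dR I₁ k) ⊔
        extendSubmodule ψ Sum.inr k (logModule dT I₂ k) ⊔ mixed S σ τ k ∧
      iSupIndep ![extendSubmodule φ Sum.inl k (logModule dR I₁ k),
        extendSubmodule ψ Sum.inr k (logModule dT I₂ k), mixed S σ τ k] ∧
      Module.Free S (mixed S σ τ k) := by
  have := hR.isDomain
  have := hT.isDomain
  obtain rfl | hk := eq_or_ne k 0
  · rw [eq_bot_of_height_minimalPrimes_eq_zero ht₁ hk₁,
      eq_bot_of_height_minimalPrimes_eq_zero ht₂ hk₂, Ideal.map_bot, Ideal.map_bot, inf_bot_eq,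
      logModule_bot_zero, logModule_bot_zero, logModule_bot_zero, extendSubmodule_bot,
      extendSubmodule_bot, mixed_zero]
    refine ⟨by simp, ?_, inferInstance⟩
    intro i
    fin_cases i <;> exact disjoint_bot_left
  · have hk' : (k : ℕ∞) ≠ 0 := by exact_mod_cast hk
    exact ⟨logModule_inf_eq h₁ h₂ hk hI₁ hI₂
      (ne_bot_of_height_minimalPrimes_ne_zero ht₁ hk' hk₁)
      (ne_bot_of_height_minimalPrimes_ne_zero ht₂ hk' hk₂),
      iSupIndep_extendSubmodule φ ψ hk _ _, free_mixed S σ τ hk⟩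

/-- Freeness of the union in all codimensions. In codimension zero the modules vanish and both sides
are false. -/
theorem projectiveDimension_logModule_inf_iff (h₁ : IsProduct dR dS Sum.inl Sum.inr φ ψ c₁)
    (h₂ : IsProduct dT dS Sum.inr Sum.inl ψ φ c₂) (hR : IsCoordinateRing dR xR)
    (hT : IsCoordinateRing dT xT) (hS : IsCoordinateRing dS xS) {k : ℕ} {I₁ : Ideal R}
    {I₂ : Ideal T} (hI₁ : I₁.IsRadical) (hI₂ : I₂.IsRadical) (ht₁ : I₁ ≠ ⊤) (ht₂ : I₂ ≠ ⊤)
    (hk₁ : ∀ p ∈ I₁.minimalPrimes, p.height = k) (hk₂ : ∀ p ∈ I₂.minimalPrimes, p.height = k) :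
    CategoryTheory.projectiveDimension
        (ModuleCat.of S (logModule dS (I₁.map φ ⊓ I₂.map ψ) k)) + 1 = k ↔
      CategoryTheory.projectiveDimension (ModuleCat.of R (logModule dR I₁ k)) + 1 = k ∧
      CategoryTheory.projectiveDimension (ModuleCat.of T (logModule dT I₂ k)) + 1 = k := by
  have := hR.isDomain
  have := hT.isDomain
  have := hR.isNoetherianRing
  have := hT.isNoetherianRing
  have := hS.isNoetherianRing
  obtain rfl | hk := eq_or_ne k 0
  · rw [eq_bot_of_height_minimalPrimes_eq_zero ht₁ hk₁,
      eq_bot_of_height_minimalPrimes_eq_zero ht₂ hk₂, Ideal.map_bot, Ideal.map_bot, inf_bot_eq,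
      logModule_bot_zero, logModule_bot_zero, logModule_bot_zero]
    exact ⟨fun h => absurd h projectiveDimension_bot_add_one_ne,
      fun h => absurd h.1 projectiveDimension_bot_add_one_ne⟩
  · have hk' : (k : ℕ∞) ≠ 0 := by exact_mod_cast hk
    rw [hR.projectiveDimension_add_one_eq_iff hI₁ ht₁ hk hk₁,
      hT.projectiveDimension_add_one_eq_iff hI₂ ht₂ hk hk₂,
      hS.projectiveDimension_add_one_eq_iff
        ((h₁.isRadical_map hI₁).inf (h₂.isRadical_map hI₂))
        (ne_top_of_le_ne_top (h₁.map_ne_top ht₁) inf_le_left) hk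
        (fun P hP => height_of_mem_minimalPrimes_inf h₁.toIsExpansion h₂.toIsExpansion hk₁ hk₂ hP)]
    exact hasProjectiveDimensionLT_logModule_inf_iff h₁ h₂ hk hI₁ hI₂
      (ne_bot_of_height_minimalPrimes_ne_zero ht₁ hk' hk₁)
      (ne_bot_of_height_minimalPrimes_ne_zero ht₂ hk' hk₂) hk

end Free

/-! ### Polynomials and convergent power series as coordinate rings -/

section Instances

variable {σ τ ρ : Type}

theorem isCoordinateRing_conv (σ : Type) [Fintype σ] :
    IsCoordinateRing (S := Conv σ) convPDeriv convX where
  isDomain := inferInstance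
  isNoetherianRing := inferInstance
  derivation_apply := conv_derivation_apply
  ringKrullDim_le := ringKrullDim_conv_le σ
  normalAt := normalAt_conv σ

theorem isProduct_conv [Finite σ] [Finite τ] (E : σ ⊕ τ ≃ ρ) {e₁ : σ ↪ ρ} {e₂ : τ ↪ ρ}
    (h₁ : e₁ = Function.Embedding.inl.trans E.toEmbedding)
    (h₂ : e₂ = Function.Embedding.inr.trans E.toEmbedding) :
    IsProduct (R := Conv σ) (S := Conv ρ) (T := Conv τ) convPDeriv convPDeriv e₁ e₂
      (convRename e₁) (convRename e₂) (convExpand E) := by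
  subst h₁ h₂
  exact {
    toIsExpansion := isExpansion_conv E
    deriv_left i r := convPDeriv_convRename (Function.Embedding.inl.trans E.toEmbedding) i r
    deriv_inr_left j r := convPDeriv_convRename_of_notMem _ (by rintro ⟨i, hi⟩; simp at hi) r
    deriv_inl_right i t := convPDeriv_convRename_of_notMem _ (by rintro ⟨j, hj⟩; simp at hj) t
    injective_right := (isExpansion_conv ((Equiv.sumComm τ σ).trans E)).injective_left
    injective_inl := Function.Embedding.injective _
    mem_range_iff r := by obtain ⟨i | j, rfl⟩ := E.surjective r <;> simp }

theorem isCoordinateRing_poly (σ : Type) [Fintype σ] :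
    IsCoordinateRing (S := MvPolynomial σ ℂ) (fun i => MvPolynomial.pderiv i)
      MvPolynomial.X where
  isDomain := inferInstance
  isNoetherianRing := inferInstance
  derivation_apply D f := by
    classical
    have h : D = ∑ i, D (MvPolynomial.X i) • MvPolynomial.pderiv i := by
      refine MvPolynomial.derivation_ext fun j => ?_
      rw [derivation_sum_apply]
      simp [MvPolynomial.pderiv_X, Pi.single_apply]
    conv_lhs => rw [h]
    rw [derivation_sum_apply]
    simp
  ringKrullDim_le := by
    rw [MvPolynomial.ringKrullDim_of_isNoetherianRing]
    simp
  normalAt := normalAt_poly σ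

theorem isProduct_poly [Finite σ] [Finite τ] (E : σ ⊕ τ ≃ ρ) {e₁ : σ ↪ ρ} {e₂ : τ ↪ ρ}
    (h₁ : e₁ = Function.Embedding.inl.trans E.toEmbedding)
    (h₂ : e₂ = Function.Embedding.inr.trans E.toEmbedding) :
    IsProduct (R := MvPolynomial σ ℂ) (S := MvPolynomial ρ ℂ) (T := MvPolynomial τ ℂ)
      (fun i => MvPolynomial.pderiv i) (fun i => MvPolynomial.pderiv i) e₁ e₂
      (MvPolynomial.rename (R := ℂ) e₁).toRingHom (MvPolynomial.rename (R := ℂ) e₂).toRingHom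
      (polySeries E) := by
  classical
  subst h₁ h₂
  exact {
    toIsExpansion := isExpansion_poly E
    deriv_left i r :=
      MvPolynomial.pderiv_rename (Function.Embedding.inl.trans E.toEmbedding).injective i r
    deriv_inr_left j r := by
      refine MvPolynomial.pderiv_eq_zero_of_notMem_vars fun h => ?_
      obtain ⟨i, -, hi⟩ := Finset.mem_image.1 (MvPolynomial.vars_rename _ _ h)
      simp at hi
    deriv_inl_right i t := by
      refine MvPolynomial.pderiv_eq_zero_of_notMem_vars fun h => ?_
      obtain ⟨j, -, hj⟩ := Finset.mem_image.1 (MvPolynomial.vars_rename _ _ h)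
      simp at hj
    injective_right := MvPolynomial.rename_injective _ (Function.Embedding.injective _)
    injective_inl := Function.Embedding.injective _
    mem_range_iff r := by obtain ⟨i | j, rfl⟩ := E.surjective r <;> simp }

end Instances

/-! ### Vanishing ideals: the algebraic case -/

section Algebraic

variable {σ τ ρ : Type}

theorem aeval_eq_eval_polyExpand (E : σ ⊕ τ ≃ ρ) (f : MvPolynomial ρ ℂ) (z : ρ → ℂ) :
    MvPolynomial.aeval z f = MvPolynomial.eval (fun j => z (E (Sum.inr j)))
      (MvPolynomial.map (MvPolynomial.eval fun i => z (E (Sum.inl i))) (polyExpand E f)) := by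
  conv_lhs => rw [← eval₂_polyExpand E f]
  have h1 := MvPolynomial.eval₂_comp_left (MvPolynomial.aeval (R := ℂ) z).toRingHom
    (MvPolynomial.rename (R := ℂ) (Function.Embedding.inl.trans E.toEmbedding)).toRingHom
    (fun j => MvPolynomial.X (E (Sum.inr j))) (polyExpand E f)
  refine h1.trans ?_
  rw [MvPolynomial.eval_map]
  congr 1
  · ext i
    · simp
    · simp
  · ext j
    simp

theorem isRadical_vanishingIdeal (X : Set (σ → ℂ)) :
    (MvPolynomial.vanishingIdeal ℂ X).IsRadical := by
  rintro f ⟨n, hn⟩ x hx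
  have := hn x hx
  rw [map_pow] at this
  exact eq_zero_of_pow_eq_zero this

theorem vanishingIdeal_ne_top {X : Set (σ → ℂ)} (hX : X.Nonempty) :
    MvPolynomial.vanishingIdeal ℂ X ≠ ⊤ := by
  obtain ⟨x, hx⟩ := hX
  intro h
  have := (Ideal.eq_top_iff_one _).1 h x hx
  simp at this

/-- The ideal of a cylinder is generated by the ideal of its base: the coefficients of a
polynomial which vanishes on the cylinder vanish on the base. -/
theorem vanishingIdeal_cylinder [Finite σ] [Finite τ] (E : σ ⊕ τ ≃ ρ) (X : Set (σ → ℂ)) :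
    MvPolynomial.vanishingIdeal ℂ {z : ρ → ℂ | (fun i => z (E (Sum.inl i))) ∈ X} =
      (MvPolynomial.vanishingIdeal ℂ X).map
        (MvPolynomial.rename (R := ℂ) (Function.Embedding.inl.trans E.toEmbedding)).toRingHom := by
  ext f
  rw [(isExpansion_poly E).mem_map_iff, MvPolynomial.mem_vanishingIdeal_iff]
  simp only [coeff_polySeries, MvPolynomial.mem_vanishingIdeal_iff, aeval_eq_eval_polyExpand E]
  constructor
  · intro h α x hx
    have h1 : MvPolynomial.map (MvPolynomial.eval x) (polyExpand E f) = 0 := by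
      refine MvPolynomial.funext fun y => ?_
      have := h (fun r => Sum.elim x y (E.symm r)) (by simpa using hx)
      simpa using this
    have h2 := congrArg (MvPolynomial.coeff α) h1
    rwa [MvPolynomial.coeff_map, MvPolynomial.coeff_zero] at h2
  · intro h z hz
    have h1 : MvPolynomial.map (MvPolynomial.eval fun i => z (E (Sum.inl i))) (polyExpand E f)
        = 0 := by
      ext α
      rw [MvPolynomial.coeff_map, MvPolynomial.coeff_zero]
      exact h α _ hz
    rw [h1, map_zero]

theorem vanishingIdeal_starProd [Finite σ] [Finite τ] (X₁ : Set (σ → ℂ)) (X₂ : Set (τ → ℂ)) :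
    MvPolynomial.vanishingIdeal ℂ (starProd X₁ X₂) =
      (MvPolynomial.vanishingIdeal ℂ X₁).map
        (MvPolynomial.rename (R := ℂ) Function.Embedding.inl).toRingHom ⊓
      (MvPolynomial.vanishingIdeal ℂ X₂).map
        (MvPolynomial.rename (R := ℂ) Function.Embedding.inr).toRingHom := by
  have h1 := vanishingIdeal_cylinder (Equiv.refl (σ ⊕ τ)) X₁
  have h2 := vanishingIdeal_cylinder (Equiv.sumComm τ σ) X₂
  refine Eq.trans ?_ (congrArg₂ _ h1 h2)
  ext f
  exact ⟨fun h => ⟨fun z hz => h z (Or.inl hz), fun z hz => h z (Or.inr hz)⟩,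
    fun h z hz => hz.elim (h.1 z) (h.2 z)⟩

/-- The union of the cylinders is cut out by the products of equations of the two factors. -/
theorem exists_starProd_eq_zeroLocus {X₁ : Set (σ → ℂ)} {X₂ : Set (τ → ℂ)}
    (h₁ : ∃ J : Ideal (MvPolynomial σ ℂ), X₁ = MvPolynomial.zeroLocus ℂ J)
    (h₂ : ∃ J : Ideal (MvPolynomial τ ℂ), X₂ = MvPolynomial.zeroLocus ℂ J) :
    ∃ J : Ideal (MvPolynomial (σ ⊕ τ) ℂ), starProd X₁ X₂ = MvPolynomial.zeroLocus ℂ J := by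
  obtain ⟨J₁, rfl⟩ := h₁
  obtain ⟨J₂, rfl⟩ := h₂
  refine ⟨Ideal.span {f | ∃ a ∈ J₁, ∃ b ∈ J₂,
    f = MvPolynomial.rename Sum.inl a * MvPolynomial.rename Sum.inr b}, ?_⟩
  rw [MvPolynomial.zeroLocus_span]
  ext z
  constructor
  · rintro (hz | hz) _ ⟨a, ha, b, hb, rfl⟩
    · rw [map_mul, MvPolynomial.aeval_rename]
      exact mul_eq_zero_of_left (hz a ha) _
    · rw [map_mul, MvPolynomial.aeval_rename, MvPolynomial.aeval_rename]
      exact mul_eq_zero_of_right _ (hz b hb)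
  · intro hz
    by_contra hn
    obtain ⟨hn₁, hn₂⟩ := not_or.1 hn
    obtain ⟨a, ha, ha0⟩ : ∃ a ∈ J₁, MvPolynomial.aeval (fun i => z (Sum.inl i)) a ≠ 0 := by
      by_contra hc
      push Not at hc
      exact hn₁ hc
    obtain ⟨b, hb, hb0⟩ : ∃ b ∈ J₂, MvPolynomial.aeval (fun i => z (Sum.inr i)) b ≠ 0 := by
      by_contra hc
      push Not at hc
      exact hn₂ hc
    have := hz _ ⟨a, ha, b, hb, rfl⟩
    rw [map_mul, MvPolynomial.aeval_rename, MvPolynomial.aeval_rename] at this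
    exact mul_ne_zero ha0 hb0 this

end Algebraic

/-! ### The identity theorem for convergent power series -/

section Identity

variable {σ τ ρ : Type}

/-- The identity theorem in one variable. -/
theorem eq_zero_of_forall_tsum_eq_zero {a : ℕ → ℂ} {r : ℝ} (hr : 0 < r)
    (hs : Summable fun n => ‖a n‖ * r ^ n) (h : ∀ t : ℂ, ‖t‖ ≤ r → ∑' n, a n * t ^ n = 0) :
    a = 0 := by
  set p := FormalMultilinearSeries.ofScalars ℂ a
  have h1 : ((r.toNNReal : NNReal) : ENNReal) ≤ p.radius := by
    refine p.le_radius_of_summable_norm (hs.congr fun n => ?_)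
    rw [FormalMultilinearSeries.ofScalars_norm, Real.coe_toNNReal r hr.le]
  have h2 : 0 < p.radius := lt_of_lt_of_le (by simpa using hr) h1
  have h3 : p = 0 := by
    refine (p.hasFPowerSeriesOnBall h2).hasFPowerSeriesAt.eq_zero_of_eventually ?_
    filter_upwards [Metric.closedBall_mem_nhds (0 : ℂ) hr] with t ht
    have := h t (by simpa using ht)
    have h4 := FormalMultilinearSeries.ofScalars_sum_eq (E := ℂ) a t
    rw [FormalMultilinearSeries.ofScalarsSum] at h4
    rw [h4]
    simpa using this
  exact (FormalMultilinearSeries.ofScalars_series_eq_zero ℂ (c := a)).1 h3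

theorem prod_smul_pow (m : τ →₀ ℕ) (t : ℂ) (y : τ → ℂ) :
    (m.prod fun j a => (t * y j) ^ a) = t ^ m.degree * m.prod fun j a => y j ^ a := by
  simp only [Finsupp.prod, mul_pow, Finset.prod_mul_distrib, Finset.prod_pow_eq_pow_sum]
  rfl

/-- A power series which converges absolutely on a polydisc and vanishes there is zero: on each
line through the origin, the homogeneous parts are the coefficients of a power series in one
variable. -/
theorem eq_zero_of_forall_evalSeries_eq_zero [Finite τ] {g : MvPowerSeries τ ℂ} {r : ℝ}
    (hr : 0 < r) (hs : Summable fun m : τ →₀ ℕ => ‖MvPowerSeries.coeff m g‖ * r ^ m.degree)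
    (h : ∀ y : τ → ℂ, (∀ j, ‖y j‖ ≤ r) → evalSeries g y = 0) : g = 0 := by
  classical
  cases nonempty_fintype τ
  set s : ℕ → Finset (τ →₀ ℕ) := fun d =>
    (Finsupp.finite_of_degree_le (σ := τ) d).toFinset.filter fun α => α.degree = d with hs_def
  have hmem : ∀ d α, α ∈ s d ↔ α.degree = d := fun d α => by
    simp only [hs_def, Finset.mem_filter, Set.Finite.mem_toFinset, Set.mem_ofPred_eq]
    exact ⟨fun h => h.2, fun h => ⟨h.le, h⟩⟩
  have hfib : ∀ d, (Finsupp.degree : (τ →₀ ℕ) → ℕ) ⁻¹' {d} = ↑(s d) := fun d => by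
    ext α
    exact (hmem d α).symm
  have key : ∀ (y : τ → ℂ) (d : ℕ),
      ∑ α ∈ s d, MvPowerSeries.coeff α g * α.prod (fun j a => y j ^ a) = 0 := by
    intro y
    set M : ℝ := 1 + ∑ j, ‖y j‖ with hM
    have hM0 : 0 < M := by positivity
    have hyM : ∀ j, ‖y j‖ ≤ M := fun j => by
      have := Finset.single_le_sum (f := fun j => ‖y j‖) (fun j _ => norm_nonneg _)
        (Finset.mem_univ j)
      linarith
    set F : (τ →₀ ℕ) → ℂ := fun α => MvPowerSeries.coeff α g * α.prod fun j a => y j ^ a with hF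
    have hsum : Summable fun α : τ →₀ ℕ => ‖F α‖ * (r / M) ^ α.degree := by
      refine hs.of_nonneg_of_le (fun α => by positivity) fun α => ?_
      have h1 := norm_monomial_le hyM α
      calc ‖F α‖ * (r / M) ^ α.degree
          ≤ ‖MvPowerSeries.coeff α g‖ * M ^ α.degree * (r / M) ^ α.degree := by
            rw [hF, norm_mul]
            gcongr
        _ = ‖MvPowerSeries.coeff α g‖ * r ^ α.degree := by
            rw [mul_assoc, ← mul_pow, mul_div_cancel₀ _ hM0.ne']
    have h0 := eq_zero_of_forall_tsum_eq_zero (a := fun d => ∑ α ∈ s d, F α) (r := r / M)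
      (by positivity) ?_ ?_
    · exact fun d => congrFun h0 d
    · refine (hsum.hasSum.tsum_fiberwise Finsupp.degree).summable.of_nonneg_of_le
        (fun d => by positivity) fun d => ?_
      rw [hfib, Finset.tsum_subtype' (s d) fun α : τ →₀ ℕ => ‖F α‖ * (r / M) ^ α.degree]
      refine (mul_le_mul_of_nonneg_right (norm_sum_le _ _) (by positivity)).trans (le_of_eq ?_)
      rw [Finset.sum_mul]
      exact Finset.sum_congr rfl fun α hα => by rw [(hmem d α).1 hα]
    · intro t ht
      have h1 : ∀ α : τ →₀ ℕ, MvPowerSeries.coeff α g * (α.prod fun j a => (t * y j) ^ a) =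
          F α * t ^ α.degree := fun α => by
        rw [prod_smul_pow, hF]; ring
      have h2 : Summable fun α : τ →₀ ℕ => F α * t ^ α.degree := by
        refine Summable.of_norm (hsum.of_nonneg_of_le (fun α => norm_nonneg _) fun α => ?_)
        rw [norm_mul, norm_pow]
        gcongr
      have h3 : ∑' α : τ →₀ ℕ, F α * t ^ α.degree = 0 := by
        refine (tsum_congr fun α => (h1 α).symm).trans (h (fun j => t * y j) fun j => ?_)
        rw [norm_mul]
        calc ‖t‖ * ‖y j‖ ≤ r / M * M := by
              gcongr
              exact hyM j
          _ = r := div_mul_cancel₀ _ hM0.ne'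
      rw [← h3, ← (h2.hasSum.tsum_fiberwise Finsupp.degree).tsum_eq]
      refine tsum_congr fun d => ?_
      rw [hfib, Finset.tsum_subtype' (s d) fun α : τ →₀ ℕ => F α * t ^ α.degree, Finset.sum_mul]
      exact Finset.sum_congr rfl fun α hα => by rw [(hmem d α).1 hα]
  refine MvPowerSeries.ext fun α => ?_
  have h1 : ∑ β ∈ s α.degree, MvPolynomial.monomial β (MvPowerSeries.coeff β g) = 0 := by
    refine MvPolynomial.funext fun y => ?_
    rw [map_sum, map_zero, ← key y α.degree]
    exact Finset.sum_congr rfl fun β _ => MvPolynomial.eval_monomial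
  have h2 := congrArg (MvPolynomial.coeff α) h1
  rw [MvPolynomial.coeff_sum, MvPolynomial.coeff_zero] at h2
  simp only [MvPolynomial.coeff_monomial] at h2
  rw [Finset.sum_ite_eq', if_pos ((hmem _ _).2 rfl)] at h2
  rw [h2, map_zero]

end Identity

/-! ### Vanishing ideals: the local analytic case -/

section Germ

variable {σ τ ρ : Type}

theorem prod_expEquiv (E : σ ⊕ τ ≃ ρ) (m : σ →₀ ℕ) (α : τ →₀ ℕ) (z : ρ → ℂ) :
    ((expEquiv E (m, α)).prod fun r a => z r ^ a) =
      (m.prod fun i a => z (E (Sum.inl i)) ^ a) * α.prod fun j a => z (E (Sum.inr j)) ^ a := by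
  classical
  rw [expEquiv_eq_add, Finsupp.prod_add_index' (by simp) (by intro i a b; exact pow_add _ _ _),
    Finsupp.prod_embDomain, Finsupp.prod_embDomain]
  rfl

theorem evalSeries_rename (e : σ ↪ τ) (f : MvPowerSeries σ ℂ) (z : τ → ℂ) :
    evalSeries (MvPowerSeries.rename e f) z = evalSeries f fun i => z (e i) := by
  have h1 := (Finsupp.embDomain_injective e).tsum_eq (f := fun m : τ →₀ ℕ =>
    MvPowerSeries.coeff m (MvPowerSeries.rename e f) * m.prod fun i a => z i ^ a) (by
      intro m hm
      by_contra hm'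
      refine hm (mul_eq_zero_of_left (MvPowerSeries.coeff_rename_eq_zero _ _ ?_) _)
      rintro ⟨x, rfl⟩
      exact hm' ⟨x, Finsupp.embDomain_eq_mapDomain e x⟩)
  rw [evalSeries, evalSeries, ← h1]
  refine tsum_congr fun m => ?_
  rw [MvPowerSeries.coeff_embDomain_rename, Finsupp.prod_embDomain]

theorem tendsto_comp_zero (e : σ → τ) :
    Tendsto (fun z : τ → ℂ => fun i => z (e i)) (𝓝 0) (𝓝 0) := by
  have : Continuous fun z : τ → ℂ => fun i => z (e i) := by fun_prop
  exact this.tendsto 0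

/-- If a convergent power series vanishes at all points `(x, y)` close to the origin with `x ∈ X`,
then its coefficients, as a series in `y`, vanish on `X` close to the origin. -/
theorem evalSeries_convPart_eq_zero [Finite τ] (E : σ ⊕ τ ≃ ρ) {f : Conv ρ} {r : ℝ} (hr : 0 < r)
    (hf : Summable fun m : ρ →₀ ℕ => ‖MvPowerSeries.coeff m f.1‖ * r ^ m.degree) {x : σ → ℂ}
    (hx : ∀ i, ‖x i‖ ≤ r)
    (h : ∀ z : ρ → ℂ, (∀ i, z (E (Sum.inl i)) = x i) → (∀ j, ‖z (E (Sum.inr j))‖ ≤ r) →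
      evalSeries f.1 z = 0) (α : τ →₀ ℕ) : evalSeries (convPart E f α).1 x = 0 := by
  set ε : (τ →₀ ℕ) × (σ →₀ ℕ) ≃ (ρ →₀ ℕ) := (Equiv.prodComm _ _).trans (expEquiv E).toEquiv
  have hε : ∀ p, ε p = expEquiv E (p.2, p.1) := fun p => rfl
  have hs : Summable fun p : (τ →₀ ℕ) × (σ →₀ ℕ) =>
      ‖MvPowerSeries.coeff p.2 (convPart E f p.1).1‖ * r ^ p.2.degree * r ^ p.1.degree := by
    refine (ε.summable_iff.2 hf).congr fun p => ?_
    rw [Function.comp_apply, hε, degree_expEquiv, pow_add, coeff_convPart, mul_assoc]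
  set b : MvPowerSeries τ ℂ := fun β => evalSeries (convPart E f β).1 x with hb
  have hbc : ∀ β, MvPowerSeries.coeff β b = evalSeries (convPart E f β).1 x := fun β => rfl
  have hle : ∀ p : (τ →₀ ℕ) × (σ →₀ ℕ),
      ‖MvPowerSeries.coeff p.2 (convPart E f p.1).1 * p.2.prod fun i a => x i ^ a‖ ≤
        ‖MvPowerSeries.coeff p.2 (convPart E f p.1).1‖ * r ^ p.2.degree := fun p => by
    rw [norm_mul]
    gcongr
    exact norm_monomial_le hx p.2
  have hs1 : Summable fun p : (τ →₀ ℕ) × (σ →₀ ℕ) =>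
      ‖MvPowerSeries.coeff p.2 (convPart E f p.1).1 * p.2.prod fun i a => x i ^ a‖ *
        r ^ p.1.degree :=
    hs.of_nonneg_of_le (fun p => by positivity) fun p =>
      mul_le_mul_of_nonneg_right (hle p) (by positivity)
  have hb0 : b = 0 := by
    refine eq_zero_of_forall_evalSeries_eq_zero hr ?_ fun y hy => ?_
    · refine hs1.prod.of_nonneg_of_le (fun β => by positivity) fun β => ?_
      change _ ≤ ∑' m : σ →₀ ℕ, ‖MvPowerSeries.coeff m (convPart E f β).1 *
        m.prod fun i a => x i ^ a‖ * r ^ β.degree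
      have h1 : Summable fun m : σ →₀ ℕ =>
          ‖MvPowerSeries.coeff m (convPart E f β).1 * m.prod fun i a => x i ^ a‖ :=
        (summable_mul_right_iff (pow_pos hr β.degree).ne').1 (hs1.prod_factor β)
      rw [tsum_mul_right]
      exact mul_le_mul_of_nonneg_right (norm_tsum_le_tsum_norm h1) (pow_nonneg hr.le _)
    · set z : ρ → ℂ := fun t => Sum.elim x y (E.symm t)
      have hzl : ∀ i, z (E (Sum.inl i)) = x i := fun i => by simp [z]
      have hzr : ∀ j, z (E (Sum.inr j)) = y j := fun j => by simp [z]
      have h1 := h z hzl fun j => (hzr j).symm ▸ hy j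
      have h2 : ∀ p : (τ →₀ ℕ) × (σ →₀ ℕ), MvPowerSeries.coeff (ε p) f.1 *
          ((ε p).prod fun t a => z t ^ a) =
          (MvPowerSeries.coeff p.2 (convPart E f p.1).1 * p.2.prod fun i a => x i ^ a) *
            p.1.prod fun j a => y j ^ a := fun p => by
        rw [hε, prod_expEquiv, coeff_convPart, mul_assoc]
        simp only [hzl, hzr]
      have h3 : Summable fun p : (τ →₀ ℕ) × (σ →₀ ℕ) =>
          (MvPowerSeries.coeff p.2 (convPart E f p.1).1 * p.2.prod fun i a => x i ^ a) *
            p.1.prod fun j a => y j ^ a := by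
        refine Summable.of_norm (hs1.of_nonneg_of_le (fun p => norm_nonneg _) fun p => ?_)
        rw [norm_mul]
        gcongr
        exact norm_monomial_le hy p.1
      rw [evalSeries, ← ε.tsum_eq, tsum_congr h2, h3.tsum_prod] at h1
      rw [evalSeries, ← h1]
      refine tsum_congr fun β => ?_
      exact tsum_mul_right.symm
  rw [← hbc, hb0, map_zero]

theorem evalSeries_one (x : σ → ℂ) : evalSeries (1 : MvPowerSeries σ ℂ) x = 1 := by
  classical
  rw [evalSeries, tsum_eq_single 0 fun m hm => by
    rw [MvPowerSeries.coeff_one, if_neg hm, zero_mul]]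
  simp

variable [Fintype σ]

theorem mem_germIdeal {X : Set (σ → ℂ)} {f : Conv σ} :
    f ∈ germIdeal X ↔ ∀ᶠ x in 𝓝 (0 : σ → ℂ), x ∈ X → evalSeries f.1 x = 0 := Iff.rfl

/-- The ideal of a cylinder is generated by the ideal of its base. -/
theorem germIdeal_cylinder [Finite τ] [Fintype ρ] (E : σ ⊕ τ ≃ ρ) (X : Set (σ → ℂ)) :
    germIdeal {z : ρ → ℂ | (fun i => z (E (Sum.inl i))) ∈ X} =
      (germIdeal X).map (convRename (Function.Embedding.inl.trans E.toEmbedding)) := by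
  apply le_antisymm
  · intro f hf
    rw [(isExpansion_conv E).mem_map_iff]
    intro α
    obtain ⟨r, hr, hs⟩ := f.2
    obtain ⟨s, hs0, hsf⟩ := Metric.eventually_nhds_iff_ball.1 hf
    have hrs : 0 < min r (s / 2) := lt_min hr (half_pos hs0)
    filter_upwards [Metric.closedBall_mem_nhds (0 : σ → ℂ) hrs] with x hx hxX
    have hx' : ∀ i, ‖x i‖ ≤ min r (s / 2) := fun i =>
      (norm_le_pi_norm x i).trans (by simpa using hx)
    refine evalSeries_convPart_eq_zero E hrs (summable_mono hrs.le (min_le_left _ _) hs) hx'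
      (fun z hzx hzy => hsf z ?_ ?_) α
    · rw [mem_ball_zero_iff]
      refine lt_of_le_of_lt ((pi_norm_le_iff_of_nonneg hrs.le).2 fun t => ?_)
        ((min_le_right r (s / 2)).trans_lt (half_lt_self hs0))
      obtain ⟨i | j, rfl⟩ := E.surjective t
      · rw [hzx]; exact hx' i
      · exact hzy j
    · change (fun i => z (E (Sum.inl i))) ∈ X
      rwa [show (fun i => z (E (Sum.inl i))) = x from funext hzx]
  · refine Ideal.map_le_iff_le_comap.2 fun f hf => ?_
    have h1 := (tendsto_comp_zero fun i => E (Sum.inl i)).eventually (mem_germIdeal.1 hf)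
    filter_upwards [h1] with z hz hzX
    exact (evalSeries_rename (Function.Embedding.inl.trans E.toEmbedding) f.1 z).trans (hz hzX)

theorem germIdeal_starProd [Fintype τ] (X₁ : Set (σ → ℂ)) (X₂ : Set (τ → ℂ)) :
    germIdeal (starProd X₁ X₂) = (germIdeal X₁).map (convRename Function.Embedding.inl) ⊓
      (germIdeal X₂).map (convRename Function.Embedding.inr) := by
  have h1 := germIdeal_cylinder (Equiv.refl (σ ⊕ τ)) X₁
  have h2 := germIdeal_cylinder (Equiv.sumComm τ σ) X₂
  refine Eq.trans ?_ (congrArg₂ _ h1 h2)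
  ext f
  rw [Submodule.mem_inf, mem_germIdeal, mem_germIdeal, mem_germIdeal, ← eventually_and]
  refine eventually_congr (Eventually.of_forall fun z => ?_)
  exact ⟨fun h => ⟨fun hz => h (Or.inl hz), fun hz => h (Or.inr hz)⟩,
    fun h hz => hz.elim h.1 h.2⟩

theorem eventually_evalSeries_pow (f : Conv σ) (n : ℕ) :
    ∀ᶠ x : σ → ℂ in 𝓝 0, evalSeries (f ^ (n + 1)).1 x = evalSeries f.1 x ^ (n + 1) := by
  induction n with
  | zero => exact Eventually.of_forall fun x => by rw [zero_add, pow_one, pow_one]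
  | succ n ih =>
    filter_upwards [ih, eventually_evalSeries_mul (f ^ (n + 1)).2 f.2] with x h1 h2
    rw [pow_succ f, pow_succ (evalSeries f.1 x), ← h1]
    exact h2

theorem isRadical_germIdeal (X : Set (σ → ℂ)) : (germIdeal X).IsRadical := by
  rintro f ⟨n, hn⟩
  have hn' : f ^ (n + 1) ∈ germIdeal X := by
    rw [pow_succ']
    exact Ideal.mul_mem_left _ _ hn
  filter_upwards [mem_germIdeal.1 hn', eventually_evalSeries_pow f n] with x h1 h2 hx
  exact eq_zero_of_pow_eq_zero (h2.symm.trans (h1 hx))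

theorem germIdeal_ne_top {X : Set (σ → ℂ)} (hX : (0 : σ → ℂ) ∈ X) : germIdeal X ≠ ⊤ := by
  intro h
  have h1 := ((Ideal.eq_top_iff_one _).1 h : (1 : Conv σ) ∈ germIdeal X)
  have h2 : evalSeries (1 : MvPowerSeries σ ℂ) (0 : σ → ℂ) = 0 :=
    (mem_germIdeal.1 h1).self_of_nhds hX
  rw [evalSeries_one] at h2
  exact one_ne_zero h2

/-- The union of the cylinders is cut out by the products of equations of the two factors. -/
theorem exists_starProd_analytic [Fintype τ] {X₁ : Set (σ → ℂ)} {X₂ : Set (τ → ℂ)}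
    (h₁ : ∃ F : Finset (Conv σ), ∀ᶠ x in 𝓝 (0 : σ → ℂ), x ∈ X₁ ↔ ∀ f ∈ F, evalSeries f.1 x = 0)
    (h₂ : ∃ F : Finset (Conv τ), ∀ᶠ x in 𝓝 (0 : τ → ℂ), x ∈ X₂ ↔ ∀ f ∈ F, evalSeries f.1 x = 0) :
    ∃ F : Finset (Conv (σ ⊕ τ)), ∀ᶠ z in 𝓝 (0 : σ ⊕ τ → ℂ),
      z ∈ starProd X₁ X₂ ↔ ∀ f ∈ F, evalSeries f.1 z = 0 := by
  classical
  obtain ⟨F₁, hF₁⟩ := h₁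
  obtain ⟨F₂, hF₂⟩ := h₂
  refine ⟨Finset.image₂ (fun f g => convRename Function.Embedding.inl f *
    convRename Function.Embedding.inr g) F₁ F₂, ?_⟩
  have hmul : ∀ᶠ z in 𝓝 (0 : σ ⊕ τ → ℂ), ∀ f ∈ F₁, ∀ g ∈ F₂,
      evalSeries (convRename Function.Embedding.inl f * convRename Function.Embedding.inr g :
        Conv (σ ⊕ τ)).1 z =
      evalSeries f.1 (fun i => z (Sum.inl i)) * evalSeries g.1 fun j => z (Sum.inr j) := by
    rw [Filter.eventually_all_finset]
    intro f _
    rw [Filter.eventually_all_finset]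
    intro g _
    filter_upwards [eventually_evalSeries_mul (convRename Function.Embedding.inl f :
      Conv (σ ⊕ τ)).2 (convRename Function.Embedding.inr g : Conv (σ ⊕ τ)).2] with z hz
    exact hz.trans (congrArg₂ _ (evalSeries_rename _ _ _) (evalSeries_rename _ _ _))
  filter_upwards [hmul, (tendsto_comp_zero (Sum.inl : σ → σ ⊕ τ)).eventually hF₁,
    (tendsto_comp_zero (Sum.inr : τ → σ ⊕ τ)).eventually hF₂] with z hz h1 h2
  rw [Finset.forall_mem_image₂]
  change _ ∈ X₁ ∨ _ ∈ X₂ ↔ _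
  rw [h1, h2]
  constructor
  · rintro (h | h) f hf g hg
    · rw [hz f hf g hg, h f hf, zero_mul]
    · rw [hz f hf g hg, h g hg, mul_zero]
  · intro h
    by_contra hn
    push Not at hn
    obtain ⟨⟨f, hf, hf0⟩, g, hg, hg0⟩ := hn
    exact mul_ne_zero hf0 hg0 ((hz f hf g hg).symm.trans (h f hf g hg))

end Germ

/-! ### The two cases of the decomposition -/

theorem derLogGerm_starProd {σ τ : Type} [Fintype σ] [Fintype τ] [DecidableEq σ]
    [DecidableEq τ] {k : ℕ} {X₁ : Set (σ → ℂ)} {X₂ : Set (τ → ℂ)}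
    (hX₁ : IsEquidimGerm X₁ k) (hX₂ : IsEquidimGerm X₂ k) :
    (derLogGerm (starProd X₁ X₂) k =
        extDerLogGerm Function.Embedding.inl X₁ k ⊔
        extDerLogGerm Function.Embedding.inr X₂ k ⊔ mixed (Conv (σ ⊕ τ)) σ τ k ∧
      iSupIndep ![extDerLogGerm Function.Embedding.inl X₁ k,
        extDerLogGerm Function.Embedding.inr X₂ k, mixed (Conv (σ ⊕ τ)) σ τ k] ∧
      Module.Free (Conv (σ ⊕ τ)) (mixed (Conv (σ ⊕ τ)) σ τ k)) ∧
    (IsFreeGerm (starProd X₁ X₂) k ↔ IsFreeGerm X₁ k ∧ IsFreeGerm X₂ k) := by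
  have h₁ := isProduct_conv (Equiv.refl (σ ⊕ τ)) (e₁ := Function.Embedding.inl)
    (e₂ := Function.Embedding.inr) rfl rfl
  have h₂ := isProduct_conv (Equiv.sumComm τ σ) (e₁ := Function.Embedding.inr)
    (e₂ := Function.Embedding.inl) rfl rfl
  have hr₁ := isRadical_germIdeal X₁
  have hr₂ := isRadical_germIdeal X₂
  have ht₁ := germIdeal_ne_top hX₁.zero_mem
  have ht₂ := germIdeal_ne_top hX₂.zero_mem
  have hI := germIdeal_starProd X₁ X₂
  have hX : IsEquidimGerm (starProd X₁ X₂) k :=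
    { analytic := exists_starProd_analytic hX₁.analytic hX₂.analytic
      zero_mem := Or.inl hX₁.zero_mem
      height := by
        rw [hI]
        exact fun P hP => height_of_mem_minimalPrimes_inf h₁.toIsExpansion
          h₂.toIsExpansion hX₁.height hX₂.height hP }
  have hdec := logModule_inf_eq_and_iSupIndep h₁ h₂
    (isCoordinateRing_conv σ) (isCoordinateRing_conv τ) hr₁ hr₂
    ht₁ ht₂ hX₁.height hX₂.height
  have hpd := projectiveDimension_logModule_inf_iff h₁ h₂
    (isCoordinateRing_conv σ) (isCoordinateRing_conv τ)
    (isCoordinateRing_conv (σ ⊕ τ)) hr₁ hr₂ ht₁ ht₂ hX₁.height hX₂.height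
  have hD : derLogGerm (starProd X₁ X₂) k = logModule convPDeriv
      ((germIdeal X₁).map (convRename Function.Embedding.inl) ⊓
        (germIdeal X₂).map (convRename Function.Embedding.inr)) k :=
    congrArg (fun I => logModule convPDeriv I k) hI
  have hpd' : CategoryTheory.projectiveDimension
      (ModuleCat.of (Conv (σ ⊕ τ)) (derLogGerm (starProd X₁ X₂) k)) + 1 = k ↔
      CategoryTheory.projectiveDimension (ModuleCat.of (Conv σ) (derLogGerm X₁ k)) + 1 = k ∧
        CategoryTheory.projectiveDimension (ModuleCat.of (Conv τ) (derLogGerm X₂ k)) + 1 = k := by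
    rw [hD]
    exact hpd
  refine ⟨⟨hD.trans hdec.1, hdec.2⟩, fun h => ?_, fun h => ⟨hX, hpd'.2 ⟨h.1.2, h.2.2⟩⟩⟩
  exact ⟨⟨hX₁, (hpd'.1 h.2).1⟩, hX₂, (hpd'.1 h.2).2⟩

theorem derLogAlg_starProd {σ τ : Type} [Fintype σ] [Fintype τ] [DecidableEq σ]
    [DecidableEq τ] {k : ℕ} {X₁ : Set (σ → ℂ)} {X₂ : Set (τ → ℂ)}
    (hX₁ : IsEquidimAlg X₁ k) (hX₂ : IsEquidimAlg X₂ k) :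
    (derLogAlg (starProd X₁ X₂) k =
        extDerLogAlg Function.Embedding.inl X₁ k ⊔
        extDerLogAlg Function.Embedding.inr X₂ k ⊔ mixed (MvPolynomial (σ ⊕ τ) ℂ) σ τ k ∧
      iSupIndep ![extDerLogAlg Function.Embedding.inl X₁ k,
        extDerLogAlg Function.Embedding.inr X₂ k, mixed (MvPolynomial (σ ⊕ τ) ℂ) σ τ k] ∧
      Module.Free (MvPolynomial (σ ⊕ τ) ℂ) (mixed (MvPolynomial (σ ⊕ τ) ℂ) σ τ k)) ∧
    (IsFreeAlg (starProd X₁ X₂) k ↔ IsFreeAlg X₁ k ∧ IsFreeAlg X₂ k) := by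
  have h₁ := isProduct_poly (Equiv.refl (σ ⊕ τ)) (e₁ := Function.Embedding.inl)
    (e₂ := Function.Embedding.inr) rfl rfl
  have h₂ := isProduct_poly (Equiv.sumComm τ σ) (e₁ := Function.Embedding.inr)
    (e₂ := Function.Embedding.inl) rfl rfl
  have hr₁ := isRadical_vanishingIdeal X₁
  have hr₂ := isRadical_vanishingIdeal X₂
  have ht₁ := vanishingIdeal_ne_top hX₁.nonempty
  have ht₂ := vanishingIdeal_ne_top hX₂.nonempty
  have hI := vanishingIdeal_starProd X₁ X₂
  have hX : IsEquidimAlg (starProd X₁ X₂) k :=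
    { algebraic := exists_starProd_eq_zeroLocus hX₁.algebraic hX₂.algebraic
      nonempty := by
        obtain ⟨x, hx⟩ := hX₁.nonempty
        exact ⟨Sum.elim x 0, Or.inl hx⟩
      height := by
        rw [hI]
        exact fun P hP => height_of_mem_minimalPrimes_inf h₁.toIsExpansion
          h₂.toIsExpansion hX₁.height hX₂.height hP }
  have hdec := logModule_inf_eq_and_iSupIndep h₁ h₂
    (isCoordinateRing_poly σ) (isCoordinateRing_poly τ) hr₁ hr₂
    ht₁ ht₂ hX₁.height hX₂.height
  have hpd := projectiveDimension_logModule_inf_iff h₁ h₂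
    (isCoordinateRing_poly σ) (isCoordinateRing_poly τ)
    (isCoordinateRing_poly (σ ⊕ τ)) hr₁ hr₂ ht₁ ht₂ hX₁.height hX₂.height
  have hD : derLogAlg (starProd X₁ X₂) k = logModule (fun i => MvPolynomial.pderiv i)
      ((MvPolynomial.vanishingIdeal ℂ X₁).map
          (MvPolynomial.rename (R := ℂ) Function.Embedding.inl).toRingHom ⊓
        (MvPolynomial.vanishingIdeal ℂ X₂).map
          (MvPolynomial.rename (R := ℂ) Function.Embedding.inr).toRingHom) k :=
    congrArg (fun I => logModule (fun i => MvPolynomial.pderiv i) I k) hI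
  have hpd' : CategoryTheory.projectiveDimension
      (ModuleCat.of (MvPolynomial (σ ⊕ τ) ℂ) (derLogAlg (starProd X₁ X₂) k)) + 1 = k ↔
      CategoryTheory.projectiveDimension
          (ModuleCat.of (MvPolynomial σ ℂ) (derLogAlg X₁ k)) + 1 = k ∧
        CategoryTheory.projectiveDimension
          (ModuleCat.of (MvPolynomial τ ℂ) (derLogAlg X₂ k)) + 1 = k := by
    rw [hD]
    exact hpd
  refine ⟨⟨hD.trans hdec.1, hdec.2⟩, fun h => ?_, fun h => ⟨hX, hpd'.2 ⟨h.1.2, h.2.2⟩⟩⟩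
  exact ⟨⟨hX₁, (hpd'.1 h.2).1⟩, hX₂, (hpd'.1 h.2).2⟩

end LogProd

end

theorem mainTheorem4 (n₁ n₂ k : ℕ) (X₁ : Set (Fin n₁ → ℂ)) (X₂ : Set (Fin n₂ → ℂ)) :
    -- the local analytic case, over convergent power series
    (LogProd.IsEquidimGerm X₁ k → LogProd.IsEquidimGerm X₂ k →
      (LogProd.derLogGerm (LogProd.starProd X₁ X₂) k =
          LogProd.extDerLogGerm Function.Embedding.inl X₁ k ⊔
          LogProd.extDerLogGerm Function.Embedding.inr X₂ k ⊔
          LogProd.mixed (LogProd.Conv (Fin n₁ ⊕ Fin n₂)) (Fin n₁) (Fin n₂) k ∧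
        iSupIndep ![LogProd.extDerLogGerm Function.Embedding.inl X₁ k,
          LogProd.extDerLogGerm Function.Embedding.inr X₂ k,
          LogProd.mixed (LogProd.Conv (Fin n₁ ⊕ Fin n₂)) (Fin n₁) (Fin n₂) k] ∧
        Module.Free (LogProd.Conv (Fin n₁ ⊕ Fin n₂))
          (LogProd.mixed (LogProd.Conv (Fin n₁ ⊕ Fin n₂)) (Fin n₁) (Fin n₂) k)) ∧
      (LogProd.IsFreeGerm (LogProd.starProd X₁ X₂) k ↔
        LogProd.IsFreeGerm X₁ k ∧ LogProd.IsFreeGerm X₂ k)) ∧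
    -- the algebraic case, over polynomials
    (LogProd.IsEquidimAlg X₁ k → LogProd.IsEquidimAlg X₂ k →
      (LogProd.derLogAlg (LogProd.starProd X₁ X₂) k =
          LogProd.extDerLogAlg Function.Embedding.inl X₁ k ⊔
          LogProd.extDerLogAlg Function.Embedding.inr X₂ k ⊔
          LogProd.mixed (MvPolynomial (Fin n₁ ⊕ Fin n₂) ℂ) (Fin n₁) (Fin n₂) k ∧
        iSupIndep ![LogProd.extDerLogAlg Function.Embedding.inl X₁ k,
          LogProd.extDerLogAlg Function.Embedding.inr X₂ k,
          LogProd.mixed (MvPolynomial (Fin n₁ ⊕ Fin n₂) ℂ) (Fin n₁) (Fin n₂) k] ∧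
        Module.Free (MvPolynomial (Fin n₁ ⊕ Fin n₂) ℂ)
          (LogProd.mixed (MvPolynomial (Fin n₁ ⊕ Fin n₂) ℂ) (Fin n₁) (Fin n₂) k)) ∧
      (LogProd.IsFreeAlg (LogProd.starProd X₁ X₂) k ↔
        LogProd.IsFreeAlg X₁ k ∧ LogProd.IsFreeAlg X₂ k)) := by
  exact ⟨LogProd.derLogGerm_starProd, LogProd.derLogAlg_starProd⟩
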